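/- **Setting.** For $\sigma>0$ and $\theta\in(0,1)$ let $\mathcal G=\{z\in\mathbb C^{\mathbb Z} : \|z\|_\sigma:=2\sum_{a\in\mathbb Z}e^{\sigma|a|^\theta}|z_a|<\infty\}$, regarded as a real normed space, and let $\mathbb B(0,s)$ be its open ball of radius $s$ centred at $0$. Let $(u,v)_{L^2}=\mathrm{Re}\sum_a u_a\overline{v_a}$. A differentiable map $\Psi$ from an open set $\mathcal O\subset\mathcal G$ to $\mathcal G$ is called symplectic if $(\mathbf i\,\mathrm d\Psi(z)v,\mathrm d\Psi(z)w)_{L^2}=(\mathbf i v,w)_{L^2}$ for all $z\in\mathcal O$ and $v,w\in\mathcal G$. For a $C^1$ function $P$ on $\mathcal O$, its Hamiltonian vector field is the sequence $(X_P(z))_a=\mathbf i\,\partial_{\overline{z_a}}P(z)$, where $2\partial_{\overline{z_a}}=\partial_{\mathrm{Re}\,z_a}+\mathbf i\,\partial_{\mathrm{Im}\,z_a}$. For $m\ge1$ let $\mathcal M_m$ be the set of $\boldsymbol j=(\delta_\alpha,a_\alpha)_{\alpha=1}^{2m}\in(\{-1,1\}\times\mathbb Z)^{2m}$ with $\sum_\alpha\delta_\alpha=0$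 and $\sum_\alpha\delta_\alpha a_\alpha=0$, and let $\mathcal R_m$ be the set of those $\boldsymbol j\in\mathcal M_m$ that also satisfy $\sum_\alpha\delta_\alpha a_\alpha^2=0$. Put $z_{(1,a)}=z_a$, $z_{(-1,a)}=\overline{z_a}$ and $z_{\boldsymbol j}=\prod_{\alpha=1}^{2m} z_{j_\alpha}$. Let $\mathcal H_m$ be the space of polynomials $P(z)=\sum_{\boldsymbol j\in\mathcal M_m}P_{\boldsymbol j}z_{\boldsymbol j}$ whose complex coefficients are invariant under permutations of the $2m$ entries of $\boldsymbol j$, satisfy $\overline{P_{\boldsymbol j}}=P_{\overline{\boldsymbol j}}$ (where $\overline{\boldsymbol j}=(-\delta_\alpha,a_\alpha)_\alpha$), and are bounded: $\|P\|_{\ell^\infty}:=\sup_{\boldsymbol j\in\mathcal M_m}|P_{\boldsymbol j}|<\infty$. Let $\mathcal H_m^{\mathcal R}$ be the subspace of those $P$ with $P_{\boldsymbol j}=0$ for $\boldsymbol j\notin\mathcal R_m$. The Hamiltonian of the Schrödinger–Poisson equation on the circle is $$H(z)=L_2(z)+\sum_{\substack{a_1+a_2=b_1+b_2\\ a_1\ne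 b_1}}\frac{1}{2(a_1-b_1)^2}\,z_{a_1}z_{a_2}\overline{z_{b_1}}\,\overline{z_{b_2}},\qquad L_2(z)=\sum_{a\in\mathbb Z}a^2|z_a|^2 .$$ **Proposition 3.1 (Bnormalform).** There exists a constant $C\ge2^8$ (independent of $\sigma$, $\theta$ and $r$) such that for all $\sigma>0$, $\theta\in(0,1)$ and all integers $r\ge2$, setting $\rho=\frac{1}{8Cr}$, there are two $C^\infty$ symplectic maps $\phi_{(0)}:\mathbb B(0,\rho)\to\mathbb B(0,2\rho)$ and $\phi_{(1)}:\mathbb B(0,2\rho)\to\mathcal G$ with $\phi_{(1)}\circ\phi_{(0)}=\mathrm{id}$ on $\mathbb B(0,\rho)$ such that on $\mathbb B(0,2\rho)$ $$H\circ\phi_{(1)}=L_2+L_4+\sum_{m=3}^rK_{2m}+R,\qquad L_4(z)=\sum_{a_1\ne a_2}\frac{1}{2(a_1-a_2)^2}|z_{a_1}|^2|z_{a_2}|^2 .$$ Here, with $K_4:=L_4$, one has $K_{2m}\in\mathcal H_m^{\mathcal R}$ and $\|K_{2m}\|_{\ell^\infty}\le C^{2m-3}m^{2(m-2)}$ for all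 $2\le m\le r$. The remainder $R:\mathbb B(0,2\rho)\to\mathbb R$ is a $C^\infty$ function whose Hamiltonian vector field takes values in $\mathcal G$ and satisfies $$\|X_R(z)\|_\sigma\le C^{4r-1}r^{2r}\|z\|_\sigma^{2r+1}\qquad\text{for all } z\in\mathbb B(0,2\rho).$$ Furthermore, for $\iota\in\{0,1\}$, $$\|\phi_{(\iota)}(z)-z\|_\sigma\le C^2\|z\|_\sigma^3\qquad\text{for all } z\in\mathbb B(0,(1+\iota)\rho).$$ -/

import Mathlib

open scoped ContDiff ComplexConjugate

noncomputable section

/-! ### The Gevrey space -/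

/-- The Gevrey weight `e^{σ |a|^θ}`. -/
def gevreyWeight (σ θ : ℝ) (a : ℤ) : ℝ := Real.exp (σ * |(a : ℝ)| ^ θ)

lemma gevreyWeight_pos (σ θ : ℝ) (a : ℤ) : 0 < gevreyWeight σ θ a := Real.exp_pos _

/-- Sequences `z : ℤ → ℂ` with `∑ₐ e^{σ |a|^θ} |zₐ| < ∞`, as a real vector space. -/
def gevreySubmodule (σ θ : ℝ) : Submodule ℝ (ℤ → ℂ) where
  carrier := {z | Summable fun a => gevreyWeight σ θ a * ‖z a‖}
  zero_mem' := by simp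
  add_mem' := by
    intro x y hx hy
    refine Summable.of_nonneg_of_le
      (fun a => mul_nonneg (gevreyWeight_pos σ θ a).le (norm_nonneg _)) (fun a => ?_) (hx.add hy)
    rw [← mul_add]
    exact mul_le_mul_of_nonneg_left (norm_add_le _ _) (gevreyWeight_pos σ θ a).le
  smul_mem' := by
    intro c x hx
    have h := Summable.mul_left |c| hx
    refine h.congr fun a => ?_
    simp only [Pi.smul_apply, norm_smul, Real.norm_eq_abs]
    ring

/-- The Gevrey space `𝒢`; it is normed below by `‖z‖_σ = 2 ∑ₐ e^{σ |a|^θ} |zₐ|`.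
(A separate type, so that it does not inherit the topology of pointwise convergence.) -/
def Gevrey (σ θ : ℝ) : Type := gevreySubmodule σ θ

namespace Gevrey

variable {σ θ : ℝ}

instance : AddCommGroup (Gevrey σ θ) := inferInstanceAs (AddCommGroup (gevreySubmodule σ θ))

instance : Module ℝ (Gevrey σ θ) := inferInstanceAs (Module ℝ (gevreySubmodule σ θ))

/-- An element of `𝒢` is the sequence of its Fourier coefficients. -/
instance : CoeFun (Gevrey σ θ) (fun _ => ℤ → ℂ) := ⟨fun z => z.1⟩

/-- `‖z‖_σ = 2 ∑ₐ e^{σ |a|^θ} |zₐ|`. -/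
instance : Norm (Gevrey σ θ) := ⟨fun z => 2 * ∑' a : ℤ, gevreyWeight σ θ a * ‖z a‖⟩

lemma norm_def (z : Gevrey σ θ) : ‖z‖ = 2 * ∑' a : ℤ, gevreyWeight σ θ a * ‖z a‖ := rfl

lemma summable (z : Gevrey σ θ) : Summable fun a => gevreyWeight σ θ a * ‖z a‖ := z.2

@[simp] lemma add_apply (x y : Gevrey σ θ) (a : ℤ) : (x + y) a = x a + y a := rfl

@[simp] lemma smul_apply (c : ℝ) (x : Gevrey σ θ) (a : ℤ) : (c • x) a = c • x a := rfl

@[simp] lemma zero_apply (a : ℤ) : (0 : Gevrey σ θ) a = 0 := rfl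

lemma normedSpaceCore : NormedSpace.Core ℝ (Gevrey σ θ) where
  norm_nonneg z := by
    rw [norm_def]
    exact mul_nonneg (by norm_num)
      (tsum_nonneg fun a => mul_nonneg (gevreyWeight_pos σ θ a).le (norm_nonneg _))
  norm_smul c z := by
    have h : ∀ a, gevreyWeight σ θ a * ‖(c • z) a‖ = ‖c‖ * (gevreyWeight σ θ a * ‖z a‖) := by
      intro a
      rw [smul_apply, norm_smul]
      ring
    simp only [norm_def, h, tsum_mul_left]
    ring
  norm_triangle x y := by
    simp only [norm_def]
    rw [← mul_add, ← (summable x).tsum_add (summable y)]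
    refine mul_le_mul_of_nonneg_left ?_ (by norm_num)
    refine (summable (x + y)).tsum_le_tsum (fun a => ?_) ((summable x).add (summable y))
    rw [← mul_add]
    exact mul_le_mul_of_nonneg_left (norm_add_le _ _) (gevreyWeight_pos σ θ a).le
  norm_eq_zero_iff z := by
    constructor
    · intro h
      rw [norm_def] at h
      have h0 : ∑' a : ℤ, gevreyWeight σ θ a * ‖z a‖ = 0 := by linarith
      have h1 := (hasSum_zero_iff_of_nonneg
        (fun a => mul_nonneg (gevreyWeight_pos σ θ a).le (norm_nonneg (z a)))).1
        (h0 ▸ (summable z).hasSum)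
      refine Subtype.ext (funext fun a => ?_)
      have h2 := congrFun h1 a
      simp only [Pi.zero_apply, mul_eq_zero, norm_eq_zero] at h2
      exact h2.resolve_left (gevreyWeight_pos σ θ a).ne'
    · rintro rfl
      simp [norm_def]

instance : NormedAddCommGroup (Gevrey σ θ) := NormedAddCommGroup.ofCore normedSpaceCore

instance : NormedSpace ℝ (Gevrey σ θ) := NormedSpace.ofCore normedSpaceCore

/-- The sequence with the single Fourier coefficient `c` at the frequency `a`. -/
def single (a : ℤ) (c : ℂ) : Gevrey σ θ :=
  ⟨Pi.single a c, by
    refine summable_of_ne_finset_zero (s := {a}) fun b hb => ?_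
    have : b ≠ a := by simpa using hb
    simp [this]⟩

/-! ### Differential calculus and symplectic structure -/

/-- `∂_{\bar zₐ} P = (∂_{Re zₐ} P + i ∂_{Im zₐ} P) / 2`. -/
def dzbar (P : Gevrey σ θ → ℂ) (z : Gevrey σ θ) (a : ℤ) : ℂ :=
  (fderiv ℝ P z (single a 1) + Complex.I * fderiv ℝ P z (single a Complex.I)) / 2

/-- The Hamiltonian vector field, `(X_P(z))ₐ = i ∂_{\bar zₐ} P(z)`, a priori only a sequence. -/
def hamVF (P : Gevrey σ θ → ℂ) (z : Gevrey σ θ) : ℤ → ℂ :=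
  fun a => Complex.I * dzbar P z a

/-- The real `L²` scalar product `Re ∑ₐ uₐ \bar vₐ`. -/
def l2Inner (u v : ℤ → ℂ) : ℝ := (∑' a : ℤ, u a * conj (v a)).re

/-- `Ψ` is symplectic on `O`: `(i dΨ(z)v, dΨ(z)w) = (i v, w)` for `z ∈ O` and `v, w ∈ 𝒢`. -/
def IsSymplecticOn (Ψ : Gevrey σ θ → Gevrey σ θ) (O : Set (Gevrey σ θ)) : Prop :=
  ∀ z ∈ O, ∀ v w : Gevrey σ θ,
    l2Inner (fun a => Complex.I * (fderiv ℝ Ψ z v) a) (fderiv ℝ Ψ z w)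
      = l2Inner (fun a => Complex.I * v a) w

end Gevrey

/-! ### Multi-indices and polynomials -/

/-- Multi-indices of length `2m` with entries `(δ, a) ∈ {-1, 1} × ℤ`. -/
abbrev MIdx (m : ℕ) : Type := Fin (2 * m) → ℤˣ × ℤ

/-- The conjugate multi-index: `(δ, a) ↦ (-δ, a)` in each entry. -/
def MIdx.conj {m : ℕ} (j : MIdx m) : MIdx m := fun α => (-(j α).1, (j α).2)

/-- `𝓜ₘ`: the multi-indices with `∑ δ_α = 0` and `∑ δ_α a_α = 0`. -/
def momentumSet (m : ℕ) : Set (MIdx m) :=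
  {j | ∑ α, ((j α).1 : ℤ) = 0 ∧ ∑ α, ((j α).1 : ℤ) * (j α).2 = 0}

/-- `𝓡ₘ`: the `j ∈ 𝓜ₘ` with `∑ δ_α a_α² = 0`. -/
def resonantSet (m : ℕ) : Set (MIdx m) :=
  {j | j ∈ momentumSet m ∧ ∑ α, ((j α).1 : ℤ) * (j α).2 ^ 2 = 0}

/-- `z_{(1, a)} = zₐ` and `z_{(-1, a)} = \bar zₐ`. -/
def signedCoord (z : ℤ → ℂ) (j : ℤˣ × ℤ) : ℂ := if j.1 = 1 then z j.2 else conj (z j.2)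

/-- The monomial `z_j = z_{j₁} ⋯ z_{j_{2m}}`. -/
def monomialEval {m : ℕ} (z : ℤ → ℂ) (j : MIdx m) : ℂ := ∏ α, signedCoord z (j α)

/-- The space `𝓗ₘ` of homogeneous polynomials of degree `2m`, given by their coefficients on `𝓜ₘ`
(extended by zero to all multi-indices). -/
structure HPoly (m : ℕ) where
  coeff : MIdx m → ℂ
  support : ∀ j, j ∉ momentumSet m → coeff j = 0
  reality : ∀ j, conj (coeff j) = coeff j.conj
  symmetry : ∀ (j : MIdx m) (φ : Equiv.Perm (Fin (2 * m))), coeff (j ∘ φ) = coeff j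
  bounded : BddAbove (Set.range fun j => ‖coeff j‖)

namespace HPoly

variable {m : ℕ}

/-- `P(z) = ∑_{j ∈ 𝓜ₘ} P_j z_j`. -/
def eval (P : HPoly m) (z : ℤ → ℂ) : ℂ := ∑' j : momentumSet m, P.coeff j * monomialEval z j.1

/-- `‖P‖_{ℓ^∞} = sup_{j ∈ 𝓜ₘ} |P_j|`. -/
def supNorm (P : HPoly m) : ℝ := ⨆ j : momentumSet m, ‖P.coeff j‖

/-- `P` is resonant: `P_j ≠ 0` only if `j` is resonant. -/
def IsResonant (P : HPoly m) : Prop := ∀ j, P.coeff j ≠ 0 → j ∈ resonantSet m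

end HPoly

/-! ### The Schrödinger–Poisson Hamiltonian -/

namespace NLSP

/-- `L₂(z) = ∑ₐ a² |zₐ|²`. -/
def L2 (z : ℤ → ℂ) : ℝ := ∑' a : ℤ, (a : ℝ) ^ 2 * ‖z a‖ ^ 2

/-- The quadruples `(a₁, a₂, b₁, b₂)` with `a₁ + a₂ = b₁ + b₂` and `a₁ ≠ b₁`. -/
def quartets : Set (ℤ × ℤ × ℤ × ℤ) :=
  {(a₁, a₂, b₁, b₂) : ℤ × ℤ × ℤ × ℤ | a₁ + a₂ = b₁ + b₂ ∧ a₁ ≠ b₁}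

/-- `P₄(z) = ∑ z_{a₁} z_{a₂} \bar z_{b₁} \bar z_{b₂} / (2 (a₁ - b₁)²)` over the quadruples above. -/
def P4 (z : ℤ → ℂ) : ℂ :=
  ∑' q : quartets, match q.1 with
    | (a₁, a₂, b₁, b₂) =>
      1 / (2 * ((a₁ : ℂ) - (b₁ : ℂ)) ^ 2) * z a₁ * z a₂ * conj (z b₁) * conj (z b₂)

/-- The Hamiltonian `H = L₂ + P₄`. -/
def H (z : ℤ → ℂ) : ℂ := (L2 z : ℂ) + P4 z

/-- `L₄(z) = ∑_{a₁ ≠ a₂} |z_{a₁}|² |z_{a₂}|² / (2 (a₁ - a₂)²)`. -/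
def L4 (z : ℤ → ℂ) : ℝ :=
  ∑' p : {p : ℤ × ℤ // p.1 ≠ p.2},
    1 / (2 * ((p.1.1 : ℝ) - (p.1.2 : ℝ)) ^ 2) * ‖z p.1.1‖ ^ 2 * ‖z p.1.2‖ ^ 2

end NLSP

end

/-!
A single Lie transform puts `H` in normal form up to degree `2 r`. The coefficients of its
polynomial generator are chosen degree by degree: transporting `L₂ + P₄` along the flow produces in
each degree an obstruction built from the lower degrees, plus the bracket of `L₂` with the new
part of the generator. That bracket multiplies the coefficient of `𝐣` by `i ∑ δ_α a_α²`, up to sign,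
and `∑ δ_α a_α²` is an integer which vanishes exactly on resonant tuples. The nonresonant part of
the obstruction is therefore removed without small divisors, and the resonant part is kept.

In `ℓ^∞` a Poisson bracket of zero-momentum polynomials costs only the product of their degrees, so
a majorant argument bounds all coefficients by a geometric growth of ratio `64 (n + 1)²`, where
`r = n + 1`. Since `a ↦ |a|^θ` is subadditive, the vector field of a bounded zero-momentum
polynomial maps the Gevrey space smoothly to itself, and its time-one flow is symplectic.
-/

open scoped ENNReal NNReal

universe u

noncomputable section

/-! ### The weighted `ℓ¹` space -/

lemma one_le_gevreyWeight {σ θ : ℝ} (hσ : 0 ≤ σ) (a : ℤ) : 1 ≤ gevreyWeight σ θ a :=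
  Real.one_le_exp (mul_nonneg hσ (Real.rpow_nonneg (abs_nonneg _) _))

lemma gevreyWeight_neg (σ θ : ℝ) (a : ℤ) : gevreyWeight σ θ (-a) = gevreyWeight σ θ a := by
  simp [gevreyWeight]

lemma gevreyWeight_add_le {σ θ : ℝ} (hσ : 0 ≤ σ) (hθ : 0 ≤ θ) (hθ1 : θ ≤ 1) (a b : ℤ) :
    gevreyWeight σ θ (a + b) ≤ gevreyWeight σ θ a * gevreyWeight σ θ b := by
  unfold gevreyWeight
  rw [← Real.exp_add, Real.exp_le_exp, ← mul_add, Int.cast_add]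
  gcongr
  calc |(a : ℝ) + b| ^ θ ≤ (|(a : ℝ)| + |(b : ℝ)|) ^ θ := by gcongr; exact abs_add_le _ _
    _ ≤ |(a : ℝ)| ^ θ + |(b : ℝ)| ^ θ :=
        Real.rpow_add_le_add_rpow (abs_nonneg _) (abs_nonneg _) hθ hθ1

lemma gevreyWeight_sum_le {σ θ : ℝ} (hσ : 0 ≤ σ) (hθ : 0 < θ) (hθ1 : θ ≤ 1) {ι : Type*}
    (s : Finset ι) (f : ι → ℤ) :
    gevreyWeight σ θ (∑ i ∈ s, f i) ≤ ∏ i ∈ s, gevreyWeight σ θ (f i) := by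
  classical
  induction s using Finset.induction_on with
  | empty => simp [gevreyWeight, Real.zero_rpow hθ.ne']
  | insert i s hi ih =>
    rw [Finset.sum_insert hi, Finset.prod_insert hi]
    exact (gevreyWeight_add_le hσ hθ.le hθ1 _ _).trans
      (mul_le_mul_of_nonneg_left ih (gevreyWeight_pos _ _ _).le)

lemma exists_sq_le_gevreyWeight {σ θ : ℝ} (hσ : 0 < σ) (hθ : 0 < θ) :
    ∃ B : ℝ, ∀ a : ℤ, (a : ℝ) ^ 2 ≤ B * gevreyWeight σ θ a := by
  obtain ⟨n, hn⟩ := exists_nat_ge (2 / θ)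
  refine ⟨n.factorial / σ ^ n, fun a => ?_⟩
  rcases eq_or_ne a 0 with rfl | ha
  · have := gevreyWeight_pos σ θ 0
    rw [Int.cast_zero, zero_pow two_ne_zero]
    positivity
  have h1 : (1 : ℝ) ≤ |(a : ℝ)| := by exact_mod_cast Int.one_le_abs ha
  have hsq : (a : ℝ) ^ 2 ≤ (|(a : ℝ)| ^ θ) ^ n := by
    rw [← sq_abs, ← Real.rpow_natCast, ← Real.rpow_natCast (_ ^ θ), ← Real.rpow_mul (abs_nonneg _)]
    refine Real.rpow_le_rpow_of_exponent_le h1 ?_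
    rwa [div_le_iff₀' hθ] at hn
  have hexp := Real.pow_div_factorial_le_exp (x := σ * |(a : ℝ)| ^ θ) (by positivity) n
  rw [div_le_iff₀ (by positivity), mul_pow] at hexp
  rw [div_mul_eq_mul_div, le_div_iff₀ (by positivity), gevreyWeight]
  calc (a : ℝ) ^ 2 * σ ^ n ≤ (|(a : ℝ)| ^ θ) ^ n * σ ^ n := by gcongr
    _ ≤ n.factorial * Real.exp (σ * |(a : ℝ)| ^ θ) := by linarith

namespace Gevrey

section Space

variable {σ θ : ℝ}

@[ext] lemma ext {x y : Gevrey σ θ} (h : ∀ a, x a = y a) : x = y := Subtype.ext (funext h)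

lemma weight_mul_norm_le (z : Gevrey σ θ) (a : ℤ) : 2 * (gevreyWeight σ θ a * ‖z a‖) ≤ ‖z‖ := by
  rw [norm_def]
  gcongr
  exact (summable z).le_tsum a fun b _ =>
    mul_nonneg (gevreyWeight_pos σ θ b).le (norm_nonneg _)

lemma norm_single (a : ℤ) (c : ℂ) : ‖(single a c : Gevrey σ θ)‖ = 2 * gevreyWeight σ θ a * ‖c‖ := by
  rw [norm_def, tsum_eq_single a]
  · simp [single, mul_assoc]
  · intro b hb
    simp [single, hb]

lemma single_apply (a b : ℤ) (c : ℂ) : (single a c : Gevrey σ θ) b = if b = a then c else 0 := by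
  simp [single, Pi.single_apply]

/-- The coordinate `z ↦ zₐ`, as a continuous linear form. -/
def coeffL (a : ℤ) : Gevrey σ θ →L[ℝ] ℂ :=
  LinearMap.mkContinuous
    { toFun := fun z => z a
      map_add' := fun _ _ => rfl
      map_smul' := fun _ _ => rfl } (2 * gevreyWeight σ θ a)⁻¹ (fun z => by
        have hw := gevreyWeight_pos σ θ a
        rw [inv_mul_eq_div, le_div_iff₀' (by positivity), mul_assoc]
        exact weight_mul_norm_le z a)

@[simp] lemma coeffL_apply (a : ℤ) (z : Gevrey σ θ) : coeffL a z = z a := rfl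

/-- The inclusion `c ↦ single a c` of one Fourier mode, as a continuous linear map. -/
def singleL (a : ℤ) : ℂ →L[ℝ] Gevrey σ θ :=
  LinearMap.mkContinuous
    { toFun := fun c => single a c
      map_add' := fun c d => by ext b; simp only [single_apply, add_apply]; split_ifs <;> simp
      map_smul' := fun c d => by
        ext b; simp only [single_apply, smul_apply, RingHom.id_apply]; split_ifs <;> simp }
    (2 * gevreyWeight σ θ a) (fun c => (norm_single a c).le)

lemma norm_singleL_le (a : ℤ) : ‖(singleL a : ℂ →L[ℝ] Gevrey σ θ)‖ ≤ 2 * gevreyWeight σ θ a :=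
  LinearMap.mkContinuous_norm_le _ (by have := gevreyWeight_pos σ θ a; positivity) _

lemma two_mul_weight_ne_zero (σ θ : ℝ) (a : ℤ) : (2 * gevreyWeight σ θ a : ℝ) ≠ 0 :=
  mul_ne_zero two_ne_zero (gevreyWeight_pos σ θ a).ne'

lemma norm_weight_smul (a : ℤ) (c : ℂ) :
    ‖(2 * gevreyWeight σ θ a : ℝ) • c‖ = 2 * (gevreyWeight σ θ a * ‖c‖) := by
  have := gevreyWeight_pos σ θ a
  rw [norm_smul, Real.norm_of_nonneg (by positivity), mul_assoc]

/-- The isometry `z ↦ (2 e^{σ |a|^θ} zₐ)ₐ` of the Gevrey space onto `ℓ¹(ℤ, ℂ)`. -/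
def toLp : Gevrey σ θ ≃ₗᵢ[ℝ] lp (fun _ : ℤ => ℂ) 1 where
  toFun z := ⟨fun a => (2 * gevreyWeight σ θ a : ℝ) • z a, by
    refine (memℓp_gen_iff (by norm_num)).2 (((summable z).mul_left 2).congr fun a => ?_)
    rw [ENNReal.toReal_one, Real.rpow_one, norm_weight_smul]⟩
  invFun f := ⟨fun a => (2 * gevreyWeight σ θ a : ℝ)⁻¹ • f a, by
    refine (((memℓp_gen_iff (by norm_num)).1 (lp.memℓp f)).mul_left (1 / 2)).congr fun a => ?_
    have h := norm_weight_smul (σ := σ) (θ := θ) a ((2 * gevreyWeight σ θ a : ℝ)⁻¹ • f a)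
    rw [smul_inv_smul₀ (two_mul_weight_ne_zero σ θ a)] at h
    rw [ENNReal.toReal_one, Real.rpow_one]
    linarith⟩
  left_inv z := by
    ext a
    exact inv_smul_smul₀ (two_mul_weight_ne_zero σ θ a) (z a)
  right_inv f := by
    ext a
    exact smul_inv_smul₀ (two_mul_weight_ne_zero σ θ a) (f a)
  map_add' x y := by ext a; exact smul_add _ (x a) (y a)
  map_smul' c x := by ext a; exact smul_comm _ c (x a)
  norm_map' z := by
    rw [lp.norm_eq_tsum_rpow (by norm_num), norm_def, ← tsum_mul_left]
    simp only [ENNReal.toReal_one, Real.rpow_one, div_one]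
    exact tsum_congr fun a => norm_weight_smul a (z a)

instance : CompleteSpace (Gevrey σ θ) :=
  (completeSpace_congr (e := (toLp (σ := σ) (θ := θ)).toEquiv)
    toLp.isometry.isUniformEmbedding).2 inferInstance

end Space

end Gevrey

/-! ### Smooth time-one flows -/

section Superposition

variable {K : Type*} [TopologicalSpace K] [CompactSpace K]
variable {E F : Type u} [NormedAddCommGroup E] [NormedSpace ℝ E] [NormedAddCommGroup F]
  [NormedSpace ℝ F]

/-- The pointwise action `(A · γ)(t) = A(t) γ(t)` of an operator-valued map on a vector-valued
map. -/
def pointwiseApplyL : C(K, E →L[ℝ] F) →L[ℝ] C(K, E) →L[ℝ] C(K, F) :=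
  LinearMap.mkContinuous₂
    (LinearMap.mk₂ ℝ (fun (A : C(K, E →L[ℝ] F)) (γ : C(K, E)) =>
        (⟨fun t => A t (γ t), A.continuous.clm_apply γ.continuous⟩ : C(K, F)))
      (fun _ _ _ => rfl) (fun _ _ _ => rfl) (fun A γ η => by ext t; exact map_add (A t) _ _)
      (fun c A γ => by ext t; exact map_smul (A t) c _)) 1
    (fun A γ => by
      rw [one_mul]
      refine (ContinuousMap.norm_le _ (by positivity)).2 fun t => ?_
      exact (A t).le_of_opNorm_le_of_le (A.norm_coe_le_norm t) (γ.norm_coe_le_norm t))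

lemma hasFDerivAt_superposition {X : C(E, F)} {DX : C(E, E →L[ℝ] F)}
    (hX : ∀ x, HasFDerivAt X (DX x) x) (γ : C(K, E)) :
    HasFDerivAt (fun η : C(K, E) => X.comp η) (pointwiseApplyL (DX.comp γ)) γ := by
  refine HasFDerivAt.of_isLittleO (Asymptotics.isLittleO_iff.2 fun ε hε => ?_)
  obtain ⟨δ, hδ, hDX⟩ := Metric.continuous_iff (α := C(K, E)) (β := C(K, E →L[ℝ] F)).1
    DX.continuous_postcomp γ ε hε
  filter_upwards [Metric.ball_mem_nhds γ hδ] with η hη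
  refine (ContinuousMap.norm_le _ (by positivity)).2 fun t => ?_
  have hsegment : ∀ y ∈ segment ℝ (γ t) (η t), ‖DX y - DX (γ t)‖ ≤ ε := by
    intro y hy
    obtain ⟨s, hs, rfl⟩ := (segment_eq_image' ℝ (γ t) (η t)).subset hy
    have hmem : γ + s • (η - γ) ∈ Metric.ball γ δ :=
      (convex_ball γ δ).add_smul_sub_mem (Metric.mem_ball_self hδ) hη hs
    rw [← dist_eq_norm]
    exact (ContinuousMap.dist_apply_le_dist t).trans (hDX _ hmem).le
  refine ((convex_segment (γ t) (η t)).norm_image_sub_le_of_norm_hasFDerivWithin_le'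
    (fun y _ => (hX y).hasFDerivWithinAt) hsegment (left_mem_segment ℝ _ _)
    (right_mem_segment ℝ _ _)).trans ?_
  gcongr
  exact (η - γ).norm_coe_le_norm t

lemma contDiff_superposition_nat (n : ℕ) {F : Type u} [NormedAddCommGroup F] [NormedSpace ℝ F]
    {X : C(E, F)} (hX : ContDiff ℝ n X) : ContDiff ℝ n fun η : C(K, E) => X.comp η := by
  induction n generalizing F with
  | zero => exact contDiff_zero.2 X.continuous_postcomp
  | succ n ih =>
    obtain ⟨DX, hDX, hderiv⟩ := contDiff_succ_iff_hasFDerivAt.1 (by exact_mod_cast hX)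
    let DX' : C(E, E →L[ℝ] F) := ⟨DX, hDX.continuous⟩
    have := contDiff_succ_iff_hasFDerivAt.2 ⟨_,
      (pointwiseApplyL (K := K) (E := E) (F := F)).contDiff.comp (ih (X := DX') hDX),
      hasFDerivAt_superposition (DX := DX') hderiv⟩
    exact_mod_cast this

lemma contDiff_superposition {X : C(E, F)} (hX : ContDiff ℝ ∞ X) :
    ContDiff ℝ ∞ fun η : C(K, E) => X.comp η :=
  contDiff_infty.2 fun n => contDiff_superposition_nat n (contDiff_infty.1 hX n)

end Superposition

section PerturbationOfIdentity

variable {E : Type*} [NormedAddCommGroup E] [NormedSpace ℝ E] {G : E → E} {c : NNReal}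

lemma approximatesLinearOn_id_sub {s : Set E} (hG : LipschitzOnWith c G s) :
    ApproximatesLinearOn (fun x => x - G x)
      (ContinuousLinearEquiv.refl ℝ E : E →L[ℝ] E) s c := by
  intro x hx y hy
  have : x - G x - (y - G y) - (x - y) = G y - G x := by abel
  rw [ContinuousLinearEquiv.coe_refl, ContinuousLinearMap.id_apply, this, norm_sub_rev]
  exact hG.norm_sub_le hx hy

lemma exists_contDiffOn_rightInverse_id_sub [CompleteSpace E] {S : ℝ} (hc : c < 1) (hS : 0 < S)
    (hG : ContDiff ℝ ∞ G) (h0 : G 0 = 0) (hlip : LipschitzOnWith c G (Metric.ball 0 S)) :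
    ∃ Φ : E → E, ContDiffOn ℝ ∞ Φ (Metric.ball 0 ((1 - c) * S)) ∧
      ∀ y ∈ Metric.ball 0 ((1 - c) * S), Φ y ∈ Metric.ball 0 S ∧ Φ y - G (Φ y) = y := by
  have hc' : (0 : ℝ) < 1 - c := sub_pos.2 (by exact_mod_cast hc)
  rcases subsingleton_or_nontrivial E with hE | hE
  · exact ⟨id, contDiffOn_id, fun y _ =>
      ⟨Subsingleton.elim 0 y ▸ Metric.mem_ball_self hS, Subsingleton.elim _ _⟩⟩
  have hN : ‖((ContinuousLinearEquiv.refl ℝ E).symm : E →L[ℝ] E)‖₊ = 1 :=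
    NNReal.eq ContinuousLinearMap.norm_id
  have happrox := approximatesLinearOn_id_sub hlip
  have hcN : Subsingleton E ∨ c < ‖((ContinuousLinearEquiv.refl ℝ E).symm : E →L[ℝ] E)‖₊⁻¹ :=
    Or.inr (by rwa [hN, inv_one])
  let e := happrox.toOpenPartialHomeomorph _ _ hcN Metric.isOpen_ball
  have htarget : Metric.ball 0 ((1 - c) * S) ⊆ e.target := by
    intro y hy
    rw [mem_ball_zero_iff, mul_comm, ← div_lt_iff₀ hc'] at hy
    refine happrox.closedBall_subset_target hcN Metric.isOpen_ball (b := 0) (by positivity)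
      (Metric.closedBall_subset_ball hy) ?_
    rw [hN, h0, sub_zero, mem_closedBall_zero_iff, inv_one, NNReal.coe_one,
      mul_div_cancel₀ _ hc'.ne']
  have hsource : ∀ y ∈ Metric.ball 0 ((1 - c) * S), e.symm y ∈ Metric.ball 0 S :=
    fun y hy => e.map_target (htarget hy)
  refine ⟨e.symm, fun y hy => ContDiffAt.contDiffWithinAt ?_,
    fun y hy => ⟨hsource y hy, e.right_inv (htarget hy)⟩⟩
  have hd := ((hG.differentiable (by simp)) (e.symm y)).hasFDerivAt
  have hnorm : ‖fderiv ℝ G (e.symm y)‖ < 1 :=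
    (hd.le_of_lipschitzOn (Metric.isOpen_ball.mem_nhds (hsource y hy)) hlip).trans_lt
      (by exact_mod_cast hc)
  have hde : HasFDerivAt e (ContinuousLinearEquiv.ofUnit (Units.oneSub _ hnorm) : E →L[ℝ] E)
      (e.symm y) := (hasFDerivAt_id (e.symm y)).sub hd
  exact e.contDiffAt_symm (htarget hy) hde (contDiff_id.sub hG).contDiffAt

end PerturbationOfIdentity

section Flow

variable {E : Type*} [NormedAddCommGroup E]

/-- A curve on the unit interval, extended to the real line by constants. -/
abbrev extendCurve (γ : C(unitInterval, E)) : ℝ → E := Set.IccExtend zero_le_one γ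

lemma continuous_extendCurve (γ : C(unitInterval, E)) : Continuous (extendCurve γ) :=
  γ.continuous.Icc_extend'

variable [NormedSpace ℝ E]

/-- The operator `γ ↦ (t ↦ ∫₀ᵗ γ)` on curves. -/
def primitiveL : C(unitInterval, E) →L[ℝ] C(unitInterval, E) :=
  LinearMap.mkContinuous
    { toFun := fun γ => ⟨fun t => ∫ s in (0 : ℝ)..t, extendCurve γ s,
        (intervalIntegral.continuous_primitive
          (fun _ _ => (continuous_extendCurve γ).intervalIntegrable _ _) 0).comp
          continuous_subtype_val⟩
      map_add' := fun γ η => by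
        ext t
        exact intervalIntegral.integral_add ((continuous_extendCurve γ).intervalIntegrable _ _)
          ((continuous_extendCurve η).intervalIntegrable _ _)
      map_smul' := fun c γ => by
        ext t
        exact intervalIntegral.integral_smul c (extendCurve γ) } 1 (fun γ => by
      rw [ContinuousMap.norm_le _ (by positivity)]
      intro t
      refine (intervalIntegral.norm_integral_le_of_norm_le_const
        (fun s _ => γ.norm_coe_le_norm _)).trans ?_
      rw [sub_zero, abs_of_nonneg t.2.1, mul_comm]
      exact mul_le_mul_of_nonneg_right t.2.2 (norm_nonneg _))

lemma primitiveL_apply (γ : C(unitInterval, E)) (t : unitInterval) :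
    primitiveL γ t = ∫ s in (0 : ℝ)..t, extendCurve γ s := rfl

lemma norm_primitiveL_le (γ : C(unitInterval, E)) : ‖primitiveL γ‖ ≤ ‖γ‖ :=
  (primitiveL (E := E) |>.le_of_opNorm_le (LinearMap.mkContinuous_norm_le _ zero_le_one _) γ)
    |>.trans_eq (one_mul _)

lemma eq_const_add_primitiveL_iff [CompleteSpace E] {γ η : C(unitInterval, E)} {x : E} :
    γ = ContinuousMap.const unitInterval x + primitiveL η ↔ γ 0 = x ∧
      ∀ t ∈ Set.Icc (0 : ℝ) 1,
        HasDerivWithinAt (extendCurve γ) (extendCurve η t) (Set.Icc 0 1) t := by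
  constructor
  · rintro rfl
    refine ⟨by simp [primitiveL_apply], fun t ht => ?_⟩
    have hderiv := ((continuous_extendCurve η).integral_hasStrictDerivAt 0 t).hasDerivAt.const_add x
    refine hderiv.hasDerivWithinAt.congr_of_mem (fun s hs => ?_) ht
    rw [extendCurve, Set.IccExtend_of_mem _ _ hs]
    rfl
  · rintro ⟨rfl, hγ⟩
    ext t
    have hFTC := intervalIntegral.integral_eq_sub_of_hasDerivAt_of_le t.2.1
      (continuous_extendCurve γ).continuousOn (fun s hs =>
        (hγ s ⟨hs.1.le, hs.2.le.trans t.2.2⟩).hasDerivAt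
          (Icc_mem_nhds hs.1 (hs.2.trans_le t.2.2)))
      ((continuous_extendCurve η).intervalIntegrable _ _)
    rw [ContinuousMap.add_apply, ContinuousMap.const_apply, primitiveL_apply, hFTC, extendCurve,
      Set.IccExtend_val, Set.IccExtend_left]
    exact (add_sub_cancel _ _).symm

/-- `γ` is the trajectory of the vector field `X` over the time interval `[0, 1]` that starts at
`x`. -/
structure IsTrajectory (X : C(E, E)) (x : E) (γ : C(unitInterval, E)) : Prop where
  initial : γ 0 = x
  integralCurve : IsIntegralCurveOn (extendCurve γ) (fun _ => X) (Set.Icc 0 1)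

lemma isTrajectory_iff_sub_primitiveL_eq [CompleteSpace E] {X : C(E, E)} {x : E}
    {γ : C(unitInterval, E)} :
    IsTrajectory X x γ ↔ γ - primitiveL (X.comp γ) = ContinuousMap.const unitInterval x := by
  rw [sub_eq_iff_eq_add, eq_const_add_primitiveL_iff]
  exact ⟨fun h => ⟨h.1, h.2⟩, fun h => ⟨h.1, h.2⟩⟩

lemma IsTrajectory.norm_sub_le [CompleteSpace E] {X : C(E, E)} {x : E} {γ : C(unitInterval, E)}
    {B : ℝ} (hγ : IsTrajectory X x γ) (hB : 0 ≤ B) (hX : ∀ t, ‖X (γ t)‖ ≤ B) (t : unitInterval) :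
    ‖γ t - x‖ ≤ B := by
  have hx := isTrajectory_iff_sub_primitiveL_eq.1 hγ
  have hdiff : γ t - x = primitiveL (X.comp γ) t := by
    rw [sub_eq_iff_eq_add, ← sub_eq_iff_eq_add']
    exact DFunLike.congr_fun hx t
  rw [hdiff]
  exact (ContinuousMap.norm_coe_le_norm _ t).trans
    ((norm_primitiveL_le _).trans ((ContinuousMap.norm_le _ hB).2 hX))

/-- The curve `γ` run backwards in time. -/
def reverseCurve (γ : C(unitInterval, E)) : C(unitInterval, E) :=
  γ.comp ⟨unitInterval.symm, unitInterval.continuous_symm⟩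

lemma IsTrajectory.reverse {X : C(E, E)} {x : E} {γ : C(unitInterval, E)}
    (hγ : IsTrajectory (-X) x γ) :
    IsTrajectory X (γ 1) (reverseCurve γ) := by
  have hmem : ∀ t ∈ Set.Icc (0 : ℝ) 1, 1 - t ∈ Set.Icc (0 : ℝ) 1 := fun t ht =>
    ⟨by linarith [ht.2], by linarith [ht.1]⟩
  have hext : ∀ t ∈ Set.Icc (0 : ℝ) 1, extendCurve (reverseCurve γ) t = extendCurve γ (1 - t) := by
    intro t ht
    rw [extendCurve, Set.IccExtend_of_mem _ _ ht, extendCurve, Set.IccExtend_of_mem _ _ (hmem t ht)]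
    rfl
  refine ⟨congrArg γ unitInterval.symm_zero, fun t ht => ?_⟩
  have hsub : HasDerivWithinAt (fun s : ℝ => 1 - s) (-1) (Set.Icc 0 1) t :=
    ((hasDerivAt_id t).const_sub 1).hasDerivWithinAt
  have hcomp := (hγ.integralCurve (1 - t) (hmem t ht)).scomp t hsub hmem
  refine (hcomp.congr_of_mem hext ht).congr_deriv ?_
  rw [hext t ht, neg_smul, one_smul]
  exact neg_neg _

/-- A smooth vector field that vanishes at the origin and is `1/2`-Lipschitz on the ball of
radius `S`. -/
structure SmallField (X : C(E, E)) (S : ℝ) : Prop where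
  pos : 0 < S
  smooth : ContDiff ℝ ∞ X
  zero : X 0 = 0
  contract : LipschitzOnWith (1 / 2) X (Metric.ball 0 S)

namespace SmallField

variable {X : C(E, E)} {S : ℝ}

lemma neg (h : SmallField X S) : SmallField (-X) S where
  pos := h.pos
  smooth := h.smooth.neg
  zero := by rw [ContinuousMap.neg_apply, h.zero, neg_zero]
  contract := h.contract.neg

lemma lipschitzOnWith_primitiveL_comp (h : SmallField X S) :
    LipschitzOnWith (1 / 2) (fun γ : C(unitInterval, E) => primitiveL (X.comp γ))
      (Metric.ball 0 S) := by
  refine LipschitzOnWith.of_dist_le_mul fun γ hγ η hη => ?_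
  have hmem : ∀ ξ ∈ Metric.ball (0 : C(unitInterval, E)) S, ∀ t, ξ t ∈ Metric.ball (0 : E) S :=
    fun ξ hξ t => mem_ball_zero_iff.2
      ((ξ.norm_coe_le_norm t).trans_lt (mem_ball_zero_iff.1 hξ))
  rw [dist_eq_norm, ← map_sub]
  refine (norm_primitiveL_le _).trans ?_
  rw [← dist_eq_norm, ContinuousMap.dist_le (by positivity)]
  intro t
  refine (h.contract.dist_le_mul _ (hmem γ hγ t) _ (hmem η hη t)).trans ?_
  gcongr
  exact ContinuousMap.dist_apply_le_dist t

variable [CompleteSpace E]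

lemma dist_trajectories_le (h : SmallField X S) {x y : E} {γ η : C(unitInterval, E)}
    (hγS : γ ∈ Metric.ball 0 S) (hηS : η ∈ Metric.ball 0 S) (hγ : IsTrajectory X x γ)
    (hη : IsTrajectory X y η) : ‖γ - η‖ ≤ 2 * ‖x - y‖ := by
  have hgap := approximatesLinearOn_id_sub h.lipschitzOnWith_primitiveL_comp γ hγS η hηS
  beta_reduce at hgap
  rw [isTrajectory_iff_sub_primitiveL_eq.1 hγ, isTrajectory_iff_sub_primitiveL_eq.1 hη,
    ContinuousLinearEquiv.coe_refl, ContinuousLinearMap.id_apply, norm_sub_rev] at hgap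
  have hconst : ‖ContinuousMap.const unitInterval x - ContinuousMap.const unitInterval y‖
      ≤ ‖x - y‖ := (ContinuousMap.norm_le _ (norm_nonneg _)).2 fun _ => le_rfl
  have htriangle := norm_sub_norm_le (γ - η)
    (ContinuousMap.const unitInterval x - ContinuousMap.const unitInterval y)
  push_cast at hgap
  linarith

lemma norm_trajectory_le (h : SmallField X S) {x : E} {γ : C(unitInterval, E)}
    (hγS : γ ∈ Metric.ball 0 S) (hγ : IsTrajectory X x γ) : ‖γ‖ ≤ 2 * ‖x‖ := by
  have hzero : IsTrajectory X 0 (0 : C(unitInterval, E)) := by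
    rw [isTrajectory_iff_sub_primitiveL_eq]
    have : X.comp (0 : C(unitInterval, E)) = 0 := ContinuousMap.ext fun _ => h.zero
    rw [this, map_zero, sub_zero]
    rfl
  simpa only [sub_zero] using
    h.dist_trajectories_le hγS (Metric.mem_ball_self h.pos) hγ hzero

lemma trajectory_unique (h : SmallField X S) {x : E} {γ η : C(unitInterval, E)}
    (hγS : γ ∈ Metric.ball 0 S) (hηS : η ∈ Metric.ball 0 S) (hγ : IsTrajectory X x γ)
    (hη : IsTrajectory X x η) : γ = η := by
  have := h.dist_trajectories_le hγS hηS hγ hη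
  rwa [sub_self, norm_zero, mul_zero, norm_le_zero_iff, sub_eq_zero] at this

lemma timeOne_neg_then_timeOne (h : SmallField X S) {x : E} {γ η : C(unitInterval, E)}
    (hγS : γ ∈ Metric.ball 0 S) (hηS : η ∈ Metric.ball 0 S) (hγ : IsTrajectory (-X) x γ)
    (hη : IsTrajectory X (γ 1) η) : η 1 = x := by
  have hreverse : reverseCurve γ ∈ Metric.ball 0 S := by
    rw [mem_ball_zero_iff] at hγS ⊢
    exact ((ContinuousMap.norm_le _ (norm_nonneg γ)).2 fun t =>
      γ.norm_coe_le_norm (unitInterval.symm t)).trans_lt hγS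
  have hη1 := DFunLike.congr_fun (h.trajectory_unique hηS hreverse hη hγ.reverse) 1
  exact hη1.trans ((congrArg γ unitInterval.symm_one).trans hγ.initial)

end SmallField

/-- `Γ` sends each point of `O` to its trajectory under `X`, and does so smoothly. -/
structure IsSmoothFlowOn (X : C(E, E)) (Γ : E → C(unitInterval, E)) (O : Set E) : Prop where
  smooth : ContDiffOn ℝ ∞ Γ O
  trajectory : ∀ x ∈ O, IsTrajectory X x (Γ x)

namespace IsSmoothFlowOn

variable {X : C(E, E)} {Γ : E → C(unitInterval, E)} {O : Set E} {x : E}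

lemma hasFDerivAt (h : IsSmoothFlowOn X Γ O) (hO : IsOpen O) (hx : x ∈ O) :
    HasFDerivAt Γ (fderiv ℝ Γ x) x :=
  ((h.smooth.differentiableOn (by simp)).differentiableAt (hO.mem_nhds hx)).hasFDerivAt

lemma hasFDerivAt_apply (h : IsSmoothFlowOn X Γ O) (hO : IsOpen O) (hx : x ∈ O)
    (t : unitInterval) :
    HasFDerivAt (fun y => Γ y t) ((ContinuousMap.evalCLM ℝ t).comp (fderiv ℝ Γ x)) x :=
  (ContinuousMap.evalCLM (M := E) ℝ t).hasFDerivAt.comp x (h.hasFDerivAt hO hx)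

variable [CompleteSpace E]

lemma variational_equation (h : IsSmoothFlowOn X Γ O) (hO : IsOpen O) (hX : ContDiff ℝ 1 X)
    (hx : x ∈ O) (v : E) :
    fderiv ℝ Γ x v 0 = v ∧ ∀ t ∈ Set.Icc (0 : ℝ) 1,
      HasDerivWithinAt (extendCurve (fderiv ℝ Γ x v))
        (fderiv ℝ X (extendCurve (Γ x) t) (extendCurve (fderiv ℝ Γ x v) t)) (Set.Icc 0 1) t := by
  let DX : C(E, E →L[ℝ] E) := ⟨fderiv ℝ X, hX.continuous_fderiv one_ne_zero⟩
  have hDX : ∀ y, HasFDerivAt X (DX y) y := fun y => (hX.differentiable one_ne_zero y).hasFDerivAt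
  have hd := h.hasFDerivAt hO hx
  have hleft : HasFDerivAt (fun y => Γ y - primitiveL (X.comp (Γ y)))
      (fderiv ℝ Γ x - primitiveL.comp ((pointwiseApplyL (DX.comp (Γ x))).comp (fderiv ℝ Γ x))) x :=
    hd.sub ((primitiveL (E := E)).hasFDerivAt.comp x
      ((hasFDerivAt_superposition hDX (Γ x)).comp x hd))
  have hright : HasFDerivAt (fun y => Γ y - primitiveL (X.comp (Γ y)))
      (ContinuousLinearMap.const ℝ unitInterval) x :=
    (ContinuousLinearMap.const (M := E) ℝ unitInterval).hasFDerivAt.congr_of_eventuallyEq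
      (Filter.eventuallyEq_of_mem (hO.mem_nhds hx) fun y hy =>
        isTrajectory_iff_sub_primitiveL_eq.1 (h.trajectory y hy))
  exact eq_const_add_primitiveL_iff.1 (sub_eq_iff_eq_add.1
    (congrArg (fun T : E →L[ℝ] C(unitInterval, E) => T v) (hleft.unique hright)))

lemma bilinear_invariant (h : IsSmoothFlowOn X Γ O) (hO : IsOpen O) (hX : ContDiff ℝ 1 X)
    (hx : x ∈ O) (B : E →L[ℝ] E →L[ℝ] ℝ)
    (hB : ∀ y u w, B (fderiv ℝ X y u) w + B u (fderiv ℝ X y w) = 0) (v w : E) :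
    B (fderiv ℝ (fun y => Γ y 1) x v) (fderiv ℝ (fun y => Γ y 1) x w) = B v w := by
  obtain ⟨hv0, hv⟩ := h.variational_equation hO hX hx v
  obtain ⟨hw0, hw⟩ := h.variational_equation hO hX hx w
  set f : ℝ → ℝ := fun t => B (extendCurve (fderiv ℝ Γ x v) t) (extendCurve (fderiv ℝ Γ x w) t)
    with hf
  have hderiv : ∀ t ∈ Set.Icc (0 : ℝ) 1, HasDerivWithinAt f 0 (Set.Icc 0 1) t := by
    intro t ht
    exact (B.hasDerivWithinAt_of_bilinear (hv t ht) (hw t ht)).congr_deriv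
      ((add_comm _ _).trans (hB _ _ _))
  have hconst : f 1 = f 0 := constant_of_has_deriv_right_zero
    (fun t ht => (hderiv t ht).continuousWithinAt)
    (fun t ht => (hderiv t (Set.Ico_subset_Icc_self ht)).mono_of_mem_nhdsWithin
      (Icc_mem_nhdsGE_of_mem ht)) 1 ⟨zero_le_one, le_rfl⟩
  rw [(h.hasFDerivAt_apply hO hx 1).fderiv]
  simp only [hf, extendCurve, Set.IccExtend_left, Set.IccExtend_right] at hconst
  exact hconst.trans (congrArg₂ (fun a b => B a b) hv0 hw0)

end IsSmoothFlowOn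

lemma SmallField.exists_isSmoothFlowOn [CompleteSpace E] {X : C(E, E)} {S : ℝ}
    (h : SmallField X S) : ∃ Γ : E → C(unitInterval, E),
      IsSmoothFlowOn X Γ (Metric.ball 0 (S / 2)) ∧
        ∀ x ∈ Metric.ball (0 : E) (S / 2), Γ x ∈ Metric.ball 0 S := by
  have hsmooth : ContDiff ℝ ∞ fun γ : C(unitInterval, E) => primitiveL (X.comp γ) :=
    primitiveL.contDiff.comp (contDiff_superposition h.smooth)
  have hzero : primitiveL (X.comp (0 : C(unitInterval, E))) = 0 := by
    rw [show X.comp (0 : C(unitInterval, E)) = 0 from ContinuousMap.ext fun _ => h.zero, map_zero]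
  obtain ⟨Φ, hΦ, hinv⟩ := exists_contDiffOn_rightInverse_id_sub (NNReal.half_lt_self one_ne_zero)
    h.pos hsmooth hzero h.lipschitzOnWith_primitiveL_comp
  have hradius : (1 - ((1 / 2 : NNReal) : ℝ)) * S = S / 2 := by push_cast; ring
  rw [hradius] at hΦ hinv
  have hmem : Set.MapsTo (ContinuousMap.const unitInterval) (Metric.ball (0 : E) (S / 2))
      (Metric.ball 0 (S / 2)) := fun x hx => by
    rw [mem_ball_zero_iff] at hx ⊢
    exact ((ContinuousMap.norm_le _ (norm_nonneg x)).2 fun _ => le_rfl).trans_lt hx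
  exact ⟨fun x => Φ (ContinuousMap.const unitInterval x),
    ⟨hΦ.comp (ContinuousLinearMap.const (M := E) ℝ unitInterval).contDiff.contDiffOn hmem,
      fun x hx => isTrajectory_iff_sub_primitiveL_eq.2 (hinv _ (hmem hx)).2⟩,
    fun x hx => (hinv _ (hmem hx)).1⟩

end Flow

/-! ### Polynomials in the signed coordinates -/

/-- A signed mode `(δ, a)`; it indexes the coordinates `zₐ` and `\bar zₐ`. -/
abbrev Mode : Type := ℤˣ × ℤ

/-- The product of the weights of the entries of a tuple of modes. -/
def tupleWeight (σ θ : ℝ) {k : ℕ} (j : Fin k → Mode) : ℝ := ∏ α, gevreyWeight σ θ (j α).2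

lemma tupleWeight_pos (σ θ : ℝ) {k : ℕ} (j : Fin k → Mode) : 0 < tupleWeight σ θ j :=
  Finset.prod_pos fun _ _ => gevreyWeight_pos _ _ _

lemma one_le_tupleWeight {σ θ : ℝ} (hσ : 0 ≤ σ) {k : ℕ} (j : Fin k → Mode) :
    1 ≤ tupleWeight σ θ j :=
  Finset.prod_induction _ (fun x => 1 ≤ x) (fun _ _ => one_le_mul_of_one_le_of_one_le) le_rfl
    fun _ _ => one_le_gevreyWeight hσ _

lemma tupleWeight_insertNth (σ θ : ℝ) {k : ℕ} (α : Fin (k + 1)) (i : Mode) (j : Fin k → Mode) :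
    tupleWeight σ θ (α.insertNth i j : Fin (k + 1) → Mode)
      = gevreyWeight σ θ i.2 * tupleWeight σ θ j := by
  simp [tupleWeight, Fin.prod_univ_succAbove _ α]

lemma hasSum_pi_prod {ι : Type*} {k : ℕ} {f : Fin k → ι → ℝ} {s : Fin k → ℝ}
    (hf : ∀ α i, 0 ≤ f α i) (hs : ∀ α, HasSum (f α) (s α)) :
    HasSum (fun j : Fin k → ι => ∏ α, f α (j α)) (∏ α, s α) := by
  induction k with
  | zero => simp
  | succ k ih =>
    rw [← (Fin.consEquiv fun _ : Fin (k + 1) => ι).hasSum_iff, Fin.prod_univ_succ]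
    have h1 : HasSum (fun j : Fin k → ι => ∏ α : Fin k, f α.succ (j α)) (∏ α : Fin k, s α.succ) :=
      ih (fun α => hf α.succ) (fun α => hs α.succ)
    have hnn : 0 ≤ fun j : Fin k → ι => ∏ α : Fin k, f α.succ (j α) :=
      fun j => Finset.prod_nonneg fun α _ => hf α.succ (j α)
    have hf0 : 0 ≤ f 0 := fun i => hf 0 i
    have hsum := Summable.mul_of_nonneg (hs 0).summable h1.summable hf0 hnn
    refine ((hs 0).mul h1 hsum).congr_fun fun x => ?_
    simp [Fin.prod_univ_succ]

namespace Gevrey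

variable {σ θ : ℝ}

/-- The signed coordinate `z_{(δ, a)}`. -/
def coord (z : Gevrey σ θ) (i : Mode) : ℂ := signedCoord z i

lemma coord_one (z : Gevrey σ θ) (a : ℤ) : coord z (1, a) = z a := by simp [coord, signedCoord]

lemma coord_neg_one (z : Gevrey σ θ) (a : ℤ) : coord z (-1, a) = conj (z a) := by
  simp [coord, signedCoord]

lemma mode_cases (i : Mode) : i = (1, i.2) ∨ i = (-1, i.2) := by
  rcases Int.units_eq_one_or i.1 with h | h
  · left; ext <;> simp [h]
  · right; ext <;> simp [h]

lemma norm_coord (z : Gevrey σ θ) (i : Mode) : ‖coord z i‖ = ‖z i.2‖ := by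
  rcases mode_cases i with h | h <;> rw [h]
  · rw [coord_one]
  · rw [coord_neg_one, RCLike.norm_conj]

lemma coord_add (x y : Gevrey σ θ) (i : Mode) : coord (x + y) i = coord x i + coord y i := by
  rcases mode_cases i with h | h <;> rw [h]
  · simp only [coord_one, add_apply]
  · simp only [coord_neg_one, add_apply, map_add]

lemma coord_smul (c : ℝ) (x : Gevrey σ θ) (i : Mode) : coord (c • x) i = c • coord x i := by
  rcases mode_cases i with h | h <;> rw [h]
  · simp only [coord_one, smul_apply]
  · simp only [coord_neg_one, smul_apply, Complex.real_smul, map_mul, Complex.conj_ofReal]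

lemma conj_coord (z : Gevrey σ θ) (i : Mode) : conj (coord z i) = coord z (-i.1, i.2) := by
  rcases mode_cases i with h | h <;> rw [h]
  · simp only [coord_one, coord_neg_one]
  · simp only [coord_one, coord_neg_one, neg_neg, Complex.conj_conj]

lemma hasSum_mode (z : Gevrey σ θ) :
    HasSum (fun i : Mode => gevreyWeight σ θ i.2 * ‖coord z i‖) ‖z‖ := by
  have h : HasSum (fun a => gevreyWeight σ θ a * ‖z a‖) (‖z‖ / 2) := by
    have := (summable z).hasSum
    rwa [show ‖z‖ / 2 = ∑' a, gevreyWeight σ θ a * ‖z a‖ by rw [norm_def]; ring]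
  have h1 : HasSum (fun _ : ℤˣ => (1 : ℝ)) 2 := by
    simpa using hasSum_fintype (fun _ : ℤˣ => (1 : ℝ))
  have h2 := h1.mul h (h1.summable.mul_of_nonneg h.summable (fun _ => zero_le_one)
    fun a => mul_nonneg (gevreyWeight_pos _ _ _).le (norm_nonneg _))
  rw [mul_div_cancel₀ _ (two_ne_zero' ℝ)] at h2
  simpa [norm_coord] using h2

lemma hasSum_tuple {k : ℕ} (m : Fin k → Gevrey σ θ) :
    HasSum (fun j : Fin k → Mode => tupleWeight σ θ j * ∏ α, ‖coord (m α) (j α)‖) (∏ α, ‖m α‖) := by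
  have := hasSum_pi_prod (f := fun α i => gevreyWeight σ θ i.2 * ‖coord (m α) i‖)
    (fun α i => mul_nonneg (gevreyWeight_pos _ _ _).le (norm_nonneg _))
    (fun α => hasSum_mode (m α))
  simpa [tupleWeight, Finset.prod_mul_distrib] using this

variable {E : Type*} [NormedAddCommGroup E] [NormedSpace ℝ E]

lemma norm_tuple_term_le {k : ℕ} {b : (Fin k → Mode) → ℂ →L[ℝ] E} {B : ℝ}
    (hb : ∀ j, ‖b j‖ ≤ B * tupleWeight σ θ j) (m : Fin k → Gevrey σ θ) (j : Fin k → Mode) :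
    ‖b j (∏ α, coord (m α) (j α))‖ ≤ B * (tupleWeight σ θ j * ∏ α, ‖coord (m α) (j α)‖) := by
  refine ((b j).le_opNorm _).trans ?_
  rw [norm_prod, ← mul_assoc]
  exact mul_le_mul_of_nonneg_right (hb j) (by positivity)

lemma summable_norm_tuple {k : ℕ} {b : (Fin k → Mode) → ℂ →L[ℝ] E} {B : ℝ}
    (hb : ∀ j, ‖b j‖ ≤ B * tupleWeight σ θ j) (m : Fin k → Gevrey σ θ) :
    Summable fun j => ‖b j (∏ α, coord (m α) (j α))‖ :=
  Summable.of_nonneg_of_le (fun _ => norm_nonneg _) (norm_tuple_term_le hb m)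
    ((hasSum_tuple m).summable.mul_left B)

lemma summable_tuple [CompleteSpace E] {k : ℕ} {b : (Fin k → Mode) → ℂ →L[ℝ] E} {B : ℝ}
    (hb : ∀ j, ‖b j‖ ≤ B * tupleWeight σ θ j) (m : Fin k → Gevrey σ θ) :
    Summable fun j => b j (∏ α, coord (m α) (j α)) :=
  (summable_norm_tuple hb m).of_norm

lemma prod_coord_update {k : ℕ} [DecidableEq (Fin k)] (m : Fin k → Gevrey σ θ) (α : Fin k)
    (v : Gevrey σ θ) (j : Fin k → Mode) : ∏ β, coord (Function.update m α v β) (j β)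
      = coord v (j α) * ∏ β ∈ Finset.univ.erase α, coord (m β) (j β) := by
  rw [← Finset.mul_prod_erase _ _ (Finset.mem_univ α), Function.update_self]
  congr 1
  refine Finset.prod_congr rfl fun β hβ => ?_
  rw [Function.update_of_ne (Finset.ne_of_mem_erase hβ)]

/-- The multilinear map `∑_j b_j (z¹_{j₁} ⋯ zᵏ_{j_k})`. -/
def tupleML [CompleteSpace E] {k : ℕ} (b : (Fin k → Mode) → ℂ →L[ℝ] E) (B : ℝ)
    (hb : ∀ j, ‖b j‖ ≤ B * tupleWeight σ θ j) :
    ContinuousMultilinearMap ℝ (fun _ : Fin k => Gevrey σ θ) E :=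
  MultilinearMap.mkContinuous
    { toFun := fun m => ∑' j, b j (∏ α, coord (m α) (j α))
      map_update_add' := by
        intro inst m α x y
        rw [← (summable_tuple hb _).tsum_add (summable_tuple hb _)]
        refine tsum_congr fun j => ?_
        rw [← map_add]
        congr 1
        rw [prod_coord_update, prod_coord_update, prod_coord_update, coord_add, add_mul]
      map_update_smul' := by
        intro inst m α c x
        rw [← (summable_tuple hb _).tsum_const_smul c]
        refine tsum_congr fun j => ?_
        rw [← map_smul]
        congr 1
        rw [prod_coord_update, prod_coord_update, coord_smul, smul_mul_assoc] } B (fun m => by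
      have h := tsum_of_norm_bounded ((hasSum_tuple m).mul_left B) (norm_tuple_term_le hb m)
      exact h)

lemma norm_tupleML_le [CompleteSpace E] {k : ℕ} (b : (Fin k → Mode) → ℂ →L[ℝ] E) (B : ℝ)
    (hb : ∀ j, ‖b j‖ ≤ B * tupleWeight σ θ j) (hB : 0 ≤ B) : ‖tupleML b B hb‖ ≤ B :=
  MultilinearMap.mkContinuous_norm_le _ hB _

end Gevrey

section Coefficients

variable {k : ℕ} {c : (Fin (k + 1) → Mode) → ℂ}

/-- The charge of a tuple, which is zero for the monomials that preserve mass. -/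
def charge (j : Fin k → Mode) : ℤ := ∑ α, ((j α).1 : ℤ)

/-- The momentum of a tuple, which is zero for the monomials that preserve momentum. -/
def momentum (j : Fin k → Mode) : ℤ := ∑ α, ((j α).1 : ℤ) * (j α).2

/-- The divisor of the homological equation; on tuples of zero charge and momentum it vanishes
exactly at the resonant ones. -/
def divisor (j : Fin k → Mode) : ℤ := ∑ α, ((j α).1 : ℤ) * (j α).2 ^ 2

/-- The conjugate mode. -/
def Mode.conj (i : Mode) : Mode := (-i.1, i.2)

/-- The conjugate tuple. -/
def conjTuple (j : Fin k → Mode) : Fin k → Mode := fun α => Mode.conj (j α)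

lemma conjTuple_conjTuple (j : Fin k → Mode) : conjTuple (conjTuple j) = j := by
  funext α; simp [conjTuple, Mode.conj]

/-- Conjugation of tuples as an equivalence. -/
def conjTupleEquiv (k : ℕ) : (Fin k → Mode) ≃ (Fin k → Mode) :=
  ⟨conjTuple, conjTuple, conjTuple_conjTuple, conjTuple_conjTuple⟩

lemma charge_conjTuple (j : Fin k → Mode) : charge (conjTuple j) = -charge j := by
  simp [charge, conjTuple, Mode.conj]

lemma momentum_conjTuple (j : Fin k → Mode) : momentum (conjTuple j) = -momentum j := by
  simp [momentum, conjTuple, Mode.conj]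

lemma divisor_conjTuple (j : Fin k → Mode) : divisor (conjTuple j) = -divisor j := by
  simp [divisor, conjTuple, Mode.conj]

lemma conjTuple_insertNth (α : Fin (k + 1)) (i : Mode) (j : Fin k → Mode) :
    conjTuple (α.insertNth i j : Fin (k + 1) → Mode) = α.insertNth (Mode.conj i) (conjTuple j) := by
  funext β
  refine Fin.succAboveCases α ?_ (fun β => ?_) β <;> simp [conjTuple]

lemma gevreyWeight_momentum_le {σ θ : ℝ} (hσ : 0 ≤ σ) (hθ : 0 < θ) (hθ1 : θ ≤ 1)
    (j : Fin k → Mode) : gevreyWeight σ θ (momentum j) ≤ tupleWeight σ θ j := by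
  refine (gevreyWeight_sum_le hσ hθ hθ1 _ _).trans (le_of_eq ?_)
  refine Finset.prod_congr rfl fun α _ => ?_
  rcases Int.units_eq_one_or (j α).1 with h | h <;> simp [h, gevreyWeight_neg]

/-- The coefficients vanish off the tuples with zero charge and momentum. -/
def MomentumSupported (c : (Fin k → Mode) → ℂ) : Prop :=
  ∀ j, c j ≠ 0 → charge j = 0 ∧ momentum j = 0

/-- The coefficients of a real polynomial. -/
def RealCoeffs (c : (Fin k → Mode) → ℂ) : Prop := ∀ j, conj (c j) = c (conjTuple j)

/-- The coefficients of the partial derivative in the coordinate of the mode `i`. -/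
def partialCoef (c : (Fin (k + 1) → Mode) → ℂ) (i : Mode) (j : Fin k → Mode) : ℂ :=
  ∑ α : Fin (k + 1), c (α.insertNth i j)

lemma conj_partialCoef (hc : RealCoeffs c) (i : Mode)
    (j : Fin k → Mode) : conj (partialCoef c i j) = partialCoef c (Mode.conj i) (conjTuple j) := by
  simp only [partialCoef, map_sum, ← conjTuple_insertNth]
  exact Finset.sum_congr rfl fun α _ => hc _

lemma norm_partialCoef_le {B : ℝ} (hc : ∀ j, ‖c j‖ ≤ B)
    (i : Mode) (j : Fin k → Mode) : ‖partialCoef c i j‖ ≤ (k + 1) * B := by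
  refine (norm_sum_le _ _).trans ((Finset.sum_le_sum fun α _ => hc _).trans ?_)
  simp

lemma norm_partialCoef_le_weight {σ θ : ℝ} {B : ℝ}
    (hc : ∀ j, ‖c j‖ ≤ B * tupleWeight σ θ j) (i : Mode) (j : Fin k → Mode) :
    ‖partialCoef c i j‖ ≤ (k + 1) * B * gevreyWeight σ θ i.2 * tupleWeight σ θ j := by
  refine (norm_sum_le _ _).trans ((Finset.sum_le_sum fun α _ => hc _).trans (le_of_eq ?_))
  simp only [tupleWeight_insertNth, Finset.sum_const, Finset.card_univ, Fintype.card_fin,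
    nsmul_eq_mul]
  push_cast
  ring

lemma charge_insertNth (α : Fin (k + 1)) (i : Mode) (j : Fin k → Mode) :
    charge (α.insertNth i j : Fin (k + 1) → Mode) = i.1 + charge j := by
  simp [charge, Fin.sum_univ_succAbove _ α]

lemma momentum_insertNth (α : Fin (k + 1)) (i : Mode) (j : Fin k → Mode) :
    momentum (α.insertNth i j : Fin (k + 1) → Mode) = i.1 * i.2 + momentum j := by
  simp [momentum, Fin.sum_univ_succAbove _ α]

lemma MomentumSupported.of_partialCoef_ne
    (hc : MomentumSupported c) {i : Mode} {j : Fin k → Mode} (h : partialCoef c i j ≠ 0) :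
    (i.1 : ℤ) + charge j = 0 ∧ (i.1 : ℤ) * i.2 + momentum j = 0 := by
  obtain ⟨α, -, hα⟩ := Finset.exists_ne_zero_of_sum_ne_zero h
  have := hc _ hα
  rwa [charge_insertNth, momentum_insertNth] at this

lemma MomentumSupported.partialCoef_neg
    (hc : MomentumSupported c) {a : ℤ} {j : Fin k → Mode} (h : a ≠ momentum j) :
    partialCoef c (-1, a) j = 0 := by
  by_contra hne
  have := (hc.of_partialCoef_ne hne).2
  simp only [Units.val_neg, Units.val_one] at this
  exact h (by linarith)

lemma MomentumSupported.partialCoef_pos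
    (hc : MomentumSupported c) {a : ℤ} {j : Fin k → Mode} (h : a ≠ -momentum j) :
    partialCoef c (1, a) j = 0 := by
  by_contra hne
  have := (hc.of_partialCoef_ne hne).2
  simp only [Units.val_one] at this
  exact h (by linarith)

end Coefficients

section Diagonal

variable {E F : Type*} [NormedAddCommGroup E] [NormedSpace ℝ E] [NormedAddCommGroup F]
  [NormedSpace ℝ F] {k : ℕ}

lemma contDiff_diag (T : ContinuousMultilinearMap ℝ (fun _ : Fin k => E) F) :
    ContDiff ℝ ∞ (fun z => T (fun _ => z)) :=
  T.contDiff.comp (contDiff_pi.2 fun _ => contDiff_id)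

lemma hasFDerivAt_diag (T : ContinuousMultilinearMap ℝ (fun _ : Fin k => E) F) (z : E) :
    HasFDerivAt (fun z => T (fun _ => z))
      ((T.linearDeriv (fun _ => z)).comp (ContinuousLinearMap.pi fun _ => .id ℝ _)) z :=
  (T.hasFDerivAt (fun _ => z)).comp z
    (ContinuousLinearMap.pi fun _ : Fin k => .id ℝ E).hasFDerivAt

end Diagonal

namespace Gevrey

section Polynomial

variable {σ θ : ℝ} {k : ℕ}

/-- The monomial `z_j`. -/
def mono (z : Gevrey σ θ) (j : Fin k → Mode) : ℂ := ∏ α, coord z (j α)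

lemma conj_mono (z : Gevrey σ θ) (j : Fin k → Mode) :
    conj (mono z j) = mono z (conjTuple j) := by
  simp only [mono, map_prod]
  exact Finset.prod_congr rfl fun α _ => conj_coord z _

lemma mono_insertNth (z : Gevrey σ θ) (α : Fin (k + 1)) (i : Mode) (j : Fin k → Mode) :
    mono z (α.insertNth i j : Fin (k + 1) → Mode) = coord z i * mono z j := by
  simp [mono, Fin.prod_univ_succAbove _ α]

/-- The polynomial `∑_j c_j z_j`. -/
def polyEval (c : (Fin k → Mode) → ℂ) (z : Gevrey σ θ) : ℂ := ∑' j, c j * mono z j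

/-- The multilinear form whose restriction to the diagonal is `polyEval c`. -/
def formL (c : (Fin k → Mode) → ℂ) (B : ℝ) (hc : ∀ j, ‖c j‖ ≤ B * tupleWeight σ θ j) :
    ContinuousMultilinearMap ℝ (fun _ : Fin k => Gevrey σ θ) ℂ :=
  tupleML (fun j => ContinuousLinearMap.mul ℝ ℂ (c j)) B
    fun j => (ContinuousLinearMap.opNorm_mul_apply ℝ ℂ _).le.trans (hc j)

lemma formL_apply {c : (Fin k → Mode) → ℂ} {B : ℝ}
    (hc : ∀ j, ‖c j‖ ≤ B * tupleWeight σ θ j) (m : Fin k → Gevrey σ θ) :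
    formL c B hc m = ∑' j, c j * ∏ α, coord (m α) (j α) := rfl

lemma summable_form {c : (Fin k → Mode) → ℂ} {B : ℝ}
    (hc : ∀ j, ‖c j‖ ≤ B * tupleWeight σ θ j) (m : Fin k → Gevrey σ θ) :
    Summable fun j => c j * ∏ α, coord (m α) (j α) :=
  summable_tuple (b := fun j => ContinuousLinearMap.mul ℝ ℂ (c j))
    (fun j => (ContinuousLinearMap.opNorm_mul_apply ℝ ℂ _).le.trans (hc j)) m

lemma summable_norm_poly {c : (Fin k → Mode) → ℂ} {B : ℝ}
    (hc : ∀ j, ‖c j‖ ≤ B * tupleWeight σ θ j) (z : Gevrey σ θ) :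
    Summable fun j => ‖c j * mono z j‖ :=
  summable_norm_tuple (b := fun j => ContinuousLinearMap.mul ℝ ℂ (c j))
    (fun j => (ContinuousLinearMap.opNorm_mul_apply ℝ ℂ _).le.trans (hc j)) (fun _ => z)

lemma summable_poly {c : (Fin k → Mode) → ℂ} {B : ℝ}
    (hc : ∀ j, ‖c j‖ ≤ B * tupleWeight σ θ j) (z : Gevrey σ θ) :
    Summable fun j => c j * mono z j := (summable_norm_poly hc z).of_norm

lemma norm_polyEval_le {c : (Fin k → Mode) → ℂ} {B : ℝ}
    (hc : ∀ j, ‖c j‖ ≤ B * tupleWeight σ θ j) (z : Gevrey σ θ) :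
    ‖polyEval c z‖ ≤ B * ‖z‖ ^ k := by
  have h := tsum_of_norm_bounded ((hasSum_tuple (fun _ : Fin k => z)).mul_left B)
    (norm_tuple_term_le (b := fun j => ContinuousLinearMap.mul ℝ ℂ (c j))
    (fun j => (ContinuousLinearMap.opNorm_mul_apply ℝ ℂ _).le.trans (hc j)) (fun _ => z))
  simpa [polyEval, mono] using h

lemma contDiff_polyEval {c : (Fin k → Mode) → ℂ} {B : ℝ}
    (hc : ∀ j, ‖c j‖ ≤ B * tupleWeight σ θ j) :
    ContDiff ℝ ∞ (polyEval c : Gevrey σ θ → ℂ) :=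
  contDiff_diag (formL c B hc)

section Gradient

variable {c : (Fin (k + 1) → Mode) → ℂ} {B : ℝ}

lemma mul_prod_coord_insertNth (z v : Gevrey σ θ) (α : Fin (k + 1)) (i : Mode)
    (j : Fin k → Mode) :
    c (α.insertNth i j) * ∏ β, coord ((α.insertNth v fun _ => z : Fin (k + 1) → Gevrey σ θ) β)
        ((α.insertNth i j : Fin (k + 1) → Mode) β)
      = c (α.insertNth i j) * (coord v i * mono z j) := by
  simp only [mono, Fin.prod_univ_succAbove _ α, Fin.insertNth_apply_same,
    Fin.insertNth_apply_succAbove]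

lemma summable_grad (hc : ∀ j, ‖c j‖ ≤ B * tupleWeight σ θ j) (z v : Gevrey σ θ)
    (α : Fin (k + 1)) :
    Summable fun x : Mode × (Fin k → Mode) =>
      c (α.insertNth x.1 x.2) * (coord v x.1 * mono z x.2) :=
  ((Fin.insertNthEquiv (fun _ : Fin (k + 1) => Mode) α).summable_iff.2
    (summable_form hc (α.insertNth v fun _ => z))).congr fun x =>
      mul_prod_coord_insertNth z v α x.1 x.2

lemma formL_insertNth (hc : ∀ j, ‖c j‖ ≤ B * tupleWeight σ θ j) (z v : Gevrey σ θ)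
    (α : Fin (k + 1)) :
    formL c B hc (α.insertNth v fun _ => z)
      = ∑' x : Mode × (Fin k → Mode), c (α.insertNth x.1 x.2) * (coord v x.1 * mono z x.2) := by
  rw [formL_apply, ← (Fin.insertNthEquiv (fun _ : Fin (k + 1) => Mode) α).tsum_eq]
  exact tsum_congr fun x => mul_prod_coord_insertNth z v α x.1 x.2

lemma fderiv_polyEval (hc : ∀ j, ‖c j‖ ≤ B * tupleWeight σ θ j) (z v : Gevrey σ θ) :
    fderiv ℝ (polyEval c) z v = ∑' i, coord v i * polyEval (partialCoef c i) z := by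
  have hdiag : fderiv ℝ (polyEval c) z v
      = ∑ α : Fin (k + 1), formL c B hc (α.insertNth v fun _ => z) := by
    change fderiv ℝ (fun z => formL c B hc (fun _ => z)) z v = _
    rw [(hasFDerivAt_diag (formL c B hc) z).fderiv, ContinuousLinearMap.comp_apply,
      ContinuousMultilinearMap.linearDeriv_apply]
    exact Finset.sum_congr rfl fun α _ =>
      congrArg _ (Fin.insertNth_removeNth (α := fun _ => Gevrey σ θ) α v fun _ => z).symm
  have hs := summable_sum fun α (_ : α ∈ Finset.univ) => summable_grad hc z v α
  rw [hdiag, Finset.sum_congr rfl fun α _ => formL_insertNth hc z v α,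
    ← Summable.tsum_finsetSum fun α _ => summable_grad hc z v α, hs.tsum_prod]
  refine tsum_congr fun i => ?_
  rw [polyEval, ← tsum_mul_left]
  refine tsum_congr fun j => ?_
  rw [partialCoef, Finset.sum_mul, Finset.mul_sum]
  exact Finset.sum_congr rfl fun α _ => by ring

lemma coord_single (a : ℤ) (ζ : ℂ) (i : Mode) (h : i.2 ≠ a) :
    coord (single a ζ : Gevrey σ θ) i = 0 := by
  rw [← norm_eq_zero, norm_coord, single_apply, if_neg h, norm_zero]

lemma tsum_coord_single (a : ℤ) (ζ : ℂ) (g : Mode → ℂ) :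
    ∑' i, coord (single a ζ : Gevrey σ θ) i * g i = ζ * g (1, a) + conj ζ * g (-1, a) := by
  rw [tsum_eq_sum (s := {((1 : ℤˣ), a), ((-1 : ℤˣ), a)})]
  · rw [Finset.sum_pair (by simp), coord_one, coord_neg_one]
    simp [single_apply]
  · intro i hi
    rw [coord_single, zero_mul]
    rintro rfl
    rcases mode_cases i with h | h <;> rw [h] at hi <;> simp at hi

lemma fderiv_polyEval_single (hc : ∀ j, ‖c j‖ ≤ B * tupleWeight σ θ j) (z : Gevrey σ θ)
    (a : ℤ) (ζ : ℂ) :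
    fderiv ℝ (polyEval c) z (single a ζ)
      = ζ * polyEval (partialCoef c (1, a)) z + conj ζ * polyEval (partialCoef c (-1, a)) z := by
  rw [fderiv_polyEval hc, tsum_coord_single]

lemma dzbar_polyEval (hc : ∀ j, ‖c j‖ ≤ B * tupleWeight σ θ j) (z : Gevrey σ θ) (a : ℤ) :
    dzbar (polyEval c) z a = polyEval (partialCoef c (-1, a)) z := by
  rw [dzbar, fderiv_polyEval_single hc, fderiv_polyEval_single hc, map_one, Complex.conj_I]
  linear_combination
    (polyEval (partialCoef c (1, a)) z - polyEval (partialCoef c (-1, a)) z) / 2 * Complex.I_sq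

end Gradient

end Polynomial

end Gevrey

/-! ### Hamiltonian vector fields -/

namespace Gevrey

section SymplecticForm

variable {σ θ : ℝ}

lemma norm_mul_conj_le (hσ : 0 ≤ σ) (u w : Gevrey σ θ) (a : ℤ) :
    ‖u a * conj (w a)‖ ≤ ‖u‖ * (gevreyWeight σ θ a * ‖w a‖) := by
  rw [norm_mul, RCLike.norm_conj]
  have hweight := one_le_gevreyWeight (θ := θ) hσ a
  have hu : ‖u a‖ ≤ ‖u‖ := by
    nlinarith [weight_mul_norm_le u a, norm_nonneg (u a)]
  exact mul_le_mul hu (le_mul_of_one_le_left (norm_nonneg _) hweight) (norm_nonneg _)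
    (norm_nonneg _)

lemma summable_pairing (hσ : 0 ≤ σ) (u w : Gevrey σ θ) : Summable fun a => u a * conj (w a) :=
  Summable.of_norm_bounded ((summable w).mul_left ‖u‖) (norm_mul_conj_le hσ u w)

lemma norm_pairing_le (hσ : 0 ≤ σ) (u w : Gevrey σ θ) :
    ‖∑' a, u a * conj (w a)‖ ≤ ‖u‖ * ‖w‖ := by
  refine (tsum_of_norm_bounded ((summable w).hasSum.mul_left ‖u‖) (norm_mul_conj_le hσ u w)).trans
    (mul_le_mul_of_nonneg_left ?_ (norm_nonneg u))
  linarith [norm_def w, norm_nonneg w]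

/-- The symplectic form `(i u, w)_{L²}`. -/
def omega (hσ : 0 ≤ σ) : Gevrey σ θ →L[ℝ] Gevrey σ θ →L[ℝ] ℝ :=
  LinearMap.mkContinuous₂
    (LinearMap.mk₂ ℝ (fun u w => (Complex.I * ∑' a, u a * conj (w a)).re)
      (fun u v w => by
        rw [← Complex.add_re, ← mul_add,
          ← (summable_pairing hσ u w).tsum_add (summable_pairing hσ v w)]
        congr 3
        funext a
        rw [add_apply, add_mul])
      (fun r u w => by
        rw [smul_eq_mul, ← Complex.re_ofReal_mul, mul_left_comm, ← tsum_mul_left (a := (r : ℂ))]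
        congr 3
        funext a
        rw [smul_apply, Complex.real_smul, mul_assoc])
      (fun u v w => by
        rw [← Complex.add_re, ← mul_add,
          ← (summable_pairing hσ u v).tsum_add (summable_pairing hσ u w)]
        congr 3
        funext a
        rw [add_apply, map_add, mul_add])
      (fun r u w => by
        rw [smul_eq_mul, ← Complex.re_ofReal_mul, mul_left_comm, ← tsum_mul_left (a := (r : ℂ))]
        congr 3
        funext a
        rw [smul_apply, Complex.real_smul, map_mul, Complex.conj_ofReal]
        ring)) 1 (fun u w => by
      rw [LinearMap.mk₂_apply, one_mul]
      refine (Complex.abs_re_le_norm _).trans ?_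
      rw [norm_mul, Complex.norm_I, one_mul]
      exact norm_pairing_le hσ u w)

lemma omega_apply (hσ : 0 ≤ σ) (u w : Gevrey σ θ) :
    omega hσ u w = (Complex.I * ∑' a, u a * conj (w a)).re := rfl

lemma omega_eq_l2Inner (hσ : 0 ≤ σ) (u w : Gevrey σ θ) :
    omega hσ u w = l2Inner (fun a => Complex.I * u a) w := by
  rw [omega_apply, l2Inner, ← tsum_mul_left]
  simp only [mul_assoc]

lemma omega_antisymm (hσ : 0 ≤ σ) (u w : Gevrey σ θ) : omega hσ u w = -omega hσ w u := by
  rw [omega_apply, omega_apply, ← Complex.conj_re, map_mul, Complex.conj_tsum, Complex.conj_I,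
    neg_mul, Complex.neg_re]
  congr 4
  funext a
  rw [map_mul, Complex.conj_conj, mul_comm]

lemma tsum_mode (f : Mode → ℂ) (h1 : Summable fun a : ℤ => f (1, a))
    (h2 : Summable fun a : ℤ => f (-1, a)) :
    ∑' i, f i = ∑' a : ℤ, f (1, a) + ∑' a : ℤ, f (-1, a) := by
  have hi : ∀ δ : ℤˣ, Function.Injective fun a : ℤ => ((δ, a) : Mode) :=
    fun δ a b h => (Prod.ext_iff.1 h).2
  have key : ∀ δ : ℤˣ, Summable (fun a : ℤ => f (δ, a)) →
      HasSum (fun i : Mode => if i.1 = δ then f i else 0) (∑' a : ℤ, f (δ, a)) := by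
    intro δ hδ
    rw [← (hi δ).hasSum_iff]
    · simpa [Function.comp_def] using hδ.hasSum
    · rintro ⟨ε, a⟩ hx
      refine if_neg fun h => hx ⟨a, ?_⟩
      simp only at h
      rw [h]
  refine (((key 1 h1).add (key (-1) h2)).congr_fun fun i => ?_).tsum_eq
  rcases mode_cases i with h | h <;> rw [h] <;> simp

end SymplecticForm

end Gevrey

lemma nonneg_of_coeff_bound {k : ℕ} {c : (Fin k → Mode) → ℂ} {B : ℝ} (hB : ∀ j, ‖c j‖ ≤ B) :
    0 ≤ B :=
  (norm_nonneg _).trans (hB fun _ => (1, 0))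

lemma weighted_coeff_bound {σ θ : ℝ} (hσ : 0 ≤ σ) {k : ℕ} {c : (Fin k → Mode) → ℂ} {B : ℝ}
    (hB : ∀ j, ‖c j‖ ≤ B) (j : Fin k → Mode) : ‖c j‖ ≤ B * tupleWeight σ θ j :=
  (hB j).trans (le_mul_of_one_le_right (nonneg_of_coeff_bound hB) (one_le_tupleWeight hσ j))

namespace Gevrey

section VectorField

variable {σ θ : ℝ} {k : ℕ} {c : (Fin (k + 1) → Mode) → ℂ} {B : ℝ}

lemma conj_tsum_coeffs (f : (Fin k → Mode) → ℂ) :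
    conj (∑' j, f j) = ∑' j, conj (f (conjTuple j)) := by
  rw [Complex.conj_tsum, ← (conjTupleEquiv k).tsum_eq]
  rfl

lemma conj_polyEval_partialCoef (hc : RealCoeffs c) (i : Mode) (z : Gevrey σ θ) :
    conj (polyEval (partialCoef c i) z) = polyEval (partialCoef c (Mode.conj i)) z := by
  rw [polyEval, conj_tsum_coeffs, polyEval]
  refine tsum_congr fun j => ?_
  rw [map_mul, conj_partialCoef hc, conj_mono, conjTuple_conjTuple]

lemma polyEval_partialCoef_one (hr : RealCoeffs c) (z : Gevrey σ θ) (a : ℤ) :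
    polyEval (partialCoef c (1, a)) z = conj (polyEval (partialCoef c (-1, a)) z) := by
  rw [conj_polyEval_partialCoef hr, Mode.conj, neg_neg]

lemma conj_polyEval {c : (Fin k → Mode) → ℂ} (hc : RealCoeffs c)
    (z : Gevrey σ θ) : conj (polyEval c z) = polyEval c z := by
  rw [polyEval, conj_tsum_coeffs]
  refine tsum_congr fun j => ?_
  rw [map_mul, hc, conj_mono, conjTuple_conjTuple]

/-- The coefficients of the Hamiltonian vector field. -/
def vfCoef (c : (Fin (k + 1) → Mode) → ℂ) (j : Fin k → Mode) : ℂ :=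
  Complex.I * partialCoef c (-1, momentum j) j

/-- The Hamiltonian vector field of `polyEval c`, for `c` supported on zero momentum. -/
def vf (c : (Fin (k + 1) → Mode) → ℂ) (z : Gevrey σ θ) : Gevrey σ θ :=
  ∑' j : Fin k → Mode, single (momentum j) (vfCoef c j * mono z j)

lemma norm_vfCoef_le (hB : ∀ j, ‖c j‖ ≤ B)
    (j : Fin k → Mode) : ‖vfCoef c j‖ ≤ (k + 1) * B := by
  rw [vfCoef, norm_mul, Complex.norm_I, one_mul]
  exact norm_partialCoef_le hB _ _

lemma norm_vf_term_le (hσ : 0 ≤ σ) (hθ : 0 < θ) (hθ1 : θ ≤ 1) (hB : ∀ j, ‖c j‖ ≤ B)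
    (j : Fin k → Mode) :
    ‖(singleL (momentum j) : ℂ →L[ℝ] Gevrey σ θ).comp (ContinuousLinearMap.mul ℝ ℂ (vfCoef c j))‖
      ≤ 2 * (k + 1) * B * tupleWeight σ θ j := by
  have hsingle := (norm_singleL_le (momentum j)).trans
    (mul_le_mul_of_nonneg_left (gevreyWeight_momentum_le hσ hθ hθ1 j) zero_le_two)
  refine (ContinuousLinearMap.opNorm_comp_le _ _).trans ?_
  rw [ContinuousLinearMap.opNorm_mul_apply]
  calc _ ≤ 2 * tupleWeight σ θ j * ((k + 1) * B) :=
        mul_le_mul hsingle (norm_vfCoef_le hB j) (norm_nonneg _) ((norm_nonneg _).trans hsingle)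
    _ = _ := by ring

/-- The multilinear map whose restriction to the diagonal is `vf c`. -/
def vfML (hσ : 0 ≤ σ) (hθ : 0 < θ) (hθ1 : θ ≤ 1) (hB : ∀ j, ‖c j‖ ≤ B) :
    ContinuousMultilinearMap ℝ (fun _ : Fin k => Gevrey σ θ) (Gevrey σ θ) :=
  tupleML _ (2 * (k + 1) * B) (norm_vf_term_le hσ hθ hθ1 hB)

section Bounded

variable (hσ : 0 ≤ σ) (hθ : 0 < θ) (hθ1 : θ ≤ 1) (hB : ∀ j, ‖c j‖ ≤ B)

lemma vf_eq_vfML (z : Gevrey σ θ) : vf c z = vfML hσ hθ hθ1 hB (fun _ => z) := rfl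

lemma norm_vfML_le : ‖vfML hσ hθ hθ1 hB‖ ≤ 2 * (k + 1) * B :=
  norm_tupleML_le _ _ _ (by have := nonneg_of_coeff_bound hB; positivity)

include hσ hθ hθ1 hB

lemma summable_vf (z : Gevrey σ θ) :
    Summable fun j : Fin k → Mode => (single (momentum j) (vfCoef c j * mono z j) : Gevrey σ θ) :=
  summable_tuple (norm_vf_term_le hσ hθ hθ1 hB) (fun _ => z)

lemma norm_vf_le (z : Gevrey σ θ) : ‖vf c z‖ ≤ 2 * (k + 1) * B * ‖z‖ ^ k := by
  rw [vf_eq_vfML hσ hθ hθ1 hB]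
  refine (ContinuousMultilinearMap.le_opNorm _ _).trans ?_
  rw [Finset.prod_const, Finset.card_univ, Fintype.card_fin]
  exact mul_le_mul_of_nonneg_right (norm_vfML_le hσ hθ hθ1 hB) (by positivity)

lemma contDiff_vf : ContDiff ℝ ∞ (vf c : Gevrey σ θ → Gevrey σ θ) :=
  contDiff_diag (vfML hσ hθ hθ1 hB)

lemma norm_vf_sub_le (x y : Gevrey σ θ) {S : ℝ} (hx : ‖x‖ ≤ S) (hy : ‖y‖ ≤ S) :
    ‖vf c x - vf c y‖ ≤ 2 * (k + 1) * B * k * S ^ (k - 1) * ‖x - y‖ := by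
  have h0 := nonneg_of_coeff_bound hB
  have hS : 0 ≤ S := (norm_nonneg _).trans hx
  rw [vf_eq_vfML hσ hθ hθ1 hB, vf_eq_vfML hσ hθ hθ1 hB]
  refine (ContinuousMultilinearMap.norm_image_sub_le _ _ _).trans ?_
  rw [Fintype.card_fin]
  have hdiff : ‖(fun _ : Fin k => x) - (fun _ => y)‖ ≤ ‖x - y‖ := pi_norm_const_le (x - y)
  gcongr
  · exact norm_vfML_le hσ hθ hθ1 hB
  · exact max_le ((pi_norm_const_le x).trans hx) ((pi_norm_const_le y).trans hy)

lemma vf_apply (hc : MomentumSupported c) (z : Gevrey σ θ) (a : ℤ) :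
    vf c z a = Complex.I * polyEval (partialCoef c (-1, a)) z := by
  have hcoeff := ((summable_vf hσ hθ hθ1 hB z).hasSum.mapL (coeffL a)).tsum_eq
  rw [polyEval, ← tsum_mul_left]
  refine hcoeff.symm.trans (tsum_congr fun j => ?_)
  rw [coeffL_apply, single_apply, vfCoef]
  split_ifs with h
  · rw [h, mul_assoc]
  · rw [hc.partialCoef_neg h, zero_mul, mul_zero]

lemma hamVF_polyEval (hc : MomentumSupported c) (z : Gevrey σ θ) (a : ℤ) :
    hamVF (polyEval c) z a = vf c z a := by
  rw [vf_apply hσ hθ hθ1 hB hc, hamVF, dzbar_polyEval (weighted_coeff_bound hσ hB)]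

lemma summable_conj_mul_gradient (hc : MomentumSupported c) (z w : Gevrey σ θ) :
    Summable fun a => conj (w a) * polyEval (partialCoef c (-1, a)) z := by
  refine ((summable_pairing hσ (vf c z) w).mul_left (-Complex.I)).congr fun a => ?_
  rw [vf_apply hσ hθ hθ1 hB hc]
  linear_combination (-(conj (w a) * polyEval (partialCoef c (-1, a)) z)) * Complex.I_sq

lemma fderiv_polyEval_eq_add_conj (hc : MomentumSupported c) (hr : RealCoeffs c)
    (z w : Gevrey σ θ) :
    fderiv ℝ (polyEval c) z w
      = conj (∑' a, conj (w a) * polyEval (partialCoef c (-1, a)) z)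
        + ∑' a, conj (w a) * polyEval (partialCoef c (-1, a)) z := by
  have hs := summable_conj_mul_gradient hσ hθ hθ1 hB hc z w
  have hconj : ∀ a, conj (conj (w a) * polyEval (partialCoef c (-1, a)) z)
      = w a * polyEval (partialCoef c (1, a)) z := fun a => by
    rw [map_mul, Complex.conj_conj, polyEval_partialCoef_one hr]
  have hs' : Summable fun a => w a * polyEval (partialCoef c (1, a)) z :=
    (Complex.conjCLE.summable.2 hs).congr hconj
  rw [fderiv_polyEval (weighted_coeff_bound hσ hB),
    tsum_mode (fun i => coord w i * polyEval (partialCoef c i) z)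
      (by simpa only [coord_one] using hs') (by simpa only [coord_neg_one] using hs),
    Complex.conj_tsum]
  simp only [coord_one, coord_neg_one, hconj]

lemma omega_vf (hc : MomentumSupported c) (hr : RealCoeffs c) (z w : Gevrey σ θ) :
    omega hσ (vf c z) w = -(1 / 2) * (fderiv ℝ (polyEval c) z w).re := by
  have hpairing : Complex.I * ∑' a, vf c z a * conj (w a)
      = -∑' a, conj (w a) * polyEval (partialCoef c (-1, a)) z := by
    rw [← tsum_mul_left, ← tsum_neg]
    refine tsum_congr fun a => ?_
    rw [vf_apply hσ hθ hθ1 hB hc]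
    linear_combination (conj (w a) * polyEval (partialCoef c (-1, a)) z) * Complex.I_sq
  rw [fderiv_polyEval_eq_add_conj hσ hθ hθ1 hB hc hr, omega_apply, hpairing, Complex.neg_re,
    Complex.add_re, Complex.conj_re]
  ring

end Bounded

end VectorField

end Gevrey

/-! ### Poisson brackets -/

/-- The first `k` entries of a tuple of length `n = k + l`. -/
def headTuple {k l n : ℕ} (h : k + l = n) (j : Fin n → Mode) : Fin k → Mode :=
  fun i => j (Fin.cast h (Fin.castAdd l i))

/-- The last `l` entries of a tuple of length `n = k + l`. -/
def tailTuple {k l n : ℕ} (h : k + l = n) (j : Fin n → Mode) : Fin l → Mode :=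
  fun i => j (Fin.cast h (Fin.natAdd k i))

/-- Splitting a tuple in two. -/
def splitTuple {k l n : ℕ} (h : k + l = n) :
    (Fin n → Mode) ≃ (Fin k → Mode) × (Fin l → Mode) where
  toFun j := (headTuple h j, tailTuple h j)
  invFun x := fun i => Fin.append x.1 x.2 (Fin.cast h.symm i)
  left_inv j := by
    subst h
    funext i
    refine Fin.addCases (fun i => ?_) (fun i => ?_) i <;> simp [headTuple, tailTuple]
  right_inv x := by
    subst h
    ext i <;> simp [headTuple, tailTuple]

/-- The coefficients of the Poisson bracket `dQ(X_χ)`. -/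
def bracket {k l n : ℕ} (h : k + l = n) (χ : (Fin (k + 1) → Mode) → ℂ)
    (Q : (Fin (l + 1) → Mode) → ℂ) (j : Fin n → Mode) : ℂ :=
  Complex.I *
    (partialCoef χ (-1, momentum (headTuple h j)) (headTuple h j)
        * partialCoef Q (1, momentum (headTuple h j)) (tailTuple h j)
      - partialCoef χ (1, -momentum (headTuple h j)) (headTuple h j)
        * partialCoef Q (-1, -momentum (headTuple h j)) (tailTuple h j))

section Bracket

variable {k l n : ℕ} (h : k + l = n)

lemma charge_split (j : Fin n → Mode) :
    charge j = charge (headTuple h j) + charge (tailTuple h j) := by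
  subst h
  simp [charge, headTuple, tailTuple, Fin.sum_univ_add]

lemma momentum_split (j : Fin n → Mode) :
    momentum j = momentum (headTuple h j) + momentum (tailTuple h j) := by
  subst h
  simp [momentum, headTuple, tailTuple, Fin.sum_univ_add]

lemma mono_split {σ θ : ℝ} (z : Gevrey σ θ) (j : Fin n → Mode) :
    z.mono j = z.mono (headTuple h j) * z.mono (tailTuple h j) := by
  subst h
  simp [Gevrey.mono, headTuple, tailTuple, Fin.prod_univ_add]

lemma headTuple_conj (j : Fin n → Mode) : headTuple h (conjTuple j) = conjTuple (headTuple h j) :=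
  rfl

lemma tailTuple_conj (j : Fin n → Mode) : tailTuple h (conjTuple j) = conjTuple (tailTuple h j) :=
  rfl

variable {χ : (Fin (k + 1) → Mode) → ℂ} {Q : (Fin (l + 1) → Mode) → ℂ}

lemma norm_bracket_le {B C : ℝ} (hχ : ∀ j, ‖χ j‖ ≤ B) (hQ : ∀ j, ‖Q j‖ ≤ C) (j : Fin n → Mode) :
    ‖bracket h χ Q j‖ ≤ 2 * (k + 1) * (l + 1) * B * C := by
  have hB := nonneg_of_coeff_bound hχ
  rw [bracket, norm_mul, Complex.norm_I, one_mul]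
  refine (norm_sub_le _ _).trans ?_
  rw [norm_mul, norm_mul]
  have hprod : ∀ i i', ‖partialCoef χ i (headTuple h j)‖ * ‖partialCoef Q i' (tailTuple h j)‖
      ≤ ((k + 1) * B) * ((l + 1) * C) := fun i i' =>
    mul_le_mul (norm_partialCoef_le hχ _ _) (norm_partialCoef_le hQ _ _) (norm_nonneg _)
      (by positivity)
  refine (add_le_add (hprod _ _) (hprod _ _)).trans (le_of_eq ?_)
  ring

lemma MomentumSupported.of_partialCoef_mul_ne (hχ : MomentumSupported χ)
    (hQ : MomentumSupported Q) {δ : ℤˣ} {a : ℤ} {i : Fin k → Mode} {j : Fin l → Mode}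
    (hne : partialCoef χ (δ, a) i * partialCoef Q (-δ, a) j ≠ 0) :
    charge i + charge j = 0 ∧ momentum i + momentum j = 0 := by
  have hi := hχ.of_partialCoef_ne (left_ne_zero_of_mul hne)
  have hj := hQ.of_partialCoef_ne (right_ne_zero_of_mul hne)
  rw [Units.val_neg] at hj
  constructor <;> linarith [hi.1, hi.2, hj.1, hj.2]

lemma momentumSupported_bracket (hχ : MomentumSupported χ) (hQ : MomentumSupported Q) :
    MomentumSupported (bracket h χ Q) := by
  intro j hj
  rw [charge_split h, momentum_split h]
  rcases ne_or_eq (partialCoef χ (-1, momentum (headTuple h j)) (headTuple h j)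
    * partialCoef Q (1, momentum (headTuple h j)) (tailTuple h j)) 0 with hne | heq
  · exact hχ.of_partialCoef_mul_ne hQ (δ := -1) hne
  · rw [bracket, heq, zero_sub] at hj
    exact hχ.of_partialCoef_mul_ne hQ (δ := 1) (neg_ne_zero.1 (right_ne_zero_of_mul hj))

lemma realCoeffs_bracket (hχ : RealCoeffs χ) (hQ : RealCoeffs Q) :
    RealCoeffs (bracket h χ Q) := by
  intro j
  simp only [bracket, map_mul, map_sub, conj_partialCoef hχ, conj_partialCoef hQ, Complex.conj_I,
    headTuple_conj, tailTuple_conj, momentum_conjTuple, Mode.conj, neg_neg]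
  ring

end Bracket

namespace Gevrey

section Bracket

variable {σ θ : ℝ} (hσ : 0 ≤ σ) (hθ : 0 < θ) (hθ1 : θ ≤ 1) {k : ℕ}
  {c : (Fin (k + 1) → Mode) → ℂ} {B : ℝ} (hB : ∀ j, ‖c j‖ ≤ B)

lemma conj_vfCoef_conjTuple (hr : RealCoeffs c) (j : Fin k → Mode) :
    conj (vfCoef c (conjTuple j)) = -(Complex.I * partialCoef c (1, -momentum j) j) := by
  rw [vfCoef, map_mul, conj_partialCoef hr, conjTuple_conjTuple, momentum_conjTuple,
    Complex.conj_I, Mode.conj, neg_neg, neg_mul]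

include hσ hθ hθ1 hB

lemma norm_vfCoef_mul_le {g : Mode → ℂ} {G : ℝ}
    (hg : ∀ i, ‖g i‖ ≤ G * gevreyWeight σ θ i.2) (δ : ℤˣ) (j : Fin k → Mode) :
    ‖vfCoef c j * g (δ, momentum j)‖ ≤ (k + 1) * B * G * tupleWeight σ θ j := by
  have hG : 0 ≤ G :=
    nonneg_of_mul_nonneg_left ((norm_nonneg _).trans (hg (1, 0))) (gevreyWeight_pos _ _ _)
  have hB0 := nonneg_of_coeff_bound hB
  rw [norm_mul]
  calc ‖vfCoef c j‖ * ‖g (δ, momentum j)‖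
      ≤ ((k + 1) * B) * (G * tupleWeight σ θ j) :=
        mul_le_mul (norm_vfCoef_le hB j) ((hg (δ, momentum j)).trans (mul_le_mul_of_nonneg_left
          (gevreyWeight_momentum_le hσ hθ hθ1 j) hG)) (norm_nonneg _) (by positivity)
    _ = (k + 1) * B * G * tupleWeight σ θ j := by ring

lemma apply_vf (hr : RealCoeffs c) (L : Gevrey σ θ →L[ℝ] ℂ) (g : Mode → ℂ) (G : ℝ)
    (hL : ∀ a ζ, L (single a ζ) = ζ * g (1, a) + conj ζ * g (-1, a))
    (hg : ∀ i, ‖g i‖ ≤ G * gevreyWeight σ θ i.2) (z : Gevrey σ θ) :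
    L (vf c z) = ∑' j : Fin k → Mode, Complex.I *
      (partialCoef c (-1, momentum j) j * g (1, momentum j)
        - partialCoef c (1, -momentum j) j * g (-1, -momentum j)) * mono z j := by
  set A : (Fin k → Mode) → ℂ := fun j => vfCoef c j * g (1, momentum j) * mono z j with hA
  set F : (Fin k → Mode) → ℂ := fun j => conj (vfCoef c j * mono z j) * g (-1, momentum j) with hF
  have hs : ∀ δ, Summable fun j => ‖vfCoef c j * g (δ, momentum j) * mono z j‖ := fun δ =>
    summable_norm_poly (norm_vfCoef_mul_le hσ hθ hθ1 hB hg δ) z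
  have hsA : Summable A := (hs 1).of_norm
  have hsF : Summable F := Summable.of_norm <| (hs (-1)).congr fun j => by
    simp only [hF, norm_mul, RCLike.norm_conj]
    ring
  have hterm : ∀ j, L (single (momentum j) (vfCoef c j * mono z j)) = A j + F j := fun j => by
    rw [hL, hA, hF]
    ring
  have hFconj : ∀ j, F (conjTuple j)
      = -(Complex.I * partialCoef c (1, -momentum j) j) * g (-1, -momentum j) * mono z j := by
    intro j
    simp only [hF, map_mul, conj_vfCoef_conjTuple hr, conj_mono, conjTuple_conjTuple,
      momentum_conjTuple]
    ring
  calc L (vf c z) = ∑' j, (A j + F j) :=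
        ((summable_vf hσ hθ hθ1 hB z).hasSum.mapL L).tsum_eq.symm.trans (tsum_congr hterm)
    _ = ∑' j, A j + ∑' j, F (conjTuple j) := by
        rw [hsA.tsum_add hsF]
        exact congrArg _ ((conjTupleEquiv k).tsum_eq F).symm
    _ = ∑' j, (A j + F (conjTuple j)) :=
        (hsA.tsum_add ((conjTupleEquiv k).summable_iff.2 hsF)).symm
    _ = _ := tsum_congr fun j => by
        simp only [hFconj, hA, vfCoef]
        ring

variable {l n : ℕ} (h : k + l = n) {Q : (Fin (l + 1) → Mode) → ℂ} {C : ℝ}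

omit hθ hθ1 in
lemma polyEval_bracket (hQ : ∀ j, ‖Q j‖ ≤ C) (z : Gevrey σ θ) :
    polyEval (bracket h c Q) z = ∑' j : Fin k → Mode, Complex.I *
      (partialCoef c (-1, momentum j) j * polyEval (partialCoef Q (1, momentum j)) z
        - partialCoef c (1, -momentum j) j * polyEval (partialCoef Q (-1, -momentum j)) z)
        * mono z j := by
  have hs := summable_poly (weighted_coeff_bound (θ := θ) hσ (norm_bracket_le h hB hQ)) z
  have hiter := ((splitTuple h).symm.summable_iff.2 hs).tsum_prod
  simp only [Function.comp_apply] at hiter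
  rw [polyEval, ← (splitTuple h).symm.tsum_eq, hiter]
  refine tsum_congr fun j => ?_
  have hsQ : ∀ i, Summable fun j' => partialCoef Q i j' * mono z j' := fun i =>
    summable_poly (norm_partialCoef_le_weight (weighted_coeff_bound (θ := θ) hσ hQ) i) z
  have hsplit : ∀ j', splitTuple h ((splitTuple h).symm (j, j')) = (j, j') :=
    fun j' => (splitTuple h).apply_symm_apply _
  have hhead : ∀ j', headTuple h ((splitTuple h).symm (j, j')) = j :=
    fun j' => congrArg Prod.fst (hsplit j')
  have htail : ∀ j', tailTuple h ((splitTuple h).symm (j, j')) = j' :=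
    fun j' => congrArg Prod.snd (hsplit j')
  simp only [bracket, mono_split h, hhead, htail]
  rw [polyEval, polyEval, ← tsum_mul_left, ← tsum_mul_left,
    ← ((hsQ _).mul_left _).tsum_sub ((hsQ _).mul_left _), ← tsum_mul_left, ← tsum_mul_right]
  exact tsum_congr fun j' => by ring

lemma fderiv_polyEval_vf (hr : RealCoeffs c) (hQ : ∀ j, ‖Q j‖ ≤ C) (z : Gevrey σ θ) :
    fderiv ℝ (polyEval Q) z (vf c z) = polyEval (bracket h c Q) z := by
  have hw := weighted_coeff_bound (θ := θ) hσ hQ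
  rw [polyEval_bracket hσ hB h hQ]
  refine apply_vf hσ hθ hθ1 hB hr _ (fun i => polyEval (partialCoef Q i) z) ((l + 1) * C * ‖z‖ ^ l)
    (fun a ζ => fderiv_polyEval_single hw z a ζ) (fun i => ?_) z
  refine (norm_polyEval_le (norm_partialCoef_le_weight hw i) z).trans (le_of_eq ?_)
  ring

end Bracket

end Gevrey

/-- The coefficients of `L₂`. -/
def l2Coef (j : Fin 2 → Mode) : ℂ :=
  if (j 0).1 = 1 ∧ j 1 = Mode.conj (j 0) then ((j 0).2 : ℂ) ^ 2 else 0

lemma gevreyWeight_le_tupleWeight {σ θ : ℝ} (hσ : 0 ≤ σ) {k : ℕ} (j : Fin k → Mode) (α : Fin k) :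
    gevreyWeight σ θ (j α).2 ≤ tupleWeight σ θ j := by
  rw [tupleWeight, ← Finset.mul_prod_erase _ _ (Finset.mem_univ α)]
  exact le_mul_of_one_le_right (gevreyWeight_pos _ _ _).le <|
    Finset.prod_induction _ (1 ≤ ·) (fun _ _ => one_le_mul_of_one_le_of_one_le) le_rfl
      fun _ _ => one_le_gevreyWeight hσ _

lemma exists_l2Coef_bound {σ θ : ℝ} (hσ : 0 < σ) (hθ : 0 < θ) :
    ∃ B : ℝ, ∀ j, ‖l2Coef j‖ ≤ B * tupleWeight σ θ j := by
  obtain ⟨B, hB⟩ := exists_sq_le_gevreyWeight hσ hθ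
  have hB0 : 0 ≤ B :=
    nonneg_of_mul_nonneg_left ((sq_nonneg _).trans (hB 0)) (gevreyWeight_pos _ _ _)
  refine ⟨B, fun j => ?_⟩
  rw [l2Coef]
  split_ifs
  · rw [norm_pow, Complex.norm_intCast, sq_abs]
    exact (hB _).trans (mul_le_mul_of_nonneg_left (gevreyWeight_le_tupleWeight hσ.le j 0) hB0)
  · rw [norm_zero]
    exact mul_nonneg hB0 (tupleWeight_pos σ θ j).le

lemma partialCoef_l2Coef (i : Mode) (j : Fin 1 → Mode) :
    partialCoef l2Coef i j = if j 0 = Mode.conj i then (i.2 : ℂ) ^ 2 else 0 := by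
  have h0 : ((0 : Fin 2).insertNth i j : Fin 2 → Mode) = ![i, j 0] := by
    funext x; fin_cases x <;> rfl
  have h1 : ((1 : Fin 2).insertNth i j : Fin 2 → Mode) = ![j 0, i] := by
    funext x; fin_cases x <;> rfl
  rw [partialCoef, Fin.sum_univ_two, h0, h1]
  simp only [l2Coef, Matrix.cons_val_zero, Matrix.cons_val_one]
  generalize j 0 = b
  obtain ⟨δ, a⟩ := i
  obtain ⟨ε, b⟩ := b
  simp only [Mode.conj, Prod.mk.injEq]
  rcases Int.units_eq_one_or δ with rfl | rfl <;> rcases Int.units_eq_one_or ε with rfl | rfl <;>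
    rcases eq_or_ne b a with rfl | hab <;> simp [*, Ne.symm]

lemma MomentumSupported.tsum_partialCoef_mul {k : ℕ} {c : (Fin (k + 1) → Mode) → ℂ}
    (hc : MomentumSupported c) (j : Fin k → Mode) (g : Mode → ℂ) :
    ∑' i, partialCoef c i j * g i
      = partialCoef c (-1, momentum j) j * g (-1, momentum j)
        + partialCoef c (1, -momentum j) j * g (1, -momentum j) := by
  rw [tsum_eq_sum (s := {((-1 : ℤˣ), momentum j), ((1 : ℤˣ), -momentum j)}),
    Finset.sum_pair (by simp)]
  intro i hi
  suffices partialCoef c i j = 0 by rw [this, zero_mul]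
  rcases Gevrey.mode_cases i with h | h <;> rw [h] at hi ⊢
  · exact hc.partialCoef_pos fun h' => hi (by rw [h']; simp)
  · exact hc.partialCoef_neg fun h' => hi (by rw [h']; simp)

namespace Gevrey

section Quadratic

variable {σ θ : ℝ}

lemma polyEval_l2Coef (z : Gevrey σ θ) : polyEval l2Coef z = (NLSP.L2 z : ℂ) := by
  have hinj : Function.Injective
      fun a : ℤ => (![((1 : ℤˣ), a), ((-1 : ℤˣ), a)] : Fin 2 → Mode) :=
    fun a b hab => (Prod.ext_iff.1 (congrFun hab 0)).2
  rw [polyEval, ← hinj.tsum_eq, NLSP.L2, Complex.ofReal_tsum]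
  · refine tsum_congr fun a => ?_
    simp only [l2Coef, mono, Fin.prod_univ_two]
    rw [if_pos (by simp [Mode.conj])]
    simp only [Matrix.cons_val_zero, Matrix.cons_val_one, coord_one, coord_neg_one]
    rw [Complex.mul_conj, Complex.normSq_eq_norm_sq]
    push_cast
    ring
  · intro j hj
    have hne : l2Coef j ≠ 0 := left_ne_zero_of_mul hj
    obtain ⟨hδ, hconj⟩ := (ite_ne_right_iff.1 hne).1
    refine ⟨(j 0).2, funext fun i => ?_⟩
    fin_cases i
    · exact Prod.ext hδ.symm rfl
    · refine Eq.trans ?_ hconj.symm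
      simp [Mode.conj, hδ]

lemma polyEval_partialCoef_l2Coef (z : Gevrey σ θ) (i : Mode) :
    polyEval (partialCoef l2Coef i) z = (i.2 : ℂ) ^ 2 * coord z (Mode.conj i) := by
  rw [polyEval, tsum_eq_single (fun _ => Mode.conj i)]
  · rw [partialCoef_l2Coef]
    simp [mono]
  · intro j hj
    rw [partialCoef_l2Coef, if_neg, zero_mul]
    exact fun h => hj (funext fun x => by rw [Subsingleton.elim x 0, h])

variable {k : ℕ} {c : (Fin (k + 1) → Mode) → ℂ} {B : ℝ}

-- Euler's identity for the operator `∑ᵢ νᵢ zᵢ ∂_{zᵢ}`, of which the monomials are eigenvectors.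
lemma polyEval_sum_mul (hσ : 0 ≤ σ) (hB : ∀ j, ‖c j‖ ≤ B) {ν : Mode → ℂ} {N : ℝ}
    (hν : ∀ i, ‖ν i‖ ≤ N * gevreyWeight σ θ i.2) (z : Gevrey σ θ) :
    polyEval (fun j => (∑ β, ν (j β)) * c j) z
      = ∑' j : Fin k → Mode, ∑' i, partialCoef c i j * (ν i * coord z i * mono z j) := by
  have hN : 0 ≤ N :=
    nonneg_of_mul_nonneg_left ((norm_nonneg _).trans (hν (1, 0))) (gevreyWeight_pos _ _ _)
  have hf : ∀ β j, ‖ν (j β) * c j‖ ≤ N * B * tupleWeight σ θ j := fun β j => by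
    rw [norm_mul, mul_right_comm]
    exact mul_le_mul ((hν _).trans (mul_le_mul_of_nonneg_left (gevreyWeight_le_tupleWeight hσ j β)
      hN)) (hB j) (norm_nonneg _) (mul_nonneg hN (tupleWeight_pos σ θ j).le)
  have hinsert : ∀ β, ∑' j, ν (j β) * c j * mono z j = ∑' x : Mode × (Fin k → Mode),
      ν x.1 * c (β.insertNth x.1 x.2) * (coord z x.1 * mono z x.2) := fun β => by
    rw [← (Fin.insertNthEquiv (fun _ : Fin (k + 1) => Mode) β).tsum_eq]
    refine tsum_congr fun x => ?_
    change ν ((β.insertNth x.1 x.2 : Fin (k + 1) → Mode) β) * c (β.insertNth x.1 x.2)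
      * mono z (β.insertNth x.1 x.2) = _
    rw [Fin.insertNth_apply_same, mono_insertNth]
  have hs : ∀ β : Fin (k + 1), Summable fun x : Mode × (Fin k → Mode) =>
      ν x.1 * c (β.insertNth x.1 x.2) * (coord z x.1 * mono z x.2) := fun β =>
    (summable_grad (hf β) z z β).congr fun x => by rw [Fin.insertNth_apply_same]
  have hiter := ((Equiv.prodComm (Fin k → Mode) Mode).summable_iff.2
    (summable_sum fun β (_ : β ∈ Finset.univ) => hs β)).tsum_prod
  calc polyEval (fun j => (∑ β, ν (j β)) * c j) z
      = ∑ β, ∑' j, ν (j β) * c j * mono z j := by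
        rw [polyEval, ← Summable.tsum_finsetSum fun β _ => summable_poly (hf β) z]
        simp only [Finset.sum_mul]
    _ = ∑' x : Mode × (Fin k → Mode), ∑ β : Fin (k + 1),
          ν x.1 * c (β.insertNth x.1 x.2) * (coord z x.1 * mono z x.2) := by
        rw [Summable.tsum_finsetSum fun β _ => hs β]
        exact Finset.sum_congr rfl fun β _ => hinsert β
    _ = _ := by
        rw [← (Equiv.prodComm (Fin k → Mode) Mode).tsum_eq]
        refine hiter.trans (tsum_congr fun j => tsum_congr fun i => ?_)
        rw [partialCoef, Finset.sum_mul]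
        exact Finset.sum_congr rfl fun β _ => by
          simp only [Equiv.prodComm_apply, Prod.fst_swap, Prod.snd_swap]
          ring

lemma fderiv_L2_vf (hσ : 0 < σ) (hθ : 0 < θ) (hθ1 : θ ≤ 1) (hB : ∀ j, ‖c j‖ ≤ B)
    (hc : MomentumSupported c) (hr : RealCoeffs c) (z : Gevrey σ θ) :
    fderiv ℝ (polyEval l2Coef) z (vf c z)
      = polyEval (fun j => -Complex.I * divisor j * c j) z := by
  obtain ⟨B₂, hB₂⟩ := exists_l2Coef_bound hσ hθ
  obtain ⟨N, hN⟩ := exists_sq_le_gevreyWeight hσ hθ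
  let ν : Mode → ℂ := fun i => -Complex.I * ((i.1 : ℤ) * (i.2 : ℂ) ^ 2)
  have hν : ∀ i, ‖ν i‖ ≤ N * gevreyWeight σ θ i.2 := fun i => by
    refine le_trans (le_of_eq ?_) (hN i.2)
    rcases Int.units_eq_one_or i.1 with h | h <;> simp [ν, h]
  have hdivisor : (fun j : Fin (k + 1) → Mode => -Complex.I * divisor j * c j)
      = fun j => (∑ β, ν (j β)) * c j := by
    funext j
    simp only [ν, divisor, Finset.mul_sum, Int.cast_sum, Int.cast_mul, Int.cast_pow]
  have hgrad : ∀ i, ‖polyEval (partialCoef l2Coef i) z‖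
      ≤ ((1 : ℕ) + 1) * B₂ * ‖z‖ ^ 1 * gevreyWeight σ θ i.2 := fun i =>
    (norm_polyEval_le (norm_partialCoef_le_weight hB₂ i) z).trans (le_of_eq (by ring))
  rw [apply_vf hσ.le hθ hθ1 hB hr _ (fun i => polyEval (partialCoef l2Coef i) z) _
    (fun a ζ => fderiv_polyEval_single hB₂ z a ζ) hgrad, hdivisor, polyEval_sum_mul hσ.le hB hν]
  refine tsum_congr fun j => ?_
  rw [hc.tsum_partialCoef_mul, polyEval_partialCoef_l2Coef, polyEval_partialCoef_l2Coef]
  simp only [ν, Mode.conj, neg_neg, Units.val_neg, Units.val_one]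
  push_cast
  ring

end Quadratic

end Gevrey

/-! ### The homological equation -/

/-- Coefficients of a homogeneous polynomial of degree `2 p + 2`. -/
abbrev Coef (p : ℕ) : Type := (Fin (2 * p + 1 + 1) → Mode) → ℂ

/-- A formal sum of homogeneous polynomials; the `p`-th one has degree `2 p + 2`. -/
abbrev Family : Type := (p : ℕ) → Coef p

/-- The component of degree `2 p + 2` of the Poisson bracket. -/
def bracketAt {a b : ℕ} (p : ℕ) (χ : Coef a) (Q : Coef b) : Coef p :=
  if h : 2 * a + 1 + (2 * b + 1) = 2 * p + 1 + 1 then bracket h χ Q else 0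

/-- The derivation `Q ↦ dQ(X_F)` on formal sums. -/
def lieDeriv (F Q : Family) : Family := fun p =>
  ∑ x ∈ Finset.HasAntidiagonal.antidiagonal p, bracketAt p (F x.1) (Q x.2)

lemma bracketAt_zero_left {a b p : ℕ} (Q : Coef b) : bracketAt p (0 : Coef a) Q = 0 := by
  unfold bracketAt
  split_ifs
  · funext j
    simp [bracket, partialCoef]
  · rfl

lemma bracketAt_zero_right {a b p : ℕ} (χ : Coef a) : bracketAt p χ (0 : Coef b) = 0 := by
  unfold bracketAt
  split_ifs
  · funext j
    simp [bracket, partialCoef]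
  · rfl

/-- The coefficients of a real Hamiltonian that preserves mass and momentum. -/
structure Admissible {k : ℕ} (c : (Fin k → Mode) → ℂ) : Prop where
  supported : MomentumSupported c
  real : RealCoeffs c

namespace Admissible

variable {k : ℕ} {c d : (Fin k → Mode) → ℂ}

lemma zero : Admissible (0 : (Fin k → Mode) → ℂ) where
  supported _ h := absurd rfl h
  real _ := by simp only [Pi.zero_apply, map_zero]

lemma add (hc : Admissible c) (hd : Admissible d) : Admissible (c + d) where
  supported j hj := by
    by_cases h : c j = 0
    · exact hd.supported j fun h' => hj (by rw [Pi.add_apply, h, h', add_zero])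
    · exact hc.supported j h
  real j := by simp only [Pi.add_apply, map_add, hc.real j, hd.real j]

lemma smul (hc : Admissible c) (s : ℝ) : Admissible (s • c) where
  supported j hj := hc.supported j fun h => hj (by rw [Pi.smul_apply, h, smul_zero])
  real j := by simp [hc.real j]

lemma sum {ι : Type*} {s : Finset ι} {f : ι → (Fin k → Mode) → ℂ}
    (h : ∀ i ∈ s, Admissible (f i)) : Admissible (∑ i ∈ s, f i) :=
  Finset.sum_induction f Admissible (fun _ _ => Admissible.add) zero h

lemma bracketAt {a b p : ℕ} {χ : Coef a} {Q : Coef b} (hχ : Admissible χ) (hQ : Admissible Q) :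
    Admissible (bracketAt p χ Q) := by
  unfold _root_.bracketAt
  split_ifs with h
  · exact ⟨momentumSupported_bracket h hχ.1 hQ.1, realCoeffs_bracket h hχ.2 hQ.2⟩
  · exact zero

end Admissible

/-- Admissibility of every component. -/
def Family.Admissible (Q : Family) : Prop := ∀ p, _root_.Admissible (Q p)

lemma Family.Admissible.lieDeriv {F Q : Family} (hF : F.Admissible) (hQ : Q.Admissible) :
    (lieDeriv F Q).Admissible := fun _ =>
  Admissible.sum fun _ _ => (hF _).bracketAt (hQ _)

lemma Family.Admissible.iterate_lieDeriv {F Q : Family} (hF : F.Admissible) (hQ : Q.Admissible)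
    (k : ℕ) : Family.Admissible ((_root_.lieDeriv F)^[k] Q) := by
  induction k with
  | zero => exact hQ
  | succ k ih => rw [Function.iterate_succ_apply']; exact hF.lieDeriv ih

lemma lieDeriv_congr {F F' Q Q' : Family} {p : ℕ} (hF : ∀ q < p, F q = F' q)
    (hQ : ∀ q < p, Q q = Q' q) (hF0 : F 0 = 0) (hF0' : F' 0 = 0) (hQ0 : Q 0 = 0) (hQ0' : Q' 0 = 0)
    {q : ℕ} (hq : q ≤ p) : lieDeriv F Q q = lieDeriv F' Q' q := by
  refine Finset.sum_congr rfl ?_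
  rintro ⟨a, b⟩ hab
  replace hab : a + b = q := Finset.HasAntidiagonal.mem_antidiagonal.1 hab
  rcases Nat.eq_zero_or_pos a with rfl | ha
  · rw [hF0, hF0', bracketAt_zero_left, bracketAt_zero_left]
  rcases Nat.eq_zero_or_pos b with rfl | hb
  · rw [hQ0, hQ0', bracketAt_zero_right, bracketAt_zero_right]
  rw [hF a (by omega), hQ b (by omega)]

lemma iterate_lieDeriv_eq_zero {F Q : Family} (hF0 : F 0 = 0) (hQ0 : Q 0 = 0) (k : ℕ) :
    ∀ p ≤ k, (lieDeriv F)^[k] Q p = 0 := by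
  induction k with
  | zero =>
    intro p hp
    rw [Nat.le_zero.1 hp]
    exact hQ0
  | succ k ih =>
    intro p hp
    rw [Function.iterate_succ_apply']
    refine Finset.sum_eq_zero ?_
    rintro ⟨a, b⟩ hab
    replace hab : a + b = p := Finset.HasAntidiagonal.mem_antidiagonal.1 hab
    rcases Nat.eq_zero_or_pos a with rfl | ha
    · rw [hF0, bracketAt_zero_left]
    · rw [ih b (by omega), bracketAt_zero_right]

lemma iterate_lieDeriv_congr {F F' Q Q' : Family} {p : ℕ} (hF : ∀ q < p, F q = F' q)
    (hQ : ∀ q < p, Q q = Q' q) (hF0 : F 0 = 0) (hF0' : F' 0 = 0) (hQ0 : Q 0 = 0) (hQ0' : Q' 0 = 0)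
    (k : ℕ) : ∀ q < p, (lieDeriv F)^[k] Q q = (lieDeriv F')^[k] Q' q := by
  induction k with
  | zero => exact hQ
  | succ k ih =>
    intro q hq
    rw [Function.iterate_succ_apply', Function.iterate_succ_apply']
    exact lieDeriv_congr hF ih hF0 hF0' (iterate_lieDeriv_eq_zero hF0 hQ0 k 0 (Nat.zero_le _))
      (iterate_lieDeriv_eq_zero hF0' hQ0' k 0 (Nat.zero_le _)) hq.le

lemma lieDeriv_eq_zero_of_lt {F Q : Family} {A B p : ℕ} (hF : ∀ a, A < a → F a = 0)
    (hQ : ∀ b, B < b → Q b = 0) (hp : A + B < p) : lieDeriv F Q p = 0 := by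
  refine Finset.sum_eq_zero ?_
  rintro ⟨a, b⟩ hab
  replace hab : a + b = p := Finset.HasAntidiagonal.mem_antidiagonal.1 hab
  by_cases ha : A < a
  · rw [hF a ha, bracketAt_zero_left]
  · rw [hQ b (by omega), bracketAt_zero_right]

/-- Half of the coefficients of `P₄` as its definition displays them; they are not invariant under
conjugation. -/
def quarticHalf (j : Fin 4 → Mode) : ℂ :=
  if (j 0).1 = 1 ∧ (j 1).1 = 1 ∧ (j 2).1 = -1 ∧ (j 3).1 = -1 ∧
    (j 0).2 + (j 1).2 = (j 2).2 + (j 3).2 ∧ (j 0).2 ≠ (j 2).2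
  then 1 / (4 * (((j 0).2 : ℂ) - ((j 2).2 : ℂ)) ^ 2) else 0

/-- Coefficients of `P₄`, made invariant under conjugation by averaging. -/
def quarticCoef (j : Fin 4 → Mode) : ℂ := quarticHalf j + quarticHalf (conjTuple j)

/-- The formal sum whose only component is `P₄`. -/
def quartic : Family
  | 1 => quarticCoef
  | _ => 0

lemma conj_quarticHalf (j : Fin 4 → Mode) : conj (quarticHalf j) = quarticHalf j := by
  unfold quarticHalf
  split_ifs <;> simp [map_ofNat]

lemma norm_quarticHalf_le (j : Fin 4 → Mode) : ‖quarticHalf j‖ ≤ 1 / 4 := by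
  unfold quarticHalf
  split_ifs with h
  · have hgap : (1 : ℝ) ≤ ‖((j 0).2 : ℂ) - ((j 2).2 : ℂ)‖ := by
      rw [← Int.cast_sub, Complex.norm_intCast]
      exact_mod_cast Int.one_le_abs (sub_ne_zero.2 h.2.2.2.2.2)
    rw [norm_div, norm_mul, norm_pow, norm_one, Complex.norm_ofNat]
    exact one_div_le_one_div_of_le (by norm_num) (by nlinarith)
  · simp

lemma norm_quarticCoef_le (j : Fin 4 → Mode) : ‖quarticCoef j‖ ≤ 1 / 2 := by
  refine (norm_add_le _ _).trans ?_
  linarith [norm_quarticHalf_le j, norm_quarticHalf_le (conjTuple j)]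

lemma momentumSupported_quarticHalf : MomentumSupported quarticHalf := by
  intro j hj
  obtain ⟨h0, h1, h2, h3, hsum, -⟩ := (ite_ne_right_iff.1 hj).1
  simp only [charge, momentum, Fin.sum_univ_four, h0, h1, h2, h3, Units.val_neg, Units.val_one]
  constructor
  · norm_num
  · linarith

lemma admissible_quarticCoef : Admissible quarticCoef where
  supported j hj := by
    by_cases h : quarticHalf j = 0
    · have hconj := momentumSupported_quarticHalf (conjTuple j) fun h' =>
        hj (by rw [quarticCoef, h, h', add_zero])
      rwa [charge_conjTuple, momentum_conjTuple, neg_eq_zero, neg_eq_zero] at hconj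
    · exact momentumSupported_quarticHalf j h
  real j := by
    rw [quarticCoef, quarticCoef, map_add, conj_quarticHalf, conj_quarticHalf,
      conjTuple_conjTuple, add_comm]

lemma admissible_quartic : quartic.Admissible
  | 0 => Admissible.zero
  | 1 => admissible_quarticCoef
  | _ + 2 => Admissible.zero

lemma quartic_of_ne {p : ℕ} (h : p ≠ 1) : quartic p = 0 := by
  match p with
  | 0 => rfl
  | 1 => exact absurd rfl h
  | _ + 2 => rfl

section Homological

variable {k : ℕ}

/-- The derivative of `L₂` along the Hamiltonian field of the polynomial with coefficients `c`. -/
def derivL2 (c : (Fin k → Mode) → ℂ) : (Fin k → Mode) → ℂ :=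
  fun j => -Complex.I * divisor j * c j

/-- The solution `c` of the homological equation `derivL2 c = resonantPart s - s` that vanishes on
resonant tuples. -/
def homologicalSol (s : (Fin k → Mode) → ℂ) : (Fin k → Mode) → ℂ :=
  fun j => if divisor j = 0 then 0 else s j / (Complex.I * divisor j)

/-- The part of a coefficient family supported on resonant tuples. -/
def resonantPart (s : (Fin k → Mode) → ℂ) : (Fin k → Mode) → ℂ :=
  fun j => if divisor j = 0 then s j else 0

lemma derivL2_homologicalSol_apply (s : (Fin k → Mode) → ℂ) (j : Fin k → Mode) :
    derivL2 (homologicalSol s) j = if divisor j = 0 then 0 else -s j := by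
  unfold derivL2 homologicalSol
  split_ifs with h
  · rw [mul_zero]
  · have hne : (divisor j : ℂ) ≠ 0 := by exact_mod_cast h
    field_simp

lemma add_derivL2_homologicalSol (s : (Fin k → Mode) → ℂ) :
    s + derivL2 (homologicalSol s) = resonantPart s := by
  funext j
  rw [Pi.add_apply, derivL2_homologicalSol_apply, resonantPart]
  split_ifs
  · rw [add_zero]
  · rw [add_neg_cancel]

lemma norm_homologicalSol_le (s : (Fin k → Mode) → ℂ) (j : Fin k → Mode) :
    ‖homologicalSol s j‖ ≤ ‖s j‖ := by
  unfold homologicalSol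
  split_ifs with h
  · simp
  · rw [norm_div, norm_mul, Complex.norm_I, one_mul, Complex.norm_intCast]
    refine div_le_self (norm_nonneg _) ?_
    exact_mod_cast Int.one_le_abs h

lemma norm_derivL2_homologicalSol_le (s : (Fin k → Mode) → ℂ) (j : Fin k → Mode) :
    ‖derivL2 (homologicalSol s) j‖ ≤ ‖s j‖ := by
  rw [derivL2_homologicalSol_apply]
  split_ifs <;> simp

lemma norm_resonantPart_le (s : (Fin k → Mode) → ℂ) (j : Fin k → Mode) :
    ‖resonantPart s j‖ ≤ ‖s j‖ := by
  unfold resonantPart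
  split_ifs <;> simp

lemma Admissible.derivL2 {c : (Fin k → Mode) → ℂ} (hc : Admissible c) :
    Admissible (derivL2 c) where
  supported j hj := hc.supported j fun h => hj (by rw [_root_.derivL2, h, mul_zero])
  real j := by
    simp only [_root_.derivL2, divisor_conjTuple, map_mul, map_neg, Complex.conj_I, hc.real j]
    simp

lemma Admissible.homologicalSol {s : (Fin k → Mode) → ℂ} (hs : Admissible s) :
    Admissible (homologicalSol s) where
  supported j hj := hs.supported j fun h => hj (norm_le_zero_iff.1
    ((norm_homologicalSol_le s j).trans_eq (by rw [h, norm_zero])))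
  real j := by
    simp only [_root_.homologicalSol, divisor_conjTuple, neg_eq_zero]
    split_ifs
    · exact map_zero _
    · rw [map_div₀, map_mul, Complex.conj_I, hs.real j]
      simp

end Homological

/-- The components of `d(L₂ + P₄)(X_F)`. -/
def firstDeriv (F : Family) : Family := fun p => derivL2 (F p) + lieDeriv F quartic p

/-- The components of the Hamiltonian transported by the time-one flow of `X_F`, without `L₂`. By
`iterate_lieDeriv_eq_zero` the terms `k > p` of the Lie series do not reach degree `2 p + 2`. -/
def transformed (F : Family) : Family := fun p =>
  quartic p + ∑ k ∈ Finset.range (p + 1),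
    ((k + 1).factorial : ℝ)⁻¹ • (lieDeriv F)^[k] (firstDeriv F) p

/-- The part of the transformed Hamiltonian that does not see the component `F p`. -/
def obstruction (F : Family) : Family := fun p =>
  quartic p + lieDeriv F quartic p
    + ∑ k ∈ Finset.range p, ((k + 2).factorial : ℝ)⁻¹ • (lieDeriv F)^[k + 1] (firstDeriv F) p

lemma transformed_eq (F : Family) (p : ℕ) :
    transformed F p = obstruction F p + derivL2 (F p) := by
  simp only [transformed, obstruction, Finset.sum_range_succ' _ p, firstDeriv, zero_add,
    Function.iterate_zero, id_eq, Nat.factorial_one, Nat.cast_one, inv_one, one_smul, add_assoc,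
    one_add_one_eq_two]
  abel

lemma quartic_zero : quartic 0 = 0 := rfl

lemma lieDeriv_zero {F Q : Family} (hF0 : F 0 = 0) : lieDeriv F Q 0 = 0 := by
  simp [lieDeriv, hF0, bracketAt_zero_left]

lemma firstDeriv_zero {F : Family} (hF0 : F 0 = 0) : firstDeriv F 0 = 0 := by
  rw [firstDeriv, lieDeriv_zero hF0, hF0]
  funext j
  simp [derivL2]

lemma obstruction_congr {F F' : Family} {p : ℕ} (hF : ∀ q < p, F q = F' q) (hF0 : F 0 = 0)
    (hF0' : F' 0 = 0) : obstruction F p = obstruction F' p := by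
  have hquartic : ∀ q ≤ p, lieDeriv F quartic q = lieDeriv F' quartic q := fun q hq =>
    lieDeriv_congr hF (fun _ _ => rfl) hF0 hF0' quartic_zero quartic_zero hq
  have hfirst : ∀ q < p, firstDeriv F q = firstDeriv F' q := fun q hq => by
    simp only [firstDeriv, hF q hq, hquartic q hq.le]
  simp only [obstruction, hquartic p le_rfl]
  congr 1
  refine Finset.sum_congr rfl fun k _ => ?_
  have hiter := iterate_lieDeriv_congr hF hfirst hF0 hF0' (firstDeriv_zero hF0)
    (firstDeriv_zero hF0') k
  rw [Function.iterate_succ_apply', Function.iterate_succ_apply',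
    lieDeriv_congr hF hiter hF0 hF0'
      (iterate_lieDeriv_eq_zero hF0 (firstDeriv_zero hF0) k 0 (Nat.zero_le _))
      (iterate_lieDeriv_eq_zero hF0' (firstDeriv_zero hF0') k 0 (Nat.zero_le _)) le_rfl]

/-- The component of degree `2 p + 2` of the generator of the normal form transformation: it solves
the homological equation for the obstruction created by the components of lower degree. -/
def generator (p : ℕ) : Coef p :=
  if p = 0 then 0 else
    homologicalSol (obstruction (fun q => if _ : q < p then generator q else 0) p)
termination_by p

/-- The generator truncated at order `n`. -/
def truncGen (n : ℕ) : Family := fun p => if p ≤ n then generator p else 0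

lemma generator_zero : generator 0 = 0 := by rw [generator]; simp

lemma truncGen_zero (n : ℕ) : truncGen n 0 = 0 := by simp [truncGen, generator_zero]

lemma truncGen_eq_homologicalSol {n p : ℕ} (hp : p ≤ n) :
    truncGen n p = homologicalSol (obstruction (truncGen n) p) := by
  rcases Nat.eq_zero_or_pos p with rfl | h0
  · rw [truncGen_zero]
    funext j
    simp [obstruction, lieDeriv_zero (truncGen_zero n), quartic_zero, homologicalSol]
  · rw [truncGen, if_pos hp, generator, if_neg h0.ne']
    congr 1
    refine obstruction_congr (fun q hq => ?_) (by simp [h0, generator_zero]) (truncGen_zero n)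
    rw [dif_pos hq, truncGen, if_pos (by omega)]

lemma truncGen_eq_zero {n p : ℕ} (hp : n < p) : truncGen n p = 0 := by
  rw [truncGen, if_neg (by omega)]

lemma Family.Admissible.obstruction {F : Family} (hF : F.Admissible) :
    (obstruction F).Admissible := fun p => by
  have hlie := hF.lieDeriv admissible_quartic
  have hfirst : (firstDeriv F).Admissible := fun p => (hF p).derivL2.add (hlie p)
  exact ((admissible_quartic p).add (hlie p)).add
    (Admissible.sum fun k _ => (hF.iterate_lieDeriv hfirst (k + 1) p).smul _)

lemma admissible_generator (p : ℕ) : Admissible (generator p) := by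
  induction p using Nat.strong_induction_on with
  | _ p ih =>
    rw [generator]
    split_ifs with h
    · exact Admissible.zero
    · refine (Family.Admissible.obstruction (fun q => ?_) p).homologicalSol
      split_ifs with hq
      · exact ih q hq
      · exact Admissible.zero

lemma admissible_truncGen (n : ℕ) : (truncGen n).Admissible := fun p => by
  unfold truncGen
  split_ifs
  · exact admissible_generator p
  · exact Admissible.zero

lemma transformed_truncGen {n p : ℕ} (hp : p ≤ n) :
    transformed (truncGen n) p = resonantPart (obstruction (truncGen n) p) := by
  rw [transformed_eq, truncGen_eq_homologicalSol hp, ← add_derivL2_homologicalSol]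

lemma Family.Admissible.transformed {F : Family} (hF : F.Admissible) :
    (transformed F).Admissible := fun p => by
  rw [transformed_eq]
  exact (hF.obstruction p).add (hF p).derivL2

/-! ### Majorant estimates -/

section Majorant

variable {k : ℕ}

/-- The supremum norm of a coefficient family. -/
def supCoef (c : (Fin k → Mode) → ℂ) : ℝ≥0∞ := ⨆ j, ‖c j‖ₑ

lemma enorm_le_supCoef (c : (Fin k → Mode) → ℂ) (j : Fin k → Mode) : ‖c j‖ₑ ≤ supCoef c :=
  le_iSup (fun j => ‖c j‖ₑ) j

lemma supCoef_zero : supCoef (0 : (Fin k → Mode) → ℂ) = 0 := by simp [supCoef]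

lemma supCoef_add_le (c d : (Fin k → Mode) → ℂ) : supCoef (c + d) ≤ supCoef c + supCoef d :=
  iSup_le fun j => (enorm_add_le _ _).trans
    (add_le_add (enorm_le_supCoef c j) (enorm_le_supCoef d j))

lemma supCoef_sum_le {ι : Type*} (s : Finset ι) (f : ι → (Fin k → Mode) → ℂ) :
    supCoef (∑ i ∈ s, f i) ≤ ∑ i ∈ s, supCoef (f i) :=
  Finset.le_sum_of_subadditive supCoef supCoef_zero.le supCoef_add_le s f

lemma supCoef_mono {c d : (Fin k → Mode) → ℂ} (h : ∀ j, ‖c j‖ ≤ ‖d j‖) : supCoef c ≤ supCoef d :=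
  iSup_le fun j => (enorm_le_iff_norm_le.2 (h j)).trans (enorm_le_supCoef d j)

lemma supCoef_smul_le (s : ℝ) (c : (Fin k → Mode) → ℂ) : supCoef (s • c) ≤ ‖s‖ₑ * supCoef c :=
  iSup_le fun j => by
    rw [Pi.smul_apply, enorm_smul]
    exact mul_le_mul_right (enorm_le_supCoef c j) _

lemma enorm_partialCoef_le (c : (Fin (k + 1) → Mode) → ℂ) (i : Mode) (j : Fin k → Mode) :
    ‖partialCoef c i j‖ₑ ≤ (k + 1) * supCoef c := by
  refine (enorm_sum_le _ _).trans ((Finset.sum_le_sum fun α _ => enorm_le_supCoef c _).trans ?_)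
  simp

lemma supCoef_bracketAt_le {a b : ℕ} (p : ℕ) (χ : Coef a) (Q : Coef b) :
    supCoef (bracketAt p χ Q) ≤ 8 * (a + 1) * (b + 1) * (supCoef χ * supCoef Q) := by
  unfold bracketAt
  split_ifs with h
  · refine iSup_le fun j => ?_
    have hterm : ∀ i i', ‖partialCoef χ i (headTuple h j) * partialCoef Q i' (tailTuple h j)‖ₑ
        ≤ 4 * (a + 1) * (b + 1) * (supCoef χ * supCoef Q) := fun i i' => by
      rw [enorm_mul]
      refine (mul_le_mul' (enorm_partialCoef_le χ _ _) (enorm_partialCoef_le Q _ _)).trans_eq ?_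
      push_cast
      ring
    have hI : ‖Complex.I‖ₑ = 1 := by rw [enorm_eq_nnnorm, Complex.nnnorm_I, ENNReal.coe_one]
    rw [bracket, enorm_mul, hI, one_mul]
    refine enorm_sub_le.trans ((add_le_add (hterm _ _) (hterm _ _)).trans_eq ?_)
    ring
  · rw [supCoef_zero]
    exact zero_le

/-- The truncated weighted norm `∑_{p ≤ N} ‖Q_p‖ x^p`. -/
def wnorm (N : ℕ) (x : ℝ≥0∞) (Q : Family) : ℝ≥0∞ :=
  ∑ p ∈ Finset.range (N + 1), supCoef (Q p) * x ^ p

lemma wnorm_mono_left {M N : ℕ} (h : M ≤ N) (x : ℝ≥0∞) (Q : Family) :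
    wnorm M x Q ≤ wnorm N x Q :=
  Finset.sum_le_sum_of_subset (Finset.range_mono (by omega))

lemma supCoef_le_wnorm {N p : ℕ} (h : p ≤ N) (x : ℝ≥0∞) (Q : Family) :
    supCoef (Q p) * x ^ p ≤ wnorm N x Q :=
  Finset.single_le_sum (f := fun p => supCoef (Q p) * x ^ p) (fun _ _ => zero_le)
    (Finset.mem_range.2 (by omega))

lemma wnorm_add_le (N : ℕ) (x : ℝ≥0∞) (Q R : Family) :
    wnorm N x (Q + R) ≤ wnorm N x Q + wnorm N x R := by
  unfold wnorm
  rw [← Finset.sum_add_distrib]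
  refine Finset.sum_le_sum fun p _ => ?_
  rw [← add_mul]
  exact mul_le_mul_left (supCoef_add_le _ _) _

lemma sum_antidiagonal_le (N : ℕ) (f g : ℕ → ℝ≥0∞) :
    ∑ p ∈ Finset.range (N + 1), ∑ x ∈ Finset.HasAntidiagonal.antidiagonal p, f x.1 * g x.2
      ≤ (∑ a ∈ Finset.range (N + 1), f a) * ∑ b ∈ Finset.range (N + 1), g b := by
  rw [← Finset.sum_biUnion, Finset.sum_mul_sum, ← Finset.sum_product']
  · refine Finset.sum_le_sum_of_subset fun x hx => ?_
    simp only [Finset.mem_biUnion, Finset.mem_range, Finset.HasAntidiagonal.mem_antidiagonal] at hx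
    obtain ⟨p, hp, hx⟩ := hx
    simp only [Finset.mem_product, Finset.mem_range]
    omega
  · intro p _ q _ hpq
    rw [Function.onFun, Finset.disjoint_left]
    intro x hx hx'
    rw [Finset.HasAntidiagonal.mem_antidiagonal] at hx hx'
    exact hpq (hx.symm.trans hx')

lemma wnorm_lieDeriv_le {N r : ℕ} {F : Family} (hF : ∀ a ≤ N, r < a + 1 → F a = 0) (x : ℝ≥0∞)
    (Q : Family) : wnorm N x (lieDeriv F Q) ≤ 8 * r * (N + 1) * wnorm N x F * wnorm N x Q := by
  have hterm : ∀ p ≤ N, ∀ y ∈ Finset.HasAntidiagonal.antidiagonal p,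
      supCoef (bracketAt p (F y.1) (Q y.2)) * x ^ p
        ≤ 8 * r * (N + 1) * ((supCoef (F y.1) * x ^ y.1) * (supCoef (Q y.2) * x ^ y.2)) := by
    intro p hp y hy
    rw [Finset.HasAntidiagonal.mem_antidiagonal] at hy
    by_cases hr : r < y.1 + 1
    · rw [hF y.1 (by omega) hr, bracketAt_zero_left, supCoef_zero, zero_mul]
      exact zero_le
    have hy₁ : (y.1 : ℝ≥0∞) + 1 ≤ r := by exact_mod_cast (by omega : y.1 + 1 ≤ r)
    have hy₂ : (y.2 : ℝ≥0∞) + 1 ≤ N + 1 := by exact_mod_cast (by omega : y.2 + 1 ≤ N + 1)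
    calc supCoef (bracketAt p (F y.1) (Q y.2)) * x ^ p
        ≤ (8 * (y.1 + 1) * (y.2 + 1) * (supCoef (F y.1) * supCoef (Q y.2))) * x ^ p :=
          mul_le_mul_left (supCoef_bracketAt_le _ _ _) _
      _ ≤ (8 * r * (N + 1) * (supCoef (F y.1) * supCoef (Q y.2))) * x ^ p := by gcongr
      _ = _ := by rw [← hy, pow_add]; ring
  calc wnorm N x (lieDeriv F Q)
      ≤ ∑ p ∈ Finset.range (N + 1), 8 * r * (N + 1) * ∑ y ∈ Finset.HasAntidiagonal.antidiagonal p,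
          (supCoef (F y.1) * x ^ y.1) * (supCoef (Q y.2) * x ^ y.2) := by
        refine Finset.sum_le_sum fun p hp => ?_
        rw [Finset.mul_sum]
        refine (mul_le_mul_left (supCoef_sum_le _ _) _).trans ?_
        rw [Finset.sum_mul]
        exact Finset.sum_le_sum (hterm p (Nat.lt_succ_iff.1 (Finset.mem_range.1 hp)))
    _ ≤ 8 * r * (N + 1) * wnorm N x F * wnorm N x Q := by
        rw [← Finset.mul_sum, mul_assoc _ (wnorm N x F)]
        exact mul_le_mul_right (sum_antidiagonal_le N (fun a => supCoef (F a) * x ^ a)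
          (fun b => supCoef (Q b) * x ^ b)) _

lemma wnorm_iterate_lieDeriv_le {N r : ℕ} {F : Family} (hF : ∀ a ≤ N, r < a + 1 → F a = 0)
    (x : ℝ≥0∞) (Q : Family) (k : ℕ) :
    wnorm N x ((lieDeriv F)^[k] Q) ≤ (8 * r * (N + 1) * wnorm N x F) ^ k * wnorm N x Q := by
  induction k with
  | zero => rw [Function.iterate_zero, id, pow_zero, one_mul]
  | succ k ih =>
    rw [Function.iterate_succ_apply']
    refine (wnorm_lieDeriv_le hF x _).trans ?_
    rw [pow_succ', mul_assoc _ _ (wnorm N x Q)]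
    exact mul_le_mul_right ih _

lemma supCoef_quartic_le : supCoef (quartic 1) ≤ ((1 / 2 : ℝ≥0) : ℝ≥0∞) := by
  refine iSup_le fun j => ?_
  rw [enorm_eq_nnnorm, ENNReal.coe_le_coe, ← NNReal.coe_le_coe]
  simpa using! norm_quarticCoef_le j

lemma wnorm_quartic_le (N : ℕ) (x : ℝ≥0∞) : wnorm N x quartic ≤ ((1 / 2 : ℝ≥0) : ℝ≥0∞) * x := by
  calc wnorm N x quartic
      ≤ ∑ p ∈ Finset.range (N + 1), if p = 1 then ((1 / 2 : ℝ≥0) : ℝ≥0∞) * x else 0 := by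
        refine Finset.sum_le_sum fun p _ => ?_
        split_ifs with h
        · rw [h, pow_one]
          exact mul_le_mul_left supCoef_quartic_le _
        · rw [quartic_of_ne h, supCoef_zero, zero_mul]
    _ ≤ _ := by
        rw [Finset.sum_ite_eq']
        split_ifs
        · exact le_rfl
        · exact zero_le

lemma sum_eighth_pow_le (n : ℕ) :
    ∑ k ∈ Finset.range n, (((1 / 8 : ℝ≥0) : ℝ≥0∞)) ^ (k + 1) ≤ ((1 / 4 : ℝ≥0) : ℝ≥0∞) := by
  have hreal : ∑ k ∈ Finset.range n, (1 / 8 : ℝ) ^ (k + 1) ≤ 1 / 4 := by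
    simp only [pow_succ']
    refine (sum_le_hasSum _ (fun _ _ => by positivity)
      ((hasSum_geometric_of_lt_one (r := (1 / 8 : ℝ)) (by norm_num) (by norm_num)).mul_left
        (1 / 8))).trans ?_
    norm_num
  have hnn : ∑ k ∈ Finset.range n, (1 / 8 : ℝ≥0) ^ (k + 1) ≤ 1 / 4 := by
    rw [← NNReal.coe_le_coe]
    push_cast
    exact hreal
  exact_mod_cast hnn

lemma enorm_inv_factorial_le (k : ℕ) : ‖((k.factorial : ℝ))⁻¹‖ₑ ≤ 1 := by
  rw [enorm_eq_nnnorm, ← ENNReal.coe_one, ENNReal.coe_le_coe, ← NNReal.coe_le_coe, coe_nnnorm,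
    norm_inv, Real.norm_natCast, NNReal.coe_one]
  exact inv_le_one_of_one_le₀ (by exact_mod_cast Nat.factorial_pos k)

lemma wnorm_firstDeriv_le {N r : ℕ} {F : Family} (hF : ∀ a ≤ N, r < a + 1 → F a = 0)
    (x : ℝ≥0∞) :
    wnorm N x (firstDeriv F) ≤ wnorm N x (fun p => derivL2 (F p))
      + 8 * r * (N + 1) * wnorm N x F * (((1 / 2 : ℝ≥0) : ℝ≥0∞) * x) :=
  (wnorm_add_le N x (fun p => derivL2 (F p)) (lieDeriv F quartic)).trans (add_le_add le_rfl
    ((wnorm_lieDeriv_le hF x _).trans (mul_le_mul_right (wnorm_quartic_le N x) _)))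

lemma wnorm_obstruction_le_sum (N : ℕ) (x : ℝ≥0∞) (F : Family) :
    wnorm N x (obstruction F) ≤ wnorm N x quartic + wnorm N x (lieDeriv F quartic)
      + ∑ k ∈ Finset.range N, wnorm N x ((lieDeriv F)^[k + 1] (firstDeriv F)) := by
  unfold wnorm
  rw [Finset.sum_comm, ← Finset.sum_add_distrib, ← Finset.sum_add_distrib]
  refine Finset.sum_le_sum fun p hp => ?_
  rw [← Finset.sum_mul, ← add_mul, ← add_mul]
  refine mul_le_mul_left ((supCoef_add_le _ _).trans (add_le_add (supCoef_add_le _ _) ?_)) _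
  have hpN : p ≤ N := Nat.lt_succ_iff.1 (Finset.mem_range.1 hp)
  refine (supCoef_sum_le _ _).trans ((Finset.sum_le_sum fun k _ => ?_).trans
    (Finset.sum_le_sum_of_subset (Finset.range_mono hpN)))
  refine (supCoef_smul_le _ _).trans ?_
  exact (mul_le_mul_left (enorm_inv_factorial_le _) _).trans_eq (one_mul _)

lemma wnorm_obstruction_le {N : ℕ} {F : Family} {x : ℝ≥0}
    (hx : 8 * (N + 1) * (N + 1) * x ≤ 1 / 8) (hFx : wnorm N x F ≤ x)
    (hDx : wnorm N x (fun p => derivL2 (F p)) ≤ x) : wnorm N x (obstruction F) ≤ x := by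
  have hF : ∀ a ≤ N, N + 1 < a + 1 → F a = 0 := fun a ha h => by omega
  have hfactor : 8 * ((N + 1 : ℕ) : ℝ≥0∞) * (N + 1) * wnorm N x F ≤ ((1 / 8 : ℝ≥0) : ℝ≥0∞) :=
    (mul_le_mul_right hFx _).trans (by exact_mod_cast hx)
  have hfirst : wnorm N x (firstDeriv F)
      ≤ x + ((1 / 8 : ℝ≥0) : ℝ≥0∞) * (((1 / 2 : ℝ≥0) : ℝ≥0∞) * x) :=
    (wnorm_firstDeriv_le hF x).trans (add_le_add hDx (mul_le_mul_left hfactor _))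
  have hlie : wnorm N x (lieDeriv F quartic)
      ≤ ((1 / 8 : ℝ≥0) : ℝ≥0∞) * (((1 / 2 : ℝ≥0) : ℝ≥0∞) * x) :=
    (wnorm_lieDeriv_le hF x _).trans (mul_le_mul' hfactor (wnorm_quartic_le N x))
  have hiter : ∀ k, wnorm N x ((lieDeriv F)^[k + 1] (firstDeriv F))
      ≤ ((1 / 8 : ℝ≥0) : ℝ≥0∞) ^ (k + 1)
        * (x + ((1 / 8 : ℝ≥0) : ℝ≥0∞) * (((1 / 2 : ℝ≥0) : ℝ≥0∞) * x)) := fun k =>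
    (wnorm_iterate_lieDeriv_le hF x _ _).trans (mul_le_mul' (pow_le_pow_left' hfactor _) hfirst)
  have hnum : (1 / 2 : ℝ≥0) * x + (1 / 8) * ((1 / 2) * x)
      + (1 / 4) * (x + (1 / 8) * ((1 / 2) * x)) ≤ x := by
    rw [← NNReal.coe_le_coe]
    push_cast
    linarith [x.coe_nonneg]
  have hsum : ∑ k ∈ Finset.range N, wnorm N x ((lieDeriv F)^[k + 1] (firstDeriv F))
      ≤ ((1 / 4 : ℝ≥0) : ℝ≥0∞)
        * (x + ((1 / 8 : ℝ≥0) : ℝ≥0∞) * (((1 / 2 : ℝ≥0) : ℝ≥0∞) * x)) := by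
    refine (Finset.sum_le_sum fun k _ => hiter k).trans ?_
    rw [← Finset.sum_mul]
    exact mul_le_mul_left (sum_eighth_pow_le N) _
  exact (wnorm_obstruction_le_sum N x F).trans
    ((add_le_add (add_le_add (wnorm_quartic_le N x) hlie) hsum).trans (by exact_mod_cast hnum))

lemma wnorm_map_truncGen_le (f : (p : ℕ) → Coef p → Coef p) (hf0 : ∀ p, f p 0 = 0)
    (hf : ∀ p s j, ‖f p (homologicalSol s) j‖ ≤ ‖s j‖) (N n : ℕ) (x : ℝ≥0∞) :
    wnorm N x (fun p => f p (truncGen n p)) ≤ wnorm n x (obstruction (truncGen n)) := by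
  refine (wnorm_mono_left (le_max_left N n) _ _).trans ?_
  unfold wnorm
  rw [← Finset.sum_subset (Finset.range_mono (by omega : n + 1 ≤ max N n + 1))]
  · refine Finset.sum_le_sum fun p hp => mul_le_mul_left ?_ _
    beta_reduce
    rw [truncGen_eq_homologicalSol (Nat.lt_succ_iff.1 (Finset.mem_range.1 hp))]
    exact supCoef_mono (hf p _)
  · intro p _ hp
    have hvanish : truncGen n p = 0 := truncGen_eq_zero (by simpa using hp)
    beta_reduce
    rw [hvanish, hf0, supCoef_zero, zero_mul]

lemma wnorm_truncGen_le_obstruction (N n : ℕ) (x : ℝ≥0∞) :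
    wnorm N x (truncGen n) ≤ wnorm n x (obstruction (truncGen n)) :=
  wnorm_map_truncGen_le (fun _ c => c) (fun _ => rfl) (fun _ s j => norm_homologicalSol_le s j)
    N n x

lemma wnorm_derivL2_truncGen_le_obstruction (N n : ℕ) (x : ℝ≥0∞) :
    wnorm N x (fun p => derivL2 (truncGen n p)) ≤ wnorm n x (obstruction (truncGen n)) :=
  wnorm_map_truncGen_le (fun _ c => derivL2 c) (fun _ => funext fun _ => mul_zero _)
    (fun _ s j => norm_derivL2_homologicalSol_le s j) N n x

lemma obstruction_truncGen_eq {p m n : ℕ} (hm : p ≤ m + 1) (hn : p ≤ n + 1) :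
    obstruction (truncGen m) p = obstruction (truncGen n) p :=
  obstruction_congr (fun q hq => by
    rw [truncGen, truncGen, if_pos (by omega), if_pos (by omega)])
    (truncGen_zero _) (truncGen_zero _)

-- The obstruction of index `n + 1` only sees the generator up to index `n`, and the homological
-- equation does not increase norms, so the bound by `x` reproduces itself.
lemma wnorm_obstruction_truncGen_le {x : ℝ≥0} (n : ℕ)
    (hx : 8 * (n + 1) * (n + 1) * x ≤ 1 / 8) : wnorm n x (obstruction (truncGen n)) ≤ x := by
  induction n with
  | zero =>
    have hzero : obstruction (truncGen 0) 0 = 0 := by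
      simp [obstruction, lieDeriv_zero (truncGen_zero 0), quartic_zero]
    simp [wnorm, hzero, supCoef_zero]
  | succ n ih =>
    have ih' := ih (le_trans (by push_cast; gcongr <;> simp) hx)
    have hcongr : wnorm (n + 1) x (obstruction (truncGen (n + 1)))
        = wnorm (n + 1) x (obstruction (truncGen n)) := Finset.sum_congr rfl fun p hp => by
      have hp' := Finset.mem_range.1 hp
      rw [obstruction_truncGen_eq (by omega : p ≤ n + 1 + 1) (by omega : p ≤ n + 1)]
    rw [hcongr]
    exact wnorm_obstruction_le hx ((wnorm_truncGen_le_obstruction _ n x).trans ih')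
      ((wnorm_derivL2_truncGen_le_obstruction _ n x).trans ih')

lemma norm_mul_pow_le {Q : Family} {p N : ℕ} {x B : ℝ≥0} (h : wnorm N x Q ≤ B) (hp : p ≤ N)
    (j : Fin (2 * p + 1 + 1) → Mode) : ‖Q p j‖ * (x : ℝ) ^ p ≤ B := by
  have hpj : ‖Q p j‖ₑ * (x : ℝ≥0∞) ^ p ≤ B :=
    (mul_le_mul_left (enorm_le_supCoef (Q p) j) _).trans ((supCoef_le_wnorm hp x Q).trans h)
  rw [enorm_eq_nnnorm] at hpj
  have hnn : ‖Q p j‖₊ * x ^ p ≤ B := by exact_mod_cast hpj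
  exact_mod_cast hnn

lemma norm_le_pow_of_wnorm_le {Q : Family} {p N : ℕ} {y : ℝ≥0} (hy : 0 < y)
    (h : wnorm N (y⁻¹ : ℝ≥0) Q ≤ (y⁻¹ : ℝ≥0)) (hp : 1 ≤ p) (hpN : p ≤ N)
    (j : Fin (2 * p + 1 + 1) → Mode) : ‖Q p j‖ ≤ (y : ℝ) ^ (p - 1) := by
  obtain ⟨q, rfl⟩ : ∃ q, p = q + 1 := ⟨p - 1, by omega⟩
  have hy' : (0 : ℝ) < y := hy
  have hmul := norm_mul_pow_le h hpN j
  rw [NNReal.coe_inv, pow_succ, ← mul_assoc] at hmul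
  have hq := le_of_mul_le_mul_right (hmul.trans_eq (one_mul _).symm) (inv_pos.2 hy')
  rwa [inv_pow, mul_inv_le_iff₀ (by positivity), one_mul] at hq

/-- The geometric rate at which the coefficients of `truncGen n` grow with the degree. -/
def growthRate (n : ℕ) : ℝ≥0 := 64 * ((n : ℝ≥0) + 1) ^ 2

lemma coe_growthRate (n : ℕ) : (growthRate n : ℝ) = 64 * ((n : ℝ) + 1) ^ 2 := by
  rw [growthRate]
  push_cast
  rfl

lemma one_le_growthRate (n : ℕ) : (1 : ℝ) ≤ growthRate n := by
  rw [coe_growthRate]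
  nlinarith [(Nat.cast_nonneg n : (0 : ℝ) ≤ n)]

lemma growthRate_pos (n : ℕ) : 0 < growthRate n := zero_lt_one.trans_le (one_le_growthRate n)

lemma wnorm_obstruction_truncGen_le_inv_growthRate (n : ℕ) :
    wnorm n ((growthRate n)⁻¹ : ℝ≥0) (obstruction (truncGen n)) ≤ ((growthRate n)⁻¹ : ℝ≥0) :=
  wnorm_obstruction_truncGen_le n <| le_of_eq <| by
    rw [growthRate]
    field_simp
    norm_num

lemma norm_obstruction_le {n p : ℕ} (hp : 1 ≤ p) (hn : p ≤ n) (j : Fin (2 * p + 1 + 1) → Mode) :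
    ‖obstruction (truncGen n) p j‖ ≤ (growthRate p : ℝ) ^ (p - 1) := by
  rw [obstruction_truncGen_eq (by omega : p ≤ n + 1) (Nat.le_succ p)]
  exact norm_le_pow_of_wnorm_le (growthRate_pos p)
    (wnorm_obstruction_truncGen_le_inv_growthRate p) hp le_rfl j

lemma norm_truncGen_le (n p : ℕ) (j : Fin (2 * p + 1 + 1) → Mode) :
    ‖truncGen n p j‖ ≤ (growthRate n : ℝ) ^ (p - 1) := by
  rcases p.eq_zero_or_pos with rfl | hp
  · simp [truncGen_zero]
  · exact norm_le_pow_of_wnorm_le (growthRate_pos n) ((wnorm_truncGen_le_obstruction p n _).trans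
      (wnorm_obstruction_truncGen_le_inv_growthRate n)) hp le_rfl j

lemma norm_derivL2_truncGen_le (n p : ℕ) (j : Fin (2 * p + 1 + 1) → Mode) :
    ‖derivL2 (truncGen n p) j‖ ≤ (growthRate n : ℝ) ^ (p - 1) := by
  rcases p.eq_zero_or_pos with rfl | hp
  · simp [truncGen_zero, derivL2]
  · exact norm_le_pow_of_wnorm_le (Q := fun p => derivL2 (truncGen n p)) (growthRate_pos n)
      ((wnorm_derivL2_truncGen_le_obstruction p n _).trans
        (wnorm_obstruction_truncGen_le_inv_growthRate n)) hp le_rfl j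

lemma lie_factor_truncGen_le {n : ℕ} (hn : 1 ≤ n) (p : ℕ) :
    8 * ((n + 1 : ℕ) : ℝ≥0∞) * (p + 1) * wnorm p ((growthRate n)⁻¹ : ℝ≥0) (truncGen n)
      ≤ (((p + 1) / 16 : ℝ≥0) : ℝ≥0∞) := by
  have hnum : 8 * ((n + 1 : ℕ) : ℝ≥0) * (p + 1) * (growthRate n)⁻¹ ≤ (p + 1) / 16 := by
    have hn' : (1 : ℝ) ≤ n := by exact_mod_cast hn
    rw [← NNReal.coe_le_coe]
    push_cast
    rw [coe_growthRate, ← div_eq_mul_inv, div_le_div_iff₀ (by positivity) (by norm_num)]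
    nlinarith [mul_nonneg (mul_nonneg p.cast_nonneg n.cast_nonneg) (sub_nonneg.2 hn'),
      mul_nonneg (p.cast_nonneg : (0 : ℝ) ≤ p) (sub_nonneg.2 hn'),
      mul_nonneg (n.cast_nonneg : (0 : ℝ) ≤ n) (sub_nonneg.2 hn')]
  exact (mul_le_mul_right ((wnorm_truncGen_le_obstruction p n _).trans
    (wnorm_obstruction_truncGen_le_inv_growthRate n)) _).trans (by exact_mod_cast hnum)

lemma wnorm_firstDeriv_truncGen_le {n : ℕ} (hn : 1 ≤ n) (p : ℕ) :
    wnorm p ((growthRate n)⁻¹ : ℝ≥0) (firstDeriv (truncGen n))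
      ≤ ((2 ^ (p + 1) * (growthRate n)⁻¹ : ℝ≥0) : ℝ≥0∞) := by
  have hvanish : ∀ a ≤ p, n + 1 < a + 1 → truncGen n a = 0 := fun a _ h =>
    truncGen_eq_zero (by omega)
  have hderiv := (wnorm_derivL2_truncGen_le_obstruction p n _).trans
    (wnorm_obstruction_truncGen_le_inv_growthRate n)
  refine (wnorm_firstDeriv_le hvanish _).trans ((add_le_add hderiv
    (mul_le_mul_left (lie_factor_truncGen_le hn p) _)).trans ?_)
  generalize (growthRate n)⁻¹ = x
  have hnum : x + ((p : ℝ≥0) + 1) / 16 * (1 / 2 * x) ≤ 2 ^ (p + 1) * x := by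
    rw [← NNReal.coe_le_coe]
    push_cast
    have hp : (p : ℝ) + 1 ≤ 2 ^ p := by exact_mod_cast Nat.lt_two_pow_self (n := p)
    rw [pow_succ]
    nlinarith [x.coe_nonneg]
  exact_mod_cast hnum

lemma pow_div_factorial_le (p k : ℕ) : ((p : ℝ) + 1) ^ k / k.factorial ≤ 3 ^ (p + 1) := by
  refine (Real.pow_div_factorial_le_exp _ (by positivity) k).trans ?_
  rw [show (p : ℝ) + 1 = ((p + 1 : ℕ) : ℝ) * 1 by push_cast; ring, Real.exp_nat_mul]
  exact pow_le_pow_left₀ (Real.exp_pos _).le (Real.exp_one_lt_d9.le.trans (by norm_num)) _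

-- The factor `(p + 1) ^ k` accumulated by `k` brackets is absorbed by the `1 / k!` of Taylor's
-- formula.
lemma norm_iterate_lieDeriv_le {n : ℕ} (hn : 1 ≤ n) (k p : ℕ)
    (j : Fin (2 * p + 1 + 1) → Mode) :
    ‖(lieDeriv (truncGen n))^[k] (firstDeriv (truncGen n)) p j‖ ≤
      k.factorial * (1 / 16) ^ k * (6 * (growthRate n : ℝ)⁻¹ * (6 * growthRate n) ^ p) := by
  have hvanish : ∀ a ≤ p, n + 1 < a + 1 → truncGen n a = 0 := fun a _ h =>
    truncGen_eq_zero (by omega)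
  have hiter : wnorm p ((growthRate n)⁻¹ : ℝ≥0)
      ((lieDeriv (truncGen n))^[k] (firstDeriv (truncGen n)))
      ≤ ((((p + 1) / 16) ^ k * (2 ^ (p + 1) * (growthRate n)⁻¹) : ℝ≥0) : ℝ≥0∞) :=
    (wnorm_iterate_lieDeriv_le hvanish _ _ _).trans ((mul_le_mul'
      (pow_le_pow_left' (lie_factor_truncGen_le hn p) _)
      (wnorm_firstDeriv_truncGen_le hn p)).trans_eq (by push_cast; rfl))
  have hmul := norm_mul_pow_le hiter le_rfl j
  have hpow := pow_div_factorial_le p k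
  have hfac : (0 : ℝ) < k.factorial := by exact_mod_cast k.factorial_pos
  have hy : (0 : ℝ) < growthRate n := growthRate_pos n
  push_cast at hmul
  generalize (growthRate n : ℝ) = y at hmul hy ⊢
  rw [div_le_iff₀ hfac] at hpow
  rw [inv_pow, mul_inv_le_iff₀ (by positivity)] at hmul
  calc _ ≤ _ := hmul
    _ = ((p : ℝ) + 1) ^ k * ((1 / 16) ^ k * (2 * y⁻¹ * (2 * y) ^ p)) := by
        rw [div_pow, one_div, inv_pow, mul_pow]; ring
    _ ≤ 3 ^ (p + 1) * k.factorial * ((1 / 16) ^ k * (2 * y⁻¹ * (2 * y) ^ p)) := by gcongr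
    _ = _ := by rw [show 6 * y = 3 * (2 * y) by ring, mul_pow 3]; ring

end Majorant

lemma geom_sum_le_two {q : ℝ} (hq : 0 ≤ q) (hq2 : q ≤ 1 / 2) (n : ℕ) :
    ∑ i ∈ Finset.range n, q ^ i ≤ 2 :=
  (Finset.sum_le_sum fun i _ => pow_le_pow_left₀ hq hq2 i).trans (sum_geometric_two_le n)

lemma hamiltonian_fderiv_skew {E : Type*} [NormedAddCommGroup E] [NormedSpace ℝ E]
    {B : E →L[ℝ] E →L[ℝ] ℝ} (hB : ∀ u v, B u v = -B v u) {X : E → E} {f : E → ℝ}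
    (hX : Differentiable ℝ X) (hf : ContDiff ℝ 2 f) (hgrad : ∀ z v, B (X z) v = fderiv ℝ f z v)
    (y u w : E) : B (fderiv ℝ X y u) w + B u (fderiv ℝ X y w) = 0 := by
  have hf' : HasFDerivAt (fderiv ℝ f) (fderiv ℝ (fderiv ℝ f) y) y :=
    ((hf.fderiv_right (m := 1) le_rfl).differentiable one_ne_zero y).hasFDerivAt
  have hessian : ∀ u v, B (fderiv ℝ X y u) v = fderiv ℝ (fderiv ℝ f) y u v := by
    intro u v
    have hBX : HasFDerivAt (fun z => B (X z) v) ((B.flip v).comp (fderiv ℝ X y)) y :=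
      (B.flip v).hasFDerivAt.comp y (hX y).hasFDerivAt
    have hdf : HasFDerivAt (fun z => B (X z) v)
        ((ContinuousLinearMap.apply ℝ ℝ v).comp (fderiv ℝ (fderiv ℝ f) y)) y := by
      simp only [hgrad]
      exact (ContinuousLinearMap.apply ℝ ℝ v).hasFDerivAt.comp y hf'
    exact congrArg (fun T : E →L[ℝ] ℝ => T u) (hBX.unique hdf)
  have hsymm : fderiv ℝ (fderiv ℝ f) y u w = fderiv ℝ (fderiv ℝ f) y w u :=
    second_derivative_symmetric (fun z => (hf.differentiable two_ne_zero z).hasFDerivAt) hf' u w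
  rw [hB u, hessian, hessian, hsymm, add_neg_cancel]

lemma growthRate_mul_sq_le {n : ℕ} {S δ : ℝ} (h : growthRate n * S ^ 2 ≤ δ) : 64 * S ^ 2 ≤ δ :=
  (mul_le_mul_of_nonneg_right
    (by rw [coe_growthRate]; nlinarith [(Nat.cast_nonneg n : (0 : ℝ) ≤ n)]) (sq_nonneg S)).trans h

namespace Gevrey

variable {σ θ : ℝ}

/-- The Hamiltonian vector field of the truncated generator. -/
def genField (n : ℕ) (z : Gevrey σ θ) : Gevrey σ θ :=
  ∑ a ∈ Finset.range (n + 1), vf (truncGen n a) z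

lemma vf_zero {k : ℕ} (z : Gevrey σ θ) : vf (0 : (Fin (k + 1) → Mode) → ℂ) z = 0 := by
  have hterm : ∀ j : Fin k → Mode,
      (single (momentum j) (vfCoef 0 j * mono z j) : Gevrey σ θ) = 0 := fun j => by
    rw [← norm_eq_zero, norm_single]
    simp [vfCoef, partialCoef]
  simp only [vf, hterm, tsum_zero]

lemma genField_eq (n : ℕ) (z : Gevrey σ θ) :
    genField n z = ∑ q ∈ Finset.range n, vf (truncGen n (q + 1)) z := by
  rw [genField, Finset.sum_range_succ', truncGen_zero, vf_zero, add_zero]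

section GenField

variable (hσ : 0 ≤ σ) (hθ : 0 < θ) (hθ1 : θ ≤ 1) (n : ℕ)

include hσ hθ hθ1

lemma contDiff_genField : ContDiff ℝ ∞ (genField n : Gevrey σ θ → Gevrey σ θ) :=
  ContDiff.sum fun a _ => contDiff_vf hσ hθ hθ1 (norm_truncGen_le n a)

lemma norm_vf_truncGen_le (q : ℕ) (z : Gevrey σ θ) :
    ‖vf (truncGen n (q + 1)) z‖ ≤ 8 * ‖z‖ ^ 3 * (2 * (growthRate n * ‖z‖ ^ 2)) ^ q := by
  have hq : (q : ℝ) + 2 ≤ 2 * 2 ^ q := by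
    have hlt : (q : ℝ) + 1 ≤ 2 ^ q := by exact_mod_cast Nat.lt_two_pow_self (n := q)
    linarith [one_le_pow₀ (one_le_two : (1 : ℝ) ≤ 2) (n := q)]
  calc ‖vf (truncGen n (q + 1)) z‖
      ≤ 2 * (((2 * (q + 1) + 1 : ℕ) : ℝ) + 1) * (growthRate n : ℝ) ^ (q + 1 - 1)
          * ‖z‖ ^ (2 * (q + 1) + 1) := norm_vf_le hσ hθ hθ1 (norm_truncGen_le n (q + 1)) z
    _ = 4 * (q + 2) * (growthRate n ^ q * ‖z‖ ^ (2 * q) * ‖z‖ ^ 3) := by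
        rw [Nat.add_sub_cancel]
        push_cast
        ring
    _ ≤ 4 * (2 * 2 ^ q) * (growthRate n ^ q * ‖z‖ ^ (2 * q) * ‖z‖ ^ 3) := by gcongr
    _ = _ := by
        rw [mul_pow, mul_pow, pow_mul]
        ring

lemma norm_genField_le {z : Gevrey σ θ} (hz : growthRate n * ‖z‖ ^ 2 ≤ 1 / 8) :
    ‖genField n z‖ ≤ 16 * ‖z‖ ^ 3 := by
  rw [genField_eq]
  calc _ ≤ ∑ q ∈ Finset.range n, 8 * ‖z‖ ^ 3 * (2 * (growthRate n * ‖z‖ ^ 2)) ^ q :=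
        norm_sum_le_of_le _ fun q _ => norm_vf_truncGen_le hσ hθ hθ1 n q z
    _ ≤ 8 * ‖z‖ ^ 3 * 2 := by
        rw [← Finset.mul_sum]
        gcongr
        exact geom_sum_le_two (by positivity) (by linarith) n
    _ = _ := by ring

lemma norm_vf_truncGen_sub_le (q : ℕ) {S : ℝ} {x y : Gevrey σ θ} (hx : ‖x‖ ≤ S) (hy : ‖y‖ ≤ S) :
    ‖vf (truncGen n (q + 1)) x - vf (truncGen n (q + 1)) y‖
      ≤ 24 * S ^ 2 * ‖x - y‖ * (4 * (growthRate n * S ^ 2)) ^ q := by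
  have hS : 0 ≤ S := (norm_nonneg x).trans hx
  have hq : ((q : ℝ) + 2) * (2 * q + 3) ≤ 6 * 4 ^ q := by
    have hlt : (q : ℝ) + 1 ≤ 2 ^ q := by exact_mod_cast Nat.lt_two_pow_self (n := q)
    rw [show (4 : ℝ) = 2 * 2 by norm_num, mul_pow]
    nlinarith [one_le_pow₀ (one_le_two : (1 : ℝ) ≤ 2) (n := q)]
  calc ‖vf (truncGen n (q + 1)) x - vf (truncGen n (q + 1)) y‖
      ≤ 2 * (((2 * (q + 1) + 1 : ℕ) : ℝ) + 1) * (growthRate n : ℝ) ^ (q + 1 - 1)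
          * ((2 * (q + 1) + 1 : ℕ) : ℝ) * S ^ (2 * (q + 1) + 1 - 1) * ‖x - y‖ :=
        norm_vf_sub_le hσ hθ hθ1 (norm_truncGen_le n (q + 1)) x y hx hy
    _ = 4 * ((q + 2) * (2 * q + 3)) * (growthRate n ^ q * S ^ (2 * q) * S ^ 2 * ‖x - y‖) := by
        rw [Nat.add_sub_cancel, Nat.add_sub_cancel]
        push_cast
        ring
    _ ≤ 4 * (6 * 4 ^ q) * (growthRate n ^ q * S ^ (2 * q) * S ^ 2 * ‖x - y‖) := by gcongr
    _ = _ := by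
        rw [mul_pow, mul_pow, pow_mul]
        ring

lemma norm_genField_sub_le {S : ℝ} (hS : growthRate n * S ^ 2 ≤ 1 / 8) {x y : Gevrey σ θ}
    (hx : ‖x‖ ≤ S) (hy : ‖y‖ ≤ S) : ‖genField n x - genField n y‖ ≤ 48 * S ^ 2 * ‖x - y‖ := by
  rw [genField_eq, genField_eq, ← Finset.sum_sub_distrib]
  calc _ ≤ ∑ q ∈ Finset.range n, 24 * S ^ 2 * ‖x - y‖ * (4 * (growthRate n * S ^ 2)) ^ q :=
        norm_sum_le_of_le _ fun q _ => norm_vf_truncGen_sub_le hσ hθ hθ1 n q hx hy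
    _ ≤ 24 * S ^ 2 * ‖x - y‖ * 2 := by
        rw [← Finset.mul_sum]
        gcongr
        exact geom_sum_le_two (by positivity) (by linarith) n
    _ = _ := by ring

/-- `genField` as a continuous map, the form in which the results on flows apply to it. -/
def genFieldC : C(Gevrey σ θ, Gevrey σ θ) :=
  ⟨genField n, (contDiff_genField hσ hθ hθ1 n).continuous⟩

lemma smallField_genFieldC {S : ℝ} (hS0 : 0 < S) (hS : growthRate n * S ^ 2 ≤ 1 / 8) :
    SmallField (genFieldC hσ hθ hθ1 n) S where
  pos := hS0
  smooth := contDiff_genField hσ hθ hθ1 n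
  zero := by
    have hzero : ‖genField n (0 : Gevrey σ θ)‖ ≤ 16 * ‖(0 : Gevrey σ θ)‖ ^ 3 :=
      norm_genField_le hσ hθ hθ1 n (by simp)
    rwa [norm_zero, zero_pow three_ne_zero, mul_zero, norm_le_zero_iff] at hzero
  contract := LipschitzOnWith.of_dist_le_mul fun x hx y hy => by
    rw [mem_ball_zero_iff] at hx hy
    rw [dist_eq_norm, dist_eq_norm]
    refine (norm_genField_sub_le hσ hθ hθ1 n hS hx.le hy.le).trans ?_
    refine mul_le_mul_of_nonneg_right ?_ (norm_nonneg _)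
    push_cast
    linarith [growthRate_mul_sq_le hS]

lemma omega_genField (z v : Gevrey σ θ) :
    omega hσ (genField n z) v = fderiv ℝ (fun z : Gevrey σ θ =>
      -(1 / 2) * (∑ a ∈ Finset.range (n + 1), polyEval (truncGen n a) z).re) z v := by
  have hsum : HasFDerivAt
      (fun z : Gevrey σ θ => ∑ a ∈ Finset.range (n + 1), polyEval (truncGen n a) z)
      (∑ a ∈ Finset.range (n + 1), fderiv ℝ (polyEval (truncGen n a)) z) z :=
    HasFDerivAt.fun_sum fun a _ => ((contDiff_polyEval
      (weighted_coeff_bound hσ (norm_truncGen_le n a))).differentiable (by simp) z).hasFDerivAt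
  have hre := (Complex.reCLM.hasFDerivAt.comp z hsum).const_mul (-(1 / 2))
  have hterm : ∀ a ∈ Finset.range (n + 1), omega hσ (vf (truncGen n a) z) v
      = -(1 / 2) * (fderiv ℝ (polyEval (truncGen n a)) z v).re := fun a _ =>
    omega_vf hσ hθ hθ1 (norm_truncGen_le n a) (admissible_truncGen n a).supported
      (admissible_truncGen n a).real z v
  refine Eq.trans ?_ (congrArg (fun T : Gevrey σ θ →L[ℝ] ℝ => T v) hre.fderiv.symm)
  rw [genField, map_sum, sum_apply, Finset.sum_congr rfl hterm, ← Finset.mul_sum]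
  simp

lemma omega_fderiv_genField (y u w : Gevrey σ θ) :
    omega hσ (fderiv ℝ (genField n) y u) w + omega hσ u (fderiv ℝ (genField n) y w) = 0 :=
  hamiltonian_fderiv_skew (omega_antisymm hσ)
    ((contDiff_genField hσ hθ hθ1 n).differentiable (by simp))
    (contDiff_const.mul (Complex.reCLM.contDiff.comp (ContDiff.sum fun a _ =>
      (contDiff_polyEval (weighted_coeff_bound hσ (norm_truncGen_le n a))).of_le
        (by norm_cast))))
    (omega_genField hσ hθ hθ1 n) y u w

end GenField

end Gevrey

/-! ### The Hamiltonian along the flow -/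

section Taylor

variable {E : Type*} [NormedAddCommGroup E] [NormedSpace ℝ E] {g : ℕ → ℝ → E} {s : Set ℝ}

lemma iteratedDerivWithin_eq_of_hasDerivWithinAt (hs : UniqueDiffOn ℝ s)
    (hg : ∀ k, ∀ t ∈ s, HasDerivWithinAt (g k) (g (k + 1) t) s t) (k : ℕ) :
    ∀ t ∈ s, iteratedDerivWithin k (g 0) s t = g k t := by
  induction k with
  | zero => simp
  | succ k ih =>
    intro t ht
    rw [iteratedDerivWithin_succ, derivWithin_congr ih (ih t ht)]
    exact (hg k t ht).derivWithin (hs t ht)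

lemma contDiffOn_of_hasDerivWithinAt_succ (hs : UniqueDiffOn ℝ s)
    (hg : ∀ k, ∀ t ∈ s, HasDerivWithinAt (g k) (g (k + 1) t) s t) : ContDiffOn ℝ ∞ (g 0) s :=
  contDiffOn_of_differentiableOn_deriv fun k _ =>
    DifferentiableOn.congr (fun t ht => (hg k t ht).differentiableWithinAt)
      (iteratedDerivWithin_eq_of_hasDerivWithinAt hs hg k)

lemma norm_inv_factorial_succ_smul_le {x : E} {k : ℕ} {b : ℝ} (h : ‖x‖ ≤ k.factorial * b) :
    ‖((k + 1).factorial : ℝ)⁻¹ • x‖ ≤ b := by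
  have hk : (0 : ℝ) < k.factorial := by exact_mod_cast k.factorial_pos
  have hk' : (k.factorial : ℝ) ≤ (k + 1).factorial := by
    exact_mod_cast Nat.factorial_le k.le_succ
  have hb : 0 ≤ b := nonneg_of_mul_nonneg_right ((norm_nonneg x).trans h) hk
  rw [norm_smul, norm_inv, Real.norm_natCast, inv_mul_le_iff₀ (hk.trans_le hk')]
  exact h.trans (mul_le_mul_of_nonneg_right hk' hb)

lemma norm_sub_taylor_le {b : ℝ} {n : ℕ}
    (hg : ∀ k, ∀ t ∈ Set.Icc (0 : ℝ) 1, HasDerivWithinAt (g k) (g (k + 1) t) (Set.Icc 0 1) t)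
    (hb : ∀ t ∈ Set.Icc (0 : ℝ) 1, ‖g (n + 1) t‖ ≤ n.factorial * b) :
    ‖∑ k ∈ Finset.range n, ((k + 1).factorial : ℝ)⁻¹ • g (k + 1) 0 - (g 0 1 - g 0 0)‖ ≤ b := by
  have hs : UniqueDiffOn ℝ (Set.Icc (0 : ℝ) 1) := uniqueDiffOn_Icc_zero_one
  have hiter := iteratedDerivWithin_eq_of_hasDerivWithinAt hs hg
  have htaylor := taylor_mean_remainder_bound (n := n) zero_le_one
    ((contDiffOn_of_hasDerivWithinAt_succ hs hg).of_le (by norm_cast; exact le_top))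
    (Set.right_mem_Icc.2 zero_le_one) (fun t ht => (hiter (n + 1) t ht).symm ▸ hb t ht)
  have hn : (n.factorial : ℝ) ≠ 0 := by exact_mod_cast n.factorial_ne_zero
  have hpoly : taylorWithinEval (g 0) n (Set.Icc 0 1) 0 1
      = g 0 0 + ∑ k ∈ Finset.range n, ((k + 1).factorial : ℝ)⁻¹ • g (k + 1) 0 := by
    simp only [taylor_within_apply, hiter _ 0 (Set.left_mem_Icc.2 zero_le_one), sub_zero, one_pow,
      mul_one]
    rw [Finset.sum_range_succ', add_comm]
    simp
  rw [hpoly, sub_zero, one_pow, mul_one, mul_div_cancel_left₀ b hn] at htaylor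
  rwa [← norm_neg, neg_sub, sub_sub]

lemma hasSum_taylor [CompleteSpace E] {M q : ℝ} (hq : 0 ≤ q) (hq1 : q < 1)
    (hg : ∀ k, ∀ t ∈ Set.Icc (0 : ℝ) 1, HasDerivWithinAt (g k) (g (k + 1) t) (Set.Icc 0 1) t)
    (hM : ∀ k, ∀ t ∈ Set.Icc (0 : ℝ) 1, ‖g (k + 1) t‖ ≤ k.factorial * (M * q ^ k)) :
    HasSum (fun k => ((k + 1).factorial : ℝ)⁻¹ • g (k + 1) 0) (g 0 1 - g 0 0) := by
  have hsum : Summable fun k => ((k + 1).factorial : ℝ)⁻¹ • g (k + 1) 0 :=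
    Summable.of_norm_bounded ((summable_geometric_of_lt_one hq hq1).mul_left M) fun k =>
      norm_inv_factorial_succ_smul_le (hM k 0 (Set.left_mem_Icc.2 zero_le_one))
  rw [hsum.hasSum_iff_tendsto_nat, tendsto_iff_norm_sub_tendsto_zero]
  refine squeeze_zero (fun _ => norm_nonneg _) (fun n => norm_sub_taylor_le hg (hM n)) ?_
  simpa using (tendsto_pow_atTop_nhds_zero_of_lt_one hq hq1).const_mul M

end Taylor

section BddCoef

variable {k : ℕ} {c d : (Fin k → Mode) → ℂ}

/-- A coefficient family is bounded, so that its polynomial converges on the Gevrey space. -/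
def BddCoef (c : (Fin k → Mode) → ℂ) : Prop := ∃ B : ℝ, ∀ j, ‖c j‖ ≤ B

lemma bddCoef_zero : BddCoef (0 : (Fin k → Mode) → ℂ) := ⟨0, fun _ => by simp⟩

lemma BddCoef.add (hc : BddCoef c) (hd : BddCoef d) : BddCoef (c + d) := by
  obtain ⟨B, hB⟩ := hc
  obtain ⟨D, hD⟩ := hd
  exact ⟨B + D, fun j => (norm_add_le _ _).trans (add_le_add (hB j) (hD j))⟩

lemma BddCoef.smul (hc : BddCoef c) (s : ℝ) : BddCoef (s • c) := by
  obtain ⟨B, hB⟩ := hc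
  exact ⟨‖s‖ * B, fun j => by
    rw [Pi.smul_apply, norm_smul]
    exact mul_le_mul_of_nonneg_left (hB j) (norm_nonneg _)⟩

lemma BddCoef.sum {ι : Type*} {s : Finset ι} {f : ι → (Fin k → Mode) → ℂ}
    (h : ∀ i ∈ s, BddCoef (f i)) : BddCoef (∑ i ∈ s, f i) :=
  Finset.sum_induction f BddCoef (fun _ _ h h' => h.add h') bddCoef_zero h

lemma BddCoef.bracketAt {a b p : ℕ} {χ : Coef a} {Q : Coef b} (hχ : BddCoef χ) (hQ : BddCoef Q) :
    BddCoef (bracketAt p χ Q) := by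
  unfold _root_.bracketAt
  split_ifs with h
  · obtain ⟨B, hB⟩ := hχ
    obtain ⟨D, hD⟩ := hQ
    exact ⟨_, norm_bracket_le h hB hD⟩
  · exact bddCoef_zero

end BddCoef

/-- The formal sum `Q` is a polynomial: its coefficients are bounded, and its components vanish
beyond the index `N`. -/
structure Family.DegreeLE (Q : Family) (N : ℕ) : Prop where
  bdd : ∀ p, BddCoef (Q p)
  vanish : ∀ p, N < p → Q p = 0

lemma Family.DegreeLE.lieDeriv {F Q : Family} {A N : ℕ} (hF : F.DegreeLE A) (hQ : Q.DegreeLE N) :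
    (lieDeriv F Q).DegreeLE (A + N) where
  bdd _ := BddCoef.sum fun _ _ => (hF.bdd _).bracketAt (hQ.bdd _)
  vanish _ := lieDeriv_eq_zero_of_lt hF.vanish hQ.vanish

lemma degreeLE_truncGen (n : ℕ) : (truncGen n).DegreeLE n where
  bdd p := ⟨_, norm_truncGen_le n p⟩
  vanish _ := truncGen_eq_zero

lemma degreeLE_quartic : quartic.DegreeLE 1 where
  bdd p := match p with
    | 0 => bddCoef_zero
    | 1 => ⟨_, norm_quarticCoef_le⟩
    | _ + 2 => bddCoef_zero
  vanish _ hp := quartic_of_ne hp.ne'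

lemma degreeLE_derivL2_truncGen (n : ℕ) :
    Family.DegreeLE (fun p => derivL2 (truncGen n p)) (n + 1) where
  bdd p := ⟨_, norm_derivL2_truncGen_le n p⟩
  vanish p hp := by
    funext j
    simp [truncGen_eq_zero (Nat.lt_of_succ_lt hp), derivL2]

lemma degreeLE_firstDeriv_truncGen (n : ℕ) : (firstDeriv (truncGen n)).DegreeLE (n + 1) where
  bdd p := ((degreeLE_derivL2_truncGen n).bdd p).add
    (((degreeLE_truncGen n).lieDeriv degreeLE_quartic).bdd p)
  vanish p hp := by
    rw [firstDeriv, (degreeLE_derivL2_truncGen n).vanish p hp,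
      ((degreeLE_truncGen n).lieDeriv degreeLE_quartic).vanish p hp, add_zero]

/-- The `(k + 1)`-st derivative of the Hamiltonian along the flow of the truncated generator. -/
def flowDeriv (n k : ℕ) : Family := (lieDeriv (truncGen n))^[k] (firstDeriv (truncGen n))

lemma flowDeriv_succ (n k : ℕ) : flowDeriv n (k + 1) = lieDeriv (truncGen n) (flowDeriv n k) :=
  Function.iterate_succ_apply' _ _ _

lemma exists_degreeLE_flowDeriv (n k : ℕ) : ∃ N, (flowDeriv n k).DegreeLE N := by
  induction k with
  | zero => exact ⟨n + 1, degreeLE_firstDeriv_truncGen n⟩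
  | succ k ih =>
    obtain ⟨N, hN⟩ := ih
    exact ⟨n + N, flowDeriv_succ n k ▸ (degreeLE_truncGen n).lieDeriv hN⟩

lemma bddCoef_flowDeriv (n k p : ℕ) : BddCoef (flowDeriv n k p) :=
  (exists_degreeLE_flowDeriv n k).elim fun _ h => h.bdd p

lemma bddCoef_transformed (n p : ℕ) : BddCoef (transformed (truncGen n) p) :=
  (degreeLE_quartic.bdd p).add (BddCoef.sum fun k _ => (bddCoef_flowDeriv n k p).smul _)

lemma norm_quartic_le {y : ℝ} (hy : 0 < y) (p : ℕ) (j : Fin (2 * p + 1 + 1) → Mode) :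
    ‖quartic p j‖ ≤ y⁻¹ * (6 * y) ^ p := by
  by_cases hp : p = 1
  · subst hp
    calc ‖quartic 1 j‖ ≤ 1 / 2 := norm_quarticCoef_le j
      _ ≤ 6 := by norm_num
      _ = _ := by field_simp
  · rw [quartic_of_ne hp, Pi.zero_apply, norm_zero]
    positivity

lemma norm_transformed_le {n : ℕ} (hn : 1 ≤ n) (p : ℕ) (j : Fin (2 * p + 1 + 1) → Mode) :
    ‖transformed (truncGen n) p j‖ ≤ 13 * (growthRate n : ℝ)⁻¹ * (6 * growthRate n) ^ p := by
  have hquartic : ‖quartic p j‖ ≤ (growthRate n : ℝ)⁻¹ * (6 * growthRate n) ^ p :=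
    norm_quartic_le (growthRate_pos n) p j
  set X := 6 * (growthRate n : ℝ)⁻¹ * (6 * growthRate n) ^ p with hX
  have hsum : ‖∑ k ∈ Finset.range (p + 1), ((k + 1).factorial : ℝ)⁻¹ •
      (lieDeriv (truncGen n))^[k] (firstDeriv (truncGen n)) p j‖ ≤ 2 * X := by
    calc _ ≤ ∑ k ∈ Finset.range (p + 1), (1 / 16 : ℝ) ^ k * X :=
          norm_sum_le_of_le _ fun k _ => norm_inv_factorial_succ_smul_le
            ((norm_iterate_lieDeriv_le hn k p j).trans_eq (mul_assoc _ _ _))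
      _ ≤ 2 * X := by
          rw [← Finset.sum_mul]
          gcongr
          exact geom_sum_le_two (by norm_num) (by norm_num) _
  simp only [transformed, Pi.add_apply, Finset.sum_apply, Pi.smul_apply]
  refine (norm_add_le _ _).trans ((add_le_add hquartic hsum).trans_eq ?_)
  rw [hX]
  ring

lemma growthRate_inv_mul_pow_le {n : ℕ} {t : ℝ} (ht : growthRate n * t ^ 2 ≤ 1 / 64) (p : ℕ) :
    (growthRate n : ℝ)⁻¹ * (6 * growthRate n) ^ p * t ^ (2 * p + 1 + 1) ≤ 1 / 16 * (1 / 2) ^ p := by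
  have ht' : t ^ 2 ≤ 1 / 16 := by linarith [growthRate_mul_sq_le ht, sq_nonneg t]
  have hinv : (growthRate n : ℝ)⁻¹ ≤ 1 := inv_le_one_of_one_le₀ (one_le_growthRate n)
  calc _ = (growthRate n : ℝ)⁻¹ * t ^ 2 * (6 * (growthRate n * t ^ 2)) ^ p := by
        rw [mul_pow, mul_pow, mul_pow]
        ring
    _ ≤ 1 * (1 / 16) * (1 / 2) ^ p := by
        gcongr
        linarith
    _ = _ := by ring

namespace Gevrey

variable {σ θ : ℝ}

section PolyEval

variable {k : ℕ} {c d : (Fin k → Mode) → ℂ}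

lemma polyEval_zero (z : Gevrey σ θ) : polyEval (0 : (Fin k → Mode) → ℂ) z = 0 := by
  simp [polyEval]

lemma polyEval_add (hσ : 0 ≤ σ) (hc : BddCoef c) (hd : BddCoef d) (z : Gevrey σ θ) :
    polyEval (c + d) z = polyEval c z + polyEval d z := by
  obtain ⟨B, hB⟩ := hc
  obtain ⟨D, hD⟩ := hd
  rw [polyEval, polyEval, polyEval, ← (summable_poly (weighted_coeff_bound hσ hB) z).tsum_add
    (summable_poly (weighted_coeff_bound hσ hD) z)]
  simp only [Pi.add_apply, add_mul]

lemma polyEval_smul (c : (Fin k → Mode) → ℂ) (s : ℝ) (z : Gevrey σ θ) :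
    polyEval (s • c) z = s • polyEval c z := by
  rw [polyEval, polyEval, ← tsum_const_smul'']
  simp only [Pi.smul_apply, smul_mul_assoc]

lemma polyEval_sum (hσ : 0 ≤ σ) {ι : Type*} (s : Finset ι) {f : ι → (Fin k → Mode) → ℂ}
    (h : ∀ i ∈ s, BddCoef (f i)) (z : Gevrey σ θ) :
    polyEval (∑ i ∈ s, f i) z = ∑ i ∈ s, polyEval (f i) z := by
  classical
  induction s using Finset.induction_on with
  | empty => simp [polyEval_zero]
  | insert i s hi ih =>
    have h' : ∀ i ∈ s, BddCoef (f i) := fun i hi => h i (Finset.mem_insert_of_mem hi)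
    rw [Finset.sum_insert hi, Finset.sum_insert hi,
      polyEval_add hσ (h i (Finset.mem_insert_self _ _)) (BddCoef.sum h'), ih h']

lemma differentiable_polyEval (hσ : 0 ≤ σ) (hc : BddCoef c) :
    Differentiable ℝ (polyEval c : Gevrey σ θ → ℂ) := by
  obtain ⟨B, hB⟩ := hc
  exact (contDiff_polyEval (weighted_coeff_bound hσ hB)).differentiable (by simp)

lemma norm_fderiv_polyEval_le (hσ : 0 ≤ σ) {c : (Fin (k + 1) → Mode) → ℂ} {B : ℝ}
    (hB : ∀ j, ‖c j‖ ≤ B) (z : Gevrey σ θ) :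
    ‖fderiv ℝ (polyEval c) z‖ ≤ (k + 1) * B * ‖z‖ ^ k := by
  have hB0 := nonneg_of_coeff_bound hB
  refine ContinuousLinearMap.opNorm_le_bound _ (by positivity) fun v => ?_
  rw [fderiv_polyEval (weighted_coeff_bound hσ hB)]
  refine tsum_of_norm_bounded ((hasSum_mode v).mul_left _) fun i => ?_
  have hi := norm_polyEval_le
    (norm_partialCoef_le_weight (weighted_coeff_bound (θ := θ) hσ hB) i) z
  calc _ ≤ ‖coord v i‖ * ((k + 1) * B * gevreyWeight σ θ i.2 * ‖z‖ ^ k) := by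
        rw [norm_mul]
        gcongr
    _ = _ := by ring

end PolyEval

lemma fderiv_polyEval_genField (hσ : 0 ≤ σ) (hθ : 0 < θ) (hθ1 : θ ≤ 1) (n : ℕ) {b : ℕ}
    {Q : Coef b} (hQ : BddCoef Q) (z : Gevrey σ θ) :
    fderiv ℝ (polyEval Q) z (genField n z)
      = ∑ a ∈ Finset.range (n + 1), polyEval (bracketAt (a + b) (truncGen n a) Q) z := by
  obtain ⟨D, hD⟩ := hQ
  rw [genField, map_sum]
  refine Finset.sum_congr rfl fun a _ => ?_
  have h : 2 * a + 1 + (2 * b + 1) = 2 * (a + b) + 1 + 1 := by ring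
  rw [bracketAt, dif_pos h, fderiv_polyEval_vf hσ hθ hθ1 (norm_truncGen_le n a) h
    (admissible_truncGen n a).real hD]

/-- The value of a formal sum at a point where its components are summable. -/
def famEval (Q : Family) (z : Gevrey σ θ) : ℂ := ∑' p, polyEval (Q p) z

lemma hasSum_famEval {Q : Family} {N : ℕ} (hQ : Q.DegreeLE N) (z : Gevrey σ θ) :
    HasSum (fun p => polyEval (Q p) z) (∑ p ∈ Finset.range (N + 1), polyEval (Q p) z) :=
  hasSum_sum_of_ne_finset_zero fun p hp => by
    rw [hQ.vanish p (by simpa using hp), polyEval_zero]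

lemma famEval_eq_sum {Q : Family} {N : ℕ} (hQ : Q.DegreeLE N) (z : Gevrey σ θ) :
    famEval Q z = ∑ p ∈ Finset.range (N + 1), polyEval (Q p) z := (hasSum_famEval hQ z).tsum_eq

lemma famEval_quartic (z : Gevrey σ θ) : famEval quartic z = polyEval quarticCoef z :=
  tsum_eq_single 1 fun p hp => by rw [quartic_of_ne hp, polyEval_zero]

lemma famEval_lieDeriv (hσ : 0 ≤ σ) {F Q : Family} {A N : ℕ} (hF : F.DegreeLE A)
    (hQ : Q.DegreeLE N) (z : Gevrey σ θ) :
    famEval (lieDeriv F Q) z = ∑ b ∈ Finset.range (N + 1), ∑ a ∈ Finset.range (A + 1),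
      polyEval (bracketAt (a + b) (F a) (Q b)) z := by
  let f : ℕ × ℕ → ℂ := fun x => polyEval (bracketAt (x.1 + x.2) (F x.1) (Q x.2)) z
  have hf : HasSum f (∑ x ∈ Finset.range (A + 1) ×ˢ Finset.range (N + 1), f x) :=
    hasSum_sum_of_ne_finset_zero fun x hx => by
      simp only [Finset.mem_product, Finset.mem_range, not_and_or, not_lt] at hx
      rcases hx with h | h
      · simp only [f, hF.vanish _ h, bracketAt_zero_left, polyEval_zero]
      · simp only [f, hQ.vanish _ h, bracketAt_zero_right, polyEval_zero]
  have hanti : HasSum (fun p => ∑ x ∈ Finset.HasAntidiagonal.antidiagonal p, f x)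
      (∑ x ∈ Finset.range (A + 1) ×ˢ Finset.range (N + 1), f x) := by
    have hsigma := (Finset.HasAntidiagonal.sigmaAntidiagonalEquivProd.hasSum_iff.2 hf).sigma
      fun p => hasSum_fintype _
    simpa only [Function.comp_apply, Finset.HasAntidiagonal.sigmaAntidiagonalEquivProd_apply,
      Finset.sum_coe_sort (Finset.HasAntidiagonal.antidiagonal _) f] using hsigma
  rw [famEval, ← Finset.sum_product_right' (f := fun a b => f (a, b)), ← hanti.tsum_eq]
  refine tsum_congr fun p => ?_
  rw [lieDeriv, polyEval_sum hσ _ fun x _ => (hF.bdd _).bracketAt (hQ.bdd _)]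
  refine Finset.sum_congr rfl fun x hx => ?_
  rw [← Finset.HasAntidiagonal.mem_antidiagonal.1 hx]

lemma hasFDerivAt_famEval (hσ : 0 ≤ σ) {Q : Family} {N : ℕ} (hQ : Q.DegreeLE N)
    (z : Gevrey σ θ) :
    HasFDerivAt (famEval Q) (∑ p ∈ Finset.range (N + 1), fderiv ℝ (polyEval (Q p)) z) z := by
  rw [show (famEval Q : Gevrey σ θ → ℂ) = fun z => ∑ p ∈ Finset.range (N + 1), polyEval (Q p) z
    from funext fun z => famEval_eq_sum hQ z]
  exact HasFDerivAt.fun_sum fun p _ => (differentiable_polyEval hσ (hQ.bdd p) z).hasFDerivAt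

/-- The Hamiltonian on the Gevrey space, as a sum of two polynomials. -/
def polyHamiltonian (z : Gevrey σ θ) : ℂ := polyEval l2Coef z + polyEval quarticCoef z

section Flow

variable (hθ : 0 < θ) (hθ1 : θ ≤ 1) {n : ℕ} {η : ℝ → Gevrey σ θ} {s : Set ℝ} {t : ℝ}

include hθ hθ1

lemma hasDerivWithinAt_famEval (hσ : 0 ≤ σ) {Q : Family} {N : ℕ} (hQ : Q.DegreeLE N)
    (hη : HasDerivWithinAt η (genField n (η t)) s t) :
    HasDerivWithinAt (fun t => famEval Q (η t)) (famEval (lieDeriv (truncGen n) Q) (η t)) s t := by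
  refine ((hasFDerivAt_famEval hσ hQ (η t)).comp_hasDerivWithinAt t hη).congr_deriv ?_
  rw [famEval_lieDeriv hσ (degreeLE_truncGen n) hQ, sum_apply]
  exact Finset.sum_congr rfl fun b _ => fderiv_polyEval_genField hσ hθ hθ1 n (hQ.bdd b) (η t)

lemma fderiv_l2_genField (hσ : 0 < σ) (z : Gevrey σ θ) :
    fderiv ℝ (polyEval l2Coef) z (genField n z)
      = famEval (fun p => derivL2 (truncGen n p)) z := by
  have htop : polyEval (derivL2 (truncGen n (n + 1))) z = 0 := by
    rw [truncGen_eq_zero n.lt_succ_self]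
    simp [polyEval, derivL2]
  rw [famEval_eq_sum (degreeLE_derivL2_truncGen n), Finset.sum_range_succ, htop, add_zero,
    genField, map_sum]
  exact Finset.sum_congr rfl fun p _ => fderiv_L2_vf hσ hθ hθ1 (norm_truncGen_le n p)
    (admissible_truncGen n p).supported (admissible_truncGen n p).real z

lemma hasDerivWithinAt_polyHamiltonian (hσ : 0 < σ)
    (hη : HasDerivWithinAt η (genField n (η t)) s t) :
    HasDerivWithinAt (fun t => polyHamiltonian (η t)) (famEval (flowDeriv n 0) (η t)) s t := by
  obtain ⟨B, hB⟩ := exists_l2Coef_bound (σ := σ) (θ := θ) hσ hθ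
  have hL2 := ((contDiff_polyEval hB).differentiable (by simp)
    (η t)).hasFDerivAt.comp_hasDerivWithinAt t hη
  have hquartic := hasDerivWithinAt_famEval hθ hθ1 hσ.le (n := n) degreeLE_quartic hη
  simp only [famEval_quartic] at hquartic
  refine (hL2.add hquartic).congr_deriv ?_
  have hderiv := degreeLE_derivL2_truncGen n
  have hlie := (degreeLE_truncGen n).lieDeriv degreeLE_quartic
  rw [fderiv_l2_genField hθ hθ1 hσ, famEval, famEval,
    ← (hasSum_famEval hderiv _).summable.tsum_add (hasSum_famEval hlie _).summable]
  exact tsum_congr fun p => (polyEval_add hσ.le (hderiv.bdd p) (hlie.bdd p) _).symm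

end Flow

section Estimates

variable (hσ : 0 ≤ σ) {n : ℕ} (hn : 1 ≤ n) {z : Gevrey σ θ}
  (hz : growthRate n * ‖z‖ ^ 2 ≤ 1 / 64)

include hσ hn hz

lemma norm_polyEval_flowDeriv_le (k p : ℕ) :
    ‖polyEval (flowDeriv n k p) z‖ ≤ k.factorial * ((1 / 16) ^ k * (1 / 2) ^ p) := by
  calc ‖polyEval (flowDeriv n k p) z‖
      ≤ k.factorial * (1 / 16) ^ k * (6 * (growthRate n : ℝ)⁻¹ * (6 * growthRate n) ^ p)
          * ‖z‖ ^ (2 * p + 1 + 1) :=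
        norm_polyEval_le (weighted_coeff_bound (θ := θ) hσ (norm_iterate_lieDeriv_le hn k p)) z
    _ = k.factorial * (1 / 16) ^ k *
          (6 * ((growthRate n : ℝ)⁻¹ * (6 * growthRate n) ^ p * ‖z‖ ^ (2 * p + 1 + 1))) := by ring
    _ ≤ k.factorial * (1 / 16) ^ k * (6 * (1 / 6 * (1 / 2) ^ p)) := by
        refine mul_le_mul_of_nonneg_left (mul_le_mul_of_nonneg_left
          ((growthRate_inv_mul_pow_le hz p).trans ?_) (by norm_num)) (by positivity)
        gcongr
        norm_num
    _ = _ := by ring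

lemma norm_famEval_flowDeriv_le (k : ℕ) :
    ‖famEval (flowDeriv n k) z‖ ≤ k.factorial * (2 * (1 / 16) ^ k) := by
  refine (tsum_of_norm_bounded ((hasSum_geometric_two.mul_left _).mul_left _)
    (norm_polyEval_flowDeriv_le hσ hn hz k)).trans_eq ?_
  ring

lemma norm_polyEval_transformed_le (p : ℕ) :
    ‖polyEval (transformed (truncGen n) p) z‖ ≤ (1 / 2) ^ p := by
  calc ‖polyEval (transformed (truncGen n) p) z‖
      ≤ 13 * (growthRate n : ℝ)⁻¹ * (6 * growthRate n) ^ p * ‖z‖ ^ (2 * p + 1 + 1) :=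
        norm_polyEval_le (weighted_coeff_bound (θ := θ) hσ (norm_transformed_le hn p)) z
    _ = 13 * ((growthRate n : ℝ)⁻¹ * (6 * growthRate n) ^ p * ‖z‖ ^ (2 * p + 1 + 1)) := by ring
    _ ≤ 13 * (1 / 16 * (1 / 2) ^ p) :=
        mul_le_mul_of_nonneg_left (growthRate_inv_mul_pow_le hz p) (by norm_num)
    _ ≤ _ := by linarith [show (0 : ℝ) ≤ (1 / 2) ^ p by positivity]

lemma summable_polyEval_transformed :
    Summable fun p => polyEval (transformed (truncGen n) p) z :=
  Summable.of_norm_bounded summable_geometric_two (norm_polyEval_transformed_le hσ hn hz)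

lemma summable_lieSeries : Summable fun x : ℕ × ℕ =>
    ((x.1 + 1).factorial : ℝ)⁻¹ • polyEval (flowDeriv n x.1 x.2) z :=
  Summable.of_norm_bounded ((summable_geometric_of_lt_one (by norm_num : (0 : ℝ) ≤ 1 / 16)
    (by norm_num)).mul_of_nonneg summable_geometric_two (fun k => by positivity)
    (fun p => by positivity)) fun x =>
      norm_inv_factorial_succ_smul_le (norm_polyEval_flowDeriv_le hσ hn hz x.1 x.2)

omit hn hz in
lemma polyEval_transformed (n p : ℕ) (z : Gevrey σ θ) :
    polyEval (transformed (truncGen n) p) z = polyEval (quartic p) z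
      + ∑' k, ((k + 1).factorial : ℝ)⁻¹ • polyEval (flowDeriv n k p) z := by
  have hb : ∀ k ∈ Finset.range (p + 1), BddCoef (((k + 1).factorial : ℝ)⁻¹ • flowDeriv n k p) :=
    fun k _ => (bddCoef_flowDeriv n k p).smul _
  have hvanish : ∀ k ∉ Finset.range (p + 1),
      ((k + 1).factorial : ℝ)⁻¹ • polyEval (flowDeriv n k p) z = 0 := fun k hk => by
    rw [Finset.mem_range, not_lt] at hk
    rw [flowDeriv, iterate_lieDeriv_eq_zero (truncGen_zero n) (firstDeriv_zero (truncGen_zero n))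
      k p (by omega), polyEval_zero, smul_zero]
  rw [tsum_eq_sum hvanish, ← Finset.sum_congr rfl fun k _ => polyEval_smul _ _ z,
    ← polyEval_sum hσ _ hb, ← polyEval_add hσ (degreeLE_quartic.bdd p) (BddCoef.sum hb)]
  rfl

lemma famEval_transformed_eq_lieSeries :
    famEval (transformed (truncGen n)) z = polyEval quarticCoef z
      + ∑' k, ((k + 1).factorial : ℝ)⁻¹ • famEval (flowDeriv n k) z := by
  have hlie := summable_lieSeries hσ hn hz
  have hsummable : Summable fun p => ∑' k, ((k + 1).factorial : ℝ)⁻¹ •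
      polyEval (flowDeriv n k p) z := hlie.prod_symm.prod
  calc famEval (transformed (truncGen n)) z
      = ∑' p, (polyEval (quartic p) z
          + ∑' k, ((k + 1).factorial : ℝ)⁻¹ • polyEval (flowDeriv n k p) z) :=
        tsum_congr fun p => polyEval_transformed hσ n p z
    _ = famEval quartic z
          + ∑' p, ∑' k, ((k + 1).factorial : ℝ)⁻¹ • polyEval (flowDeriv n k p) z :=
        (hasSum_famEval degreeLE_quartic z).summable.tsum_add hsummable
    _ = famEval quartic z
          + ∑' k, ∑' p, ((k + 1).factorial : ℝ)⁻¹ • polyEval (flowDeriv n k p) z := by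
        rw [Summable.tsum_comm (f := fun k p => ((k + 1).factorial : ℝ)⁻¹ •
          polyEval (flowDeriv n k p) z) hlie]
    _ = _ := by
        rw [famEval_quartic]
        simp only [famEval, tsum_const_smul'']

end Estimates

lemma polyHamiltonian_flow (hσ : 0 < σ) (hθ : 0 < θ) (hθ1 : θ ≤ 1) {n : ℕ} (hn : 1 ≤ n)
    {η : ℝ → Gevrey σ θ}
    (hη : ∀ t ∈ Set.Icc (0 : ℝ) 1, HasDerivWithinAt η (genField n (η t)) (Set.Icc 0 1) t)
    (hb : ∀ t ∈ Set.Icc (0 : ℝ) 1, growthRate n * ‖η t‖ ^ 2 ≤ 1 / 64) :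
    polyHamiltonian (η 1)
      = polyEval l2Coef (η 0) + famEval (transformed (truncGen n)) (η 0) := by
  let g : ℕ → ℝ → ℂ := fun k => Nat.casesOn k
    (fun t => polyHamiltonian (η t)) (fun k t => famEval (flowDeriv n k) (η t))
  have hg : ∀ k, ∀ t ∈ Set.Icc (0 : ℝ) 1,
      HasDerivWithinAt (g k) (g (k + 1) t) (Set.Icc 0 1) t := by
    rintro (_ | k) t ht
    · exact hasDerivWithinAt_polyHamiltonian hθ hθ1 hσ (hη t ht)
    · obtain ⟨N, hN⟩ := exists_degreeLE_flowDeriv n k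
      have hderiv := hasDerivWithinAt_famEval hθ hθ1 hσ.le hN (hη t ht)
      rwa [← flowDeriv_succ] at hderiv
  have hlie : ∑' k, ((k + 1).factorial : ℝ)⁻¹ • famEval (flowDeriv n k) (η 0)
      = polyHamiltonian (η 1) - polyHamiltonian (η 0) :=
    (hasSum_taylor (by norm_num) (by norm_num) hg fun k t ht =>
      norm_famEval_flowDeriv_le hσ.le hn (hb t ht) k).tsum_eq
  rw [famEval_transformed_eq_lieSeries hσ.le hn (hb 0 (Set.left_mem_Icc.2 zero_le_one)), hlie,
    polyHamiltonian, polyHamiltonian]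
  ring

lemma hasSum_hamVF {ι : Type*} {f : ι → Gevrey σ θ → ℂ} {F : Gevrey σ θ → ℂ} {z : Gevrey σ θ}
    (hF : HasSum (fun i => fderiv ℝ (f i) z) (fderiv ℝ F z)) (a : ℤ) :
    HasSum (fun i => hamVF (f i) z a) (hamVF F z a) := by
  have happly : ∀ v, HasSum (fun i => fderiv ℝ (f i) z v) (fderiv ℝ F z v) := fun v =>
    (ContinuousLinearMap.apply ℝ ℂ v).hasSum hF
  exact (((happly _).add ((happly _).mul_left _)).div_const 2).mul_left _

lemma succ_mul_growth_pow_le {y t : ℝ} (hy : 0 ≤ y) (ht : 0 ≤ t) (p : ℕ) :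
    (((2 * p + 1 : ℕ) : ℝ) + 1) * (13 * y⁻¹ * (6 * y) ^ p) * t ^ (2 * p + 1)
      ≤ 26 * y⁻¹ * t * (12 * (y * t ^ 2)) ^ p := by
  have hp : (p : ℝ) + 1 ≤ 2 ^ p := by exact_mod_cast Nat.lt_two_pow_self (n := p)
  calc _ = ((p : ℝ) + 1) * (26 * y⁻¹ * t * (6 * (y * t ^ 2)) ^ p) := by
        push_cast
        rw [mul_pow 6 y, mul_pow 6, mul_pow y, ← pow_mul]
        ring
    _ ≤ 2 ^ p * (26 * y⁻¹ * t * (6 * (y * t ^ 2)) ^ p) := by gcongr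
    _ = _ := by
        rw [show 12 * (y * t ^ 2) = 2 * (6 * (y * t ^ 2)) by ring, mul_pow 2]
        ring

/-- The part of the transformed quartic Hamiltonian of degree greater than `2 (n + 1)`. -/
def remainder (n : ℕ) (z : Gevrey σ θ) : ℝ :=
  (∑' i, polyEval (transformed (truncGen n) (n + 1 + i)) z).re

lemma ofReal_remainder (n : ℕ) (z : Gevrey σ θ) :
    (remainder n z : ℂ) = ∑' i, polyEval (transformed (truncGen n) (n + 1 + i)) z := by
  refine Complex.conj_eq_iff_re.1 ?_
  rw [Complex.conj_tsum]
  have hreal := fun p => (Family.Admissible.transformed (admissible_truncGen n) p).real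
  exact tsum_congr fun i => conj_polyEval (hreal _) z

/-- The Hamiltonian vector field of the remainder, summed degree by degree. -/
def remainderField (n : ℕ) (z : Gevrey σ θ) : Gevrey σ θ :=
  ∑' i, vf (transformed (truncGen n) (n + 1 + i)) z

section Remainder

variable (hσ : 0 ≤ σ) {n : ℕ} (hn : 1 ≤ n) {z : Gevrey σ θ}

include hσ hn

lemma famEval_transformed (hz : growthRate n * ‖z‖ ^ 2 ≤ 1 / 64) :
    famEval (transformed (truncGen n)) z
      = ∑ p ∈ Finset.range (n + 1), polyEval (transformed (truncGen n) p) z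
        + (remainder n z : ℂ) := by
  rw [famEval, ofReal_remainder, ← (summable_polyEval_transformed hσ hn hz).sum_add_tsum_nat_add
    (n + 1)]
  exact congrArg _ (tsum_congr fun i => by rw [Nat.add_comm i (n + 1)])

section Derivative

variable {S : ℝ} (hS : growthRate n * S ^ 2 ≤ 1 / 64)

include hS

lemma norm_fderiv_transformed_le (hz : ‖z‖ ≤ S) (p : ℕ) :
    ‖fderiv ℝ (polyEval (transformed (truncGen n) p)) z‖
      ≤ 26 * (growthRate n : ℝ)⁻¹ * S * (1 / 2) ^ p := by
  have hS0 : 0 ≤ S := (norm_nonneg _).trans hz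
  calc _ ≤ (((2 * p + 1 : ℕ) : ℝ) + 1) * (13 * (growthRate n : ℝ)⁻¹ * (6 * growthRate n) ^ p)
        * ‖z‖ ^ (2 * p + 1) := norm_fderiv_polyEval_le hσ (norm_transformed_le hn p) z
    _ ≤ (((2 * p + 1 : ℕ) : ℝ) + 1) * (13 * (growthRate n : ℝ)⁻¹ * (6 * growthRate n) ^ p)
        * S ^ (2 * p + 1) := by gcongr
    _ ≤ 26 * (growthRate n : ℝ)⁻¹ * S * (12 * (growthRate n * S ^ 2)) ^ p :=
        succ_mul_growth_pow_le (growthRate_pos n).le hS0 p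
    _ ≤ _ := by
        gcongr
        linarith

lemma summable_fderiv_transformed (hz : ‖z‖ ≤ S) :
    Summable fun p => fderiv ℝ (polyEval (transformed (truncGen n) p)) z :=
  Summable.of_norm_bounded (summable_geometric_two.mul_left _)
    (norm_fderiv_transformed_le hσ hn hS hz)

lemma hasFDerivAt_remainder (hz : z ∈ Metric.ball 0 S) :
    HasFDerivAt (fun y : Gevrey σ θ => (remainder n y : ℂ))
      (∑' i, fderiv ℝ (polyEval (transformed (truncGen n) (n + 1 + i))) z) z := by
  have hzS : ‖z‖ < S := mem_ball_zero_iff.1 hz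
  have hz64 : growthRate n * ‖z‖ ^ 2 ≤ 1 / 64 := le_trans (by gcongr) hS
  simp only [ofReal_remainder]
  exact hasFDerivAt_tsum_of_isPreconnected
    ((summable_geometric_two.mul_left _).comp_injective (add_right_injective (n + 1)))
    Metric.isOpen_ball (convex_ball (0 : Gevrey σ θ) S).isPreconnected
    (fun i y _ => (differentiable_polyEval hσ ⟨_, norm_transformed_le hn _⟩ y).hasFDerivAt)
    (fun i y hy => norm_fderiv_transformed_le hσ hn hS (mem_ball_zero_iff.1 hy).le _)
    hz ((summable_polyEval_transformed hσ hn hz64).comp_injective (add_right_injective (n + 1))) hz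

end Derivative

variable (hθ : 0 < θ) (hθ1 : θ ≤ 1)

include hθ hθ1

lemma norm_vf_transformed_le (hz : growthRate n * ‖z‖ ^ 2 ≤ 1 / 64) (i : ℕ) :
    ‖vf (transformed (truncGen n) (n + 1 + i)) z‖ ≤ 52 * (growthRate n : ℝ)⁻¹ * ‖z‖
      * (12 * (growthRate n * ‖z‖ ^ 2)) ^ (n + 1) * (1 / 2) ^ i := by
  calc _ ≤ 2 * ((((2 * (n + 1 + i) + 1 : ℕ) : ℝ) + 1)
        * (13 * (growthRate n : ℝ)⁻¹ * (6 * growthRate n) ^ (n + 1 + i))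
        * ‖z‖ ^ (2 * (n + 1 + i) + 1)) :=
        (norm_vf_le hσ hθ hθ1 (norm_transformed_le hn _) z).trans_eq (by simp only [mul_assoc])
    _ ≤ 2 * (26 * (growthRate n : ℝ)⁻¹ * ‖z‖
        * (12 * (growthRate n * ‖z‖ ^ 2)) ^ (n + 1 + i)) :=
        mul_le_mul_of_nonneg_left (succ_mul_growth_pow_le (growthRate_pos n).le
          (norm_nonneg z) _) zero_le_two
    _ = 52 * (growthRate n : ℝ)⁻¹ * ‖z‖ * (12 * (growthRate n * ‖z‖ ^ 2)) ^ (n + 1)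
        * (12 * (growthRate n * ‖z‖ ^ 2)) ^ i := by rw [pow_add _ (n + 1)]; ring
    _ ≤ _ := by
        gcongr
        linarith

lemma norm_remainderField_le (hz : growthRate n * ‖z‖ ^ 2 ≤ 1 / 64) :
    ‖remainderField n z‖ ≤ 104 * (growthRate n : ℝ)⁻¹ * ‖z‖
      * (12 * (growthRate n * ‖z‖ ^ 2)) ^ (n + 1) := by
  refine (tsum_of_norm_bounded (hasSum_geometric_two.mul_left _)
    (norm_vf_transformed_le hσ hn hθ hθ1 hz)).trans_eq ?_
  ring

lemma remainderField_apply {S : ℝ} (hS : growthRate n * S ^ 2 ≤ 1 / 64)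
    (hz : z ∈ Metric.ball 0 S) (a : ℤ) :
    remainderField n z a = hamVF (fun y => (remainder n y : ℂ)) z a := by
  have hzS : ‖z‖ < S := mem_ball_zero_iff.1 hz
  have hz64 : growthRate n * ‖z‖ ^ 2 ≤ 1 / 64 := le_trans (by gcongr) hS
  have hsummable : Summable fun i => vf (transformed (truncGen n) (n + 1 + i)) z :=
    Summable.of_norm_bounded (summable_geometric_two.mul_left _)
      (norm_vf_transformed_le hσ hn hθ hθ1 hz64)
  have hfderiv := ((summable_fderiv_transformed hσ hn hS hzS.le).comp_injective
    (add_right_injective (n + 1))).hasSum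
  rw [Function.comp_def, ← (hasFDerivAt_remainder hσ hn hS hz).fderiv] at hfderiv
  rw [← (hasSum_hamVF hfderiv a).tsum_eq, remainderField, ← coeffL_apply,
    (coeffL a).map_tsum hsummable]
  exact tsum_congr fun i => (hamVF_polyEval hσ hθ hθ1 (norm_transformed_le hn _)
    (Family.Admissible.transformed (admissible_truncGen n) _).supported z a).symm

end Remainder

lemma polyEval_add_conjTuple (hσ : 0 ≤ σ) {k : ℕ} {c : (Fin k → Mode) → ℂ} (hc : BddCoef c)
    (hreal : ∀ j, conj (c j) = c j) (z : Gevrey σ θ) :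
    polyEval (fun j => c j + c (conjTuple j)) z = polyEval c z + conj (polyEval c z) := by
  obtain ⟨B, hB⟩ := hc
  have hconj : polyEval (fun j => c (conjTuple j)) z = conj (polyEval c z) := by
    rw [polyEval, polyEval, conj_tsum_coeffs]
    refine tsum_congr fun j => ?_
    rw [map_mul, hreal, conj_mono, conjTuple_conjTuple]
  rw [← hconj, ← polyEval_add hσ ⟨B, hB⟩ ⟨B, fun j => hB _⟩]
  rfl

/-- The tuple of modes of the monomial `z_{a₁} z_{a₂} \bar z_{b₁} \bar z_{b₂}`. -/
def quartetTuple (q : ℤ × ℤ × ℤ × ℤ) : Fin 4 → Mode :=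
  ![(1, q.1), (1, q.2.1), (-1, q.2.2.1), (-1, q.2.2.2)]

lemma quartetTuple_injective : Function.Injective quartetTuple := fun q q' h => by
  have hentry := fun i => congrArg Prod.snd (congrFun h i)
  exact Prod.ext (hentry 0) (Prod.ext (hentry 1) (Prod.ext (hentry 2) (hentry 3)))

lemma mono_quartetTuple (z : Gevrey σ θ) (a₁ a₂ b₁ b₂ : ℤ) :
    mono z (quartetTuple (a₁, a₂, b₁, b₂)) = z a₁ * z a₂ * conj (z b₁) * conj (z b₂) := by
  rw [mono, Fin.prod_univ_four, ← coord_one, ← coord_one, ← coord_neg_one, ← coord_neg_one]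
  rfl

lemma divisor_quartetTuple (a₁ a₂ b₁ b₂ : ℤ) :
    divisor (quartetTuple (a₁, a₂, b₁, b₂)) = a₁ ^ 2 + a₂ ^ 2 - b₁ ^ 2 - b₂ ^ 2 := by
  simp only [divisor, Fin.sum_univ_four, quartetTuple, Matrix.cons_val, Units.val_one,
    Units.val_neg]
  ring

lemma quarticHalf_quartetTuple {a₁ a₂ b₁ b₂ : ℤ} (h : a₁ + a₂ = b₁ + b₂) (h' : a₁ ≠ b₁) :
    quarticHalf (quartetTuple (a₁, a₂, b₁, b₂)) = 1 / (4 * ((a₁ : ℂ) - (b₁ : ℂ)) ^ 2) :=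
  if_pos ⟨rfl, rfl, rfl, rfl, h, h'⟩

lemma exists_quartetTuple_eq {j : Fin 4 → Mode} (hj : quarticHalf j ≠ 0) :
    ∃ a₁ a₂ b₁ b₂ : ℤ, a₁ + a₂ = b₁ + b₂ ∧ a₁ ≠ b₁ ∧ quartetTuple (a₁, a₂, b₁, b₂) = j := by
  obtain ⟨h0, h1, h2, h3, hsum, hne⟩ := (ite_ne_right_iff.1 hj).1
  refine ⟨_, _, _, _, hsum, hne, funext fun i => ?_⟩
  fin_cases i
  exacts [Prod.ext h0.symm rfl, Prod.ext h1.symm rfl, Prod.ext h2.symm rfl, Prod.ext h3.symm rfl]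

lemma resonant_quartet {a₁ a₂ b₁ b₂ : ℤ} (h : a₁ + a₂ = b₁ + b₂) (h' : a₁ ≠ b₁)
    (hres : a₁ ^ 2 + a₂ ^ 2 - b₁ ^ 2 - b₂ ^ 2 = 0) : b₁ = a₂ ∧ b₂ = a₁ := by
  have hfactor : (a₁ - b₁) * (a₂ - b₁) = 0 := by
    obtain rfl : b₂ = a₁ + a₂ - b₁ := by linarith
    linarith
  rcases mul_eq_zero.1 hfactor with h₁ | h₂
  · exact absurd (sub_eq_zero.1 h₁) h'
  · constructor <;> linarith

lemma polyEval_quarticHalf (z : Gevrey σ θ) : polyEval quarticHalf z = NLSP.P4 z / 2 := by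
  have hinj : Function.Injective fun q : NLSP.quartets => quartetTuple q.1 :=
    quartetTuple_injective.comp Subtype.val_injective
  have hsupport : Function.support (fun j => quarticHalf j * mono z j)
      ⊆ Set.range fun q : NLSP.quartets => quartetTuple q.1 := fun j hj => by
    obtain ⟨a₁, a₂, b₁, b₂, h, h', rfl⟩ := exists_quartetTuple_eq (left_ne_zero_of_mul hj)
    exact ⟨⟨_, h, h'⟩, rfl⟩
  rw [polyEval, ← hinj.tsum_eq hsupport, NLSP.P4, ← tsum_div_const]
  refine tsum_congr fun ⟨⟨a₁, a₂, b₁, b₂⟩, h, h'⟩ => ?_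
  dsimp only
  rw [quarticHalf_quartetTuple h h', mono_quartetTuple, one_div, one_div, mul_inv, mul_inv]
  ring

lemma conj_P4 (z : Gevrey σ θ) : conj (NLSP.P4 z) = NLSP.P4 z := by
  let swap : NLSP.quartets ≃ NLSP.quartets :=
    { toFun := fun q => ⟨(q.1.2.2.1, q.1.2.2.2, q.1.1, q.1.2.1), q.2.1.symm, q.2.2.symm⟩
      invFun := fun q => ⟨(q.1.2.2.1, q.1.2.2.2, q.1.1, q.1.2.1), q.2.1.symm, q.2.2.symm⟩
      left_inv := fun _ => rfl
      right_inv := fun _ => rfl }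
  rw [NLSP.P4, Complex.conj_tsum, ← swap.tsum_eq]
  refine tsum_congr fun q => ?_
  simp only [swap, Equiv.coe_fn_mk, map_mul, map_div₀, map_one, map_pow, map_sub,
    Complex.conj_conj, map_ofNat, map_intCast]
  ring

lemma polyEval_quarticCoef (hσ : 0 ≤ σ) (z : Gevrey σ θ) :
    polyEval quarticCoef z = NLSP.P4 z := by
  have h := polyEval_add_conjTuple hσ ⟨_, norm_quarticHalf_le⟩ conj_quarticHalf z
  rwa [polyEval_quarticHalf, map_div₀, conj_P4, map_ofNat, add_halves] at h

lemma polyEval_resonantPart_quarticHalf (z : Gevrey σ θ) :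
    polyEval (resonantPart quarticHalf) z = (NLSP.L4 z : ℂ) / 2 := by
  have hinj : Function.Injective fun p : {p : ℤ × ℤ // p.1 ≠ p.2} =>
      quartetTuple (p.1.1, p.1.2, p.1.2, p.1.1) := fun p q h => by
    have hpq := quartetTuple_injective h
    rw [Prod.mk.injEq, Prod.mk.injEq] at hpq
    exact Subtype.ext (Prod.ext hpq.1 hpq.2.1)
  have hsupport : Function.support (fun j => resonantPart quarticHalf j * mono z j)
      ⊆ Set.range fun p : {p : ℤ × ℤ // p.1 ≠ p.2} =>
        quartetTuple (p.1.1, p.1.2, p.1.2, p.1.1) := fun j hj => by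
    obtain ⟨hdiv, hne⟩ := ite_ne_right_iff.1
      (left_ne_zero_of_mul hj : resonantPart quarticHalf j ≠ 0)
    obtain ⟨a₁, a₂, b₁, b₂, h, h', rfl⟩ := exists_quartetTuple_eq hne
    obtain ⟨rfl, rfl⟩ := resonant_quartet h h' ((divisor_quartetTuple _ _ _ _).symm.trans hdiv)
    exact ⟨⟨(b₂, b₁), h'⟩, rfl⟩
  rw [polyEval, ← hinj.tsum_eq hsupport, NLSP.L4, Complex.ofReal_tsum, ← tsum_div_const]
  refine tsum_congr fun ⟨⟨a₁, a₂⟩, h⟩ => ?_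
  have hdiv : divisor (quartetTuple (a₁, a₂, a₂, a₁)) = 0 := by
    rw [divisor_quartetTuple]
    ring
  rw [resonantPart, if_pos hdiv, quarticHalf_quartetTuple (add_comm _ _) h, mono_quartetTuple]
  push_cast
  rw [← Complex.mul_conj', ← Complex.mul_conj', one_div, one_div, mul_inv, mul_inv]
  ring

lemma polyEval_resonantPart_quarticCoef (hσ : 0 ≤ σ) (z : Gevrey σ θ) :
    polyEval (resonantPart quarticCoef) z = (NLSP.L4 z : ℂ) := by
  have hreal : ∀ j, conj (resonantPart quarticHalf j) = resonantPart quarticHalf j := fun j => by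
    unfold resonantPart
    split_ifs
    exacts [conj_quarticHalf j, map_zero _]
  have hsplit : resonantPart quarticCoef =
      fun j => resonantPart quarticHalf j + resonantPart quarticHalf (conjTuple j) := by
    funext j
    simp only [resonantPart, quarticCoef, divisor_conjTuple, neg_eq_zero]
    split_ifs <;> simp
  rw [hsplit, polyEval_add_conjTuple hσ
      ⟨_, fun j => (norm_resonantPart_le _ j).trans (norm_quarticHalf_le j)⟩ hreal,
    polyEval_resonantPart_quarticHalf, map_div₀, Complex.conj_ofReal, map_ofNat, add_halves]

lemma transformed_truncGen_one {n : ℕ} (hn : 1 ≤ n) :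
    transformed (truncGen n) 1 = resonantPart quarticCoef := by
  have hlie : lieDeriv (truncGen n) quartic 1 = 0 :=
    iterate_lieDeriv_eq_zero (truncGen_zero n) quartic_zero 1 1 le_rfl
  have hfirst : lieDeriv (truncGen n) (firstDeriv (truncGen n)) 1 = 0 :=
    iterate_lieDeriv_eq_zero (truncGen_zero n) (firstDeriv_zero (truncGen_zero n)) 1 1 le_rfl
  rw [transformed_truncGen hn, obstruction, hlie, Finset.sum_range_one, Function.iterate_one,
    hfirst, smul_zero, add_zero, add_zero]
  rfl

end Gevrey

/-! ### The normal form -/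

section Symmetrization

variable {k : ℕ} {c : (Fin k → Mode) → ℂ}

/-- The mean of the coefficients over the permutations of the entries: the symmetric coefficients
of the same polynomial. -/
def symmCoef (c : (Fin k → Mode) → ℂ) : (Fin k → Mode) → ℂ :=
  (k.factorial : ℝ)⁻¹ • ∑ φ : Equiv.Perm (Fin k), fun j => c (j ∘ φ)

lemma symmCoef_apply (c : (Fin k → Mode) → ℂ) (j : Fin k → Mode) :
    symmCoef c j = (k.factorial : ℝ)⁻¹ • ∑ φ : Equiv.Perm (Fin k), c (j ∘ φ) := by
  simp [symmCoef]

lemma symmCoef_comp_perm (c : (Fin k → Mode) → ℂ) (j : Fin k → Mode) (ψ : Equiv.Perm (Fin k)) :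
    symmCoef c (j ∘ ψ) = symmCoef c j := by
  rw [symmCoef_apply, symmCoef_apply,
    ← Equiv.sum_comp (Equiv.mulLeft ψ) fun φ : Equiv.Perm (Fin k) => c (j ∘ φ)]
  rfl

lemma exists_of_symmCoef_ne {j : Fin k → Mode} (h : symmCoef c j ≠ 0) :
    ∃ φ : Equiv.Perm (Fin k), c (j ∘ φ) ≠ 0 := by
  by_contra! h'
  exact h (by simp [symmCoef_apply, h'])

lemma norm_symmCoef_le {B : ℝ} (hB : ∀ j, ‖c j‖ ≤ B) (j : Fin k → Mode) : ‖symmCoef c j‖ ≤ B := by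
  have hfac : (0 : ℝ) < k.factorial := mod_cast k.factorial_pos
  have hsum : ‖∑ φ : Equiv.Perm (Fin k), c (j ∘ φ)‖ ≤ k.factorial * B := by
    refine (norm_sum_le_of_le _ fun (φ : Equiv.Perm (Fin k)) _ => hB (j ∘ φ)).trans_eq ?_
    rw [Finset.sum_const, Finset.card_univ, Fintype.card_perm, Fintype.card_fin, nsmul_eq_mul]
  rw [symmCoef_apply, norm_smul, Real.norm_of_nonneg (inv_pos.2 hfac).le, inv_mul_le_iff₀ hfac]
  exact hsum

lemma divisor_eq_zero_of_symmCoef_ne (hc : ∀ j, c j ≠ 0 → divisor j = 0) {j : Fin k → Mode}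
    (hj : symmCoef c j ≠ 0) : divisor j = 0 := by
  obtain ⟨φ, hφ⟩ := exists_of_symmCoef_ne hj
  rw [← hc _ hφ]
  exact (Equiv.sum_comp φ fun α => ((j α).1 : ℤ) * (j α).2 ^ 2).symm

lemma Admissible.symmCoef (hc : Admissible c) : Admissible (symmCoef c) where
  supported j hj := by
    obtain ⟨φ, hφ⟩ := exists_of_symmCoef_ne hj
    obtain ⟨hcharge, hmomentum⟩ := hc.supported _ hφ
    exact ⟨(Equiv.sum_comp φ fun α => ((j α).1 : ℤ)).symm.trans hcharge,
      (Equiv.sum_comp φ fun α => ((j α).1 : ℤ) * (j α).2).symm.trans hmomentum⟩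
  real j := by
    rw [symmCoef_apply, symmCoef_apply, Complex.real_smul, Complex.real_smul, map_mul,
      Complex.conj_ofReal, map_sum]
    exact congrArg _ (Finset.sum_congr rfl fun φ _ => hc.real _)

lemma Gevrey.polyEval_comp_perm {σ θ : ℝ} (c : (Fin k → Mode) → ℂ) (φ : Equiv.Perm (Fin k))
    (z : Gevrey σ θ) : polyEval (fun j => c (j ∘ φ)) z = polyEval c z := by
  rw [polyEval, polyEval, ← (Equiv.arrowCongr φ.symm (Equiv.refl Mode)).tsum_eq
    fun j => c j * mono z j]
  refine tsum_congr fun j => congrArg _ ?_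
  exact (Equiv.prod_comp φ fun α => coord z (j α)).symm

lemma Gevrey.polyEval_symmCoef {σ θ : ℝ} (hσ : 0 ≤ σ) (hc : BddCoef c) (z : Gevrey σ θ) :
    polyEval (symmCoef c) z = polyEval c z := by
  have hfac : (k.factorial : ℝ) ≠ 0 := mod_cast k.factorial_ne_zero
  have hperm : ∀ φ : Equiv.Perm (Fin k), BddCoef fun j => c (j ∘ φ) := fun φ =>
    hc.imp fun B hB j => hB (j ∘ φ)
  rw [symmCoef, polyEval_smul, polyEval_sum hσ _ fun φ _ => hperm φ]
  simp only [polyEval_comp_perm]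
  rw [Finset.sum_const, Finset.card_univ, Fintype.card_perm, Fintype.card_fin,
    ← Nat.cast_smul_eq_nsmul ℝ, smul_smul, inv_mul_cancel₀ hfac, one_smul]

end Symmetrization

namespace HPoly

variable {m : ℕ} {c : (Fin (2 * m) → Mode) → ℂ}

lemma eval_eq_polyEval {σ θ : ℝ} (P : HPoly m) (z : Gevrey σ θ) :
    P.eval z = Gevrey.polyEval P.coeff z :=
  tsum_subtype_eq_of_support_subset (f := fun j => P.coeff j * Gevrey.mono z j) fun j hj =>
    not_imp_comm.1 (P.support j) (left_ne_zero_of_mul hj)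

lemma contDiff_eval {σ θ : ℝ} (hσ : 0 ≤ σ) (P : HPoly m) :
    ContDiff ℝ ∞ fun z : Gevrey σ θ => P.eval z := by
  obtain ⟨B, hB⟩ := P.bounded
  simp only [eval_eq_polyEval]
  exact Gevrey.contDiff_polyEval (weighted_coeff_bound hσ fun j => hB ⟨j, rfl⟩)

/-- The element of `𝓗ₘ` that represents the polynomial with the given, not necessarily symmetric,
coefficients. -/
def ofCoef (c : (Fin (2 * m) → Mode) → ℂ) (hc : Admissible c) (hb : BddCoef c) : HPoly m where
  coeff := symmCoef c
  support j hj := by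
    by_contra h
    exact hj (hc.symmCoef.supported j h)
  reality := hc.symmCoef.real
  symmetry := symmCoef_comp_perm c
  bounded := hb.imp fun _ hB => Set.forall_mem_range.2 (norm_symmCoef_le hB)

lemma eval_ofCoef {σ θ : ℝ} (hσ : 0 ≤ σ) {hc : Admissible c} {hb : BddCoef c} (z : Gevrey σ θ) :
    (ofCoef c hc hb).eval z = Gevrey.polyEval c z :=
  (eval_eq_polyEval _ z).trans (Gevrey.polyEval_symmCoef hσ hb z)

lemma supNorm_ofCoef_le {hc : Admissible c} {hb : BddCoef c} {B : ℝ} (hB : ∀ j, ‖c j‖ ≤ B) :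
    (ofCoef c hc hb).supNorm ≤ B :=
  Real.iSup_le (fun j => norm_symmCoef_le hB j.1) (nonneg_of_coeff_bound hB)

lemma isResonant_ofCoef {hc : Admissible c} {hb : BddCoef c}
    (hd : ∀ j, c j ≠ 0 → divisor j = 0) : (ofCoef c hc hb).IsResonant := fun j hj =>
  ⟨hc.symmCoef.supported j hj, divisor_eq_zero_of_symmCoef_ne hd hj⟩

end HPoly

/-- The component of degree `2 m` of the Hamiltonian transformed by the truncated generator. -/
def normalPoly (n : ℕ) : (m : ℕ) → HPoly m
  | 0 => .ofCoef 0 .zero bddCoef_zero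
  | p + 1 => .ofCoef (transformed (truncGen n) p) ((admissible_truncGen n).transformed p)
      (bddCoef_transformed n p)

lemma eval_normalPoly_succ {σ θ : ℝ} (hσ : 0 ≤ σ) (n p : ℕ) (z : Gevrey σ θ) :
    (normalPoly n (p + 1)).eval z = Gevrey.polyEval (transformed (truncGen n) p) z := by
  rw [normalPoly, HPoly.eval_ofCoef hσ]

lemma isResonant_normalPoly {n m : ℕ} (hm : m ≤ n + 1) : (normalPoly n m).IsResonant := by
  cases m with
  | zero =>
    rw [normalPoly]
    exact HPoly.isResonant_ofCoef fun _ h => (h rfl).elim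
  | succ p =>
    rw [normalPoly]
    refine HPoly.isResonant_ofCoef fun j hj => ?_
    rw [transformed_truncGen (Nat.le_of_succ_le_succ hm)] at hj
    exact (ite_ne_right_iff.1 hj).1

lemma supNorm_normalPoly_succ_le {n p : ℕ} (hp : 1 ≤ p) (hpn : p ≤ n) :
    (normalPoly n (p + 1)).supNorm ≤ (growthRate p : ℝ) ^ (p - 1) := by
  rw [normalPoly]
  refine HPoly.supNorm_ofCoef_le fun j => ?_
  rw [transformed_truncGen hpn]
  exact (norm_resonantPart_le _ j).trans (norm_obstruction_le hp hpn j)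

namespace Gevrey

variable {σ θ : ℝ}

/-- A smooth symplectic map on `O` that agrees with the identity up to third order at the origin. -/
structure IsCubicSymplecticOn (φ : Gevrey σ θ → Gevrey σ θ) (O : Set (Gevrey σ θ)) : Prop where
  smooth : ContDiffOn ℝ ∞ φ O
  symplectic : IsSymplecticOn φ O
  norm_sub_le : ∀ z ∈ O, ‖φ z - z‖ ≤ 128 * ‖z‖ ^ 3

lemma IsCubicSymplecticOn.mono {φ : Gevrey σ θ → Gevrey σ θ} {O O' : Set (Gevrey σ θ)}
    (h : IsCubicSymplecticOn φ O) (hO : O' ⊆ O) : IsCubicSymplecticOn φ O' where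
  smooth := h.smooth.mono hO
  symplectic z hz := h.symplectic z (hO hz)
  norm_sub_le z hz := h.norm_sub_le z (hO hz)

lemma IsCubicSymplecticOn.mapsTo_ball {φ : Gevrey σ θ → Gevrey σ θ} {s : ℝ}
    (h : IsCubicSymplecticOn φ (Metric.ball 0 s)) (hs : 128 * s ^ 2 ≤ 1) :
    Set.MapsTo φ (Metric.ball 0 s) (Metric.ball 0 (2 * s)) := by
  intro z hz
  have hzs : ‖z‖ < s := mem_ball_zero_iff.1 hz
  have hcubic : 128 * ‖z‖ ^ 3 ≤ ‖z‖ := by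
    calc 128 * ‖z‖ ^ 3 = 128 * ‖z‖ ^ 2 * ‖z‖ := by ring
      _ ≤ 128 * s ^ 2 * ‖z‖ := by gcongr
      _ ≤ ‖z‖ := mul_le_of_le_one_left (norm_nonneg z) hs
  rw [mem_ball_zero_iff]
  linarith [norm_le_norm_add_norm_sub' (φ z) z, h.norm_sub_le z hz]

section TimeOne

variable (hσ : 0 ≤ σ) {O : Set (Gevrey σ θ)} {X : C(Gevrey σ θ, Gevrey σ θ)}
  {Γ : Gevrey σ θ → C(unitInterval, Gevrey σ θ)}

include hσ

lemma isSymplecticOn_timeOne (hΓ : IsSmoothFlowOn X Γ O) (hO : IsOpen O) (hX : ContDiff ℝ 1 X)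
    (hω : ∀ y u w, omega hσ (fderiv ℝ X y u) w + omega hσ u (fderiv ℝ X y w) = 0) :
    IsSymplecticOn (fun z => Γ z 1) O := fun z hz v w => by
  rw [← omega_eq_l2Inner hσ, ← omega_eq_l2Inner hσ]
  exact hΓ.bilinear_invariant hO hX hz (omega hσ) hω v w

variable (hθ : 0 < θ) (hθ1 : θ ≤ 1) {n : ℕ} {S : ℝ} (hS : growthRate n * S ^ 2 ≤ 1 / 8)

include hθ hθ1 hS

lemma norm_timeOne_sub_le (h : SmallField X S) (hX : ∀ w, ‖X w‖ = ‖genField n w‖)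
    {z : Gevrey σ θ} {γ : C(unitInterval, Gevrey σ θ)} (hγS : γ ∈ Metric.ball 0 S)
    (hγ : IsTrajectory X z γ) : ‖γ 1 - z‖ ≤ 128 * ‖z‖ ^ 3 := by
  refine hγ.norm_sub_le (by positivity) (fun t => ?_) 1
  have hγt : ‖γ t‖ ≤ ‖γ‖ := γ.norm_coe_le_norm t
  have hγ' : ‖γ‖ < S := mem_ball_zero_iff.1 hγS
  calc ‖X (γ t)‖ = ‖genField n (γ t)‖ := hX _
    _ ≤ 16 * ‖γ t‖ ^ 3 := norm_genField_le hσ hθ hθ1 n <| hS.trans' <| by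
      gcongr
      exact hγt.trans hγ'.le
    _ ≤ 16 * (2 * ‖z‖) ^ 3 := by
      gcongr
      exact hγt.trans (h.norm_trajectory_le hγS hγ)
    _ = 128 * ‖z‖ ^ 3 := by ring

lemma exists_isCubicSymplecticOn_timeOne (h : SmallField X S)
    (hX : ∀ w, ‖X w‖ = ‖genField n w‖)
    (hω : ∀ y u w, omega hσ (fderiv ℝ X y u) w + omega hσ u (fderiv ℝ X y w) = 0) :
    ∃ Γ : Gevrey σ θ → C(unitInterval, Gevrey σ θ),
      (∀ z ∈ Metric.ball 0 (S / 2), Γ z ∈ Metric.ball 0 S ∧ IsTrajectory X z (Γ z)) ∧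
        IsCubicSymplecticOn (fun z => Γ z 1) (Metric.ball 0 (S / 2)) := by
  obtain ⟨Γ, hΓ, hΓS⟩ := h.exists_isSmoothFlowOn
  refine ⟨Γ, fun z hz => ⟨hΓS z hz, hΓ.trajectory z hz⟩, ?_, ?_, fun z hz => ?_⟩
  · exact (ContinuousMap.evalCLM ℝ (1 : unitInterval)).contDiff.comp_contDiffOn hΓ.smooth
  · exact isSymplecticOn_timeOne hσ hΓ Metric.isOpen_ball (h.smooth.of_le (by norm_cast)) hω
  · exact norm_timeOne_sub_le hσ hθ hθ1 hS h hX (hΓS z hz) (hΓ.trajectory z hz)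

end TimeOne

lemma polyHamiltonian_timeOne (hσ : 0 < σ) (hθ : 0 < θ) (hθ1 : θ ≤ 1) {n : ℕ} (hn : 1 ≤ n)
    {S : ℝ} (hS : growthRate n * S ^ 2 ≤ 1 / 64) {z : Gevrey σ θ}
    {γ : C(unitInterval, Gevrey σ θ)} (hγS : γ ∈ Metric.ball 0 S)
    (hγ : IsTrajectory (genFieldC hσ.le hθ hθ1 n) z γ) :
    polyHamiltonian (γ 1) = polyEval l2Coef z + famEval (transformed (truncGen n)) z := by
  have hnorm : ∀ t, ‖extendCurve γ t‖ ≤ S := fun t =>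
    (γ.norm_coe_le_norm _).trans (mem_ball_zero_iff.1 hγS).le
  have hflow := polyHamiltonian_flow hσ hθ hθ1 hn hγ.integralCurve fun t _ =>
    hS.trans' (by gcongr; exact hnorm t)
  rw [extendCurve, Set.IccExtend_left, Set.IccExtend_right] at hflow
  rw [← hγ.initial]
  exact hflow

lemma exists_lieTransform (hσ : 0 < σ) (hθ : 0 < θ) (hθ1 : θ ≤ 1) {n : ℕ} (hn : 1 ≤ n) {S : ℝ}
    (hS0 : 0 < S) (hS : growthRate n * S ^ 2 ≤ 1 / 64) :
    ∃ φ₀ φ₁ : Gevrey σ θ → Gevrey σ θ,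
      IsCubicSymplecticOn φ₀ (Metric.ball 0 (S / 2)) ∧
      IsCubicSymplecticOn φ₁ (Metric.ball 0 (S / 2)) ∧
      (∀ z ∈ Metric.ball 0 (S / 2), φ₀ z ∈ Metric.ball 0 (S / 2) → φ₁ (φ₀ z) = z) ∧
      ∀ z ∈ Metric.ball 0 (S / 2),
        polyHamiltonian (φ₁ z) = polyEval l2Coef z + famEval (transformed (truncGen n)) z := by
  have hS' : growthRate n * S ^ 2 ≤ 1 / 8 := hS.trans (by norm_num)
  have hX := smallField_genFieldC hσ.le hθ hθ1 n hS0 hS'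
  have hω := omega_fderiv_genField hσ.le hθ hθ1 n
  obtain ⟨Γ, hΓ, hφ₁⟩ := exists_isCubicSymplecticOn_timeOne hσ.le hθ hθ1 hS' hX (fun _ => rfl) hω
  obtain ⟨Γ', hΓ', hφ₀⟩ := exists_isCubicSymplecticOn_timeOne hσ.le hθ hθ1 hS' hX.neg
    (fun _ => norm_neg _) fun y u w => by
      have hneg : fderiv ℝ (⇑(-genFieldC hσ.le hθ hθ1 n)) y = -fderiv ℝ (genField n) y :=
        fderiv_neg
      simp only [hneg, _root_.neg_apply, map_neg]
      linarith [hω y u w]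
  refine ⟨fun z => Γ' z 1, fun z => Γ z 1, hφ₀, hφ₁, fun z hz hz' => ?_, fun z hz => ?_⟩
  · exact hX.timeOne_neg_then_timeOne (hΓ' z hz).1 (hΓ _ hz').1 (hΓ' z hz).2 (hΓ _ hz').2
  · exact polyHamiltonian_timeOne hσ hθ hθ1 hn hS (hΓ z hz).1 (hΓ z hz).2

lemma eval_normalPoly_two (hσ : 0 ≤ σ) {n : ℕ} (hn : 1 ≤ n) (z : Gevrey σ θ) :
    (normalPoly n 2).eval z = (NLSP.L4 z : ℂ) := by
  rw [eval_normalPoly_succ hσ, transformed_truncGen_one hn, polyEval_resonantPart_quarticCoef hσ]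

lemma sum_polyEval_transformed (hσ : 0 ≤ σ) {n : ℕ} (hn : 1 ≤ n) (z : Gevrey σ θ) :
    ∑ p ∈ Finset.range (n + 1), polyEval (transformed (truncGen n) p) z
      = (NLSP.L4 z : ℂ) + ∑ m ∈ Finset.Icc 3 (n + 1), (normalPoly n m).eval z := by
  have hzero : (normalPoly n 1).eval z = 0 := by
    have htransformed : transformed (truncGen n) 0 = 0 := by
      simp [transformed, firstDeriv_zero (truncGen_zero n), quartic_zero]
    rw [eval_normalPoly_succ hσ, htransformed, polyEval_zero]
  calc _ = ∑ p ∈ Finset.range (n + 1), (normalPoly n (1 + p)).eval z :=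
        Finset.sum_congr rfl fun p _ => by rw [add_comm 1 p, eval_normalPoly_succ hσ]
    _ = ∑ m ∈ Finset.Ico 1 (n + 2), (normalPoly n m).eval z := by
        rw [Finset.sum_Ico_eq_sum_range]
        rfl
    _ = (normalPoly n 2).eval z + ∑ m ∈ Finset.Icc 3 (n + 1), (normalPoly n m).eval z := by
        rw [Finset.sum_eq_sum_Ico_succ_bot (by lia), hzero, zero_add,
          Finset.sum_eq_sum_Ico_succ_bot (by lia)]
        rfl
    _ = _ := by rw [eval_normalPoly_two hσ hn]

lemma hamiltonian_eq_polyHamiltonian (hσ : 0 ≤ σ) (z : Gevrey σ θ) :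
    NLSP.H z = polyHamiltonian z := by
  rw [NLSP.H, polyHamiltonian, polyEval_l2Coef, polyEval_quarticCoef hσ]

lemma contDiff_L2 (hσ : 0 < σ) (hθ : 0 < θ) :
    ContDiff ℝ ∞ fun z : Gevrey σ θ => (NLSP.L2 z : ℂ) := by
  obtain ⟨B, hB⟩ := exists_l2Coef_bound hσ hθ
  simp only [← polyEval_l2Coef]
  exact contDiff_polyEval hB

lemma contDiff_hamiltonian (hσ : 0 < σ) (hθ : 0 < θ) :
    ContDiff ℝ ∞ fun z : Gevrey σ θ => NLSP.H z := by
  simp only [NLSP.H, ← polyEval_quarticCoef hσ.le]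
  exact (contDiff_L2 hσ hθ).add (contDiff_polyEval (weighted_coeff_bound hσ.le norm_quarticCoef_le))

/-- The Hamiltonian `L₂ + L₄ + ∑ K_{2m}` in normal form up to degree `2 (n + 1)`. -/
def normalForm (n : ℕ) (z : Gevrey σ θ) : ℂ :=
  NLSP.L2 z + NLSP.L4 z + ∑ m ∈ Finset.Icc 3 (n + 1), (normalPoly n m).eval z

lemma contDiff_normalForm (hσ : 0 < σ) (hθ : 0 < θ) {n : ℕ} (hn : 1 ≤ n) :
    ContDiff ℝ ∞ (normalForm n : Gevrey σ θ → ℂ) := by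
  unfold normalForm
  simp only [← eval_normalPoly_two hσ.le hn]
  exact ((contDiff_L2 hσ hθ).add (HPoly.contDiff_eval hσ.le _)).add
    (ContDiff.sum fun m _ => HPoly.contDiff_eval hσ.le _)

lemma hamiltonian_eq_normalForm_add_remainder (hσ : 0 ≤ σ) {n : ℕ} (hn : 1 ≤ n) {z w : Gevrey σ θ}
    (hz : growthRate n * ‖z‖ ^ 2 ≤ 1 / 64)
    (hw : polyHamiltonian w = polyEval l2Coef z + famEval (transformed (truncGen n)) z) :
    NLSP.H w = normalForm n z + (remainder n z : ℂ) := by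
  rw [hamiltonian_eq_polyHamiltonian hσ, hw, polyEval_l2Coef, famEval_transformed hσ hn hz,
    sum_polyEval_transformed hσ hn, normalForm]
  ring

lemma contDiffOn_remainder (hσ : 0 < σ) (hθ : 0 < θ) {n : ℕ} (hn : 1 ≤ n) {O : Set (Gevrey σ θ)}
    {φ : Gevrey σ θ → Gevrey σ θ} (hφ : ContDiffOn ℝ ∞ φ O)
    (h : ∀ z ∈ O, NLSP.H (φ z) = normalForm n z + (remainder n z : ℂ)) :
    ContDiffOn ℝ ∞ (remainder n) O := by
  have hdiff : ContDiffOn ℝ ∞ (fun z => (NLSP.H (φ z) - normalForm n z).re) O :=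
    Complex.reCLM.contDiff.comp_contDiffOn
      (((contDiff_hamiltonian hσ hθ).comp_contDiffOn hφ).sub
        (contDiff_normalForm hσ hθ hn).contDiffOn)
  refine hdiff.congr fun z hz => ?_
  rw [h z hz, add_sub_cancel_left, Complex.ofReal_re]

end Gevrey

lemma supNorm_normalPoly_le {n m : ℕ} (hm : 2 ≤ m) (hmn : m ≤ n + 1) :
    (normalPoly n m).supNorm ≤ 256 ^ (2 * m - 3) * (m : ℝ) ^ (2 * (m - 2)) := by
  obtain ⟨q, rfl⟩ : ∃ q, m = q + 1 + 1 := ⟨m - 2, by lia⟩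
  calc _ ≤ (growthRate (q + 1) : ℝ) ^ q := supNorm_normalPoly_succ_le (by lia) (by lia)
    _ = 64 ^ q * ((q + 1 + 1 : ℕ) : ℝ) ^ (2 * q) := by
      rw [coe_growthRate, mul_pow, ← pow_mul, Nat.cast_succ (q + 1)]
    _ ≤ _ := by
      rw [show q + 1 + 1 - 2 = q from rfl]
      gcongr
      calc (64 : ℝ) ^ q ≤ 256 ^ q := by gcongr; norm_num
        _ ≤ _ := pow_le_pow_right₀ (by norm_num) (by lia)

lemma remainder_constant_le (n : ℕ) {t : ℝ} (ht : 0 ≤ t) :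
    104 * (growthRate n : ℝ)⁻¹ * t * (12 * (growthRate n * t ^ 2)) ^ (n + 1)
      ≤ 256 ^ (4 * (n + 1) - 1) * ((n + 1 : ℕ) : ℝ) ^ (2 * (n + 1)) * t ^ (2 * (n + 1) + 1) := by
  have hinv : (growthRate n : ℝ)⁻¹ ≤ 1 := inv_le_one_of_one_le₀ (one_le_growthRate n)
  have hconst : (104 : ℝ) * 768 ^ (n + 1) ≤ 256 ^ (4 * (n + 1) - 1) := by
    calc (104 : ℝ) * 768 ^ (n + 1) ≤ 256 * (256 ^ 2) ^ (n + 1) := by gcongr <;> norm_num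
      _ = 256 ^ (2 * (n + 1) + 1) := by rw [← pow_mul, ← pow_succ']
      _ ≤ _ := pow_le_pow_right₀ (by norm_num) (by lia)
  calc _ ≤ 104 * 1 * t * (12 * (growthRate n * t ^ 2)) ^ (n + 1) := by gcongr
    _ = 104 * 768 ^ (n + 1) * ((n + 1 : ℕ) : ℝ) ^ (2 * (n + 1)) * t ^ (2 * (n + 1) + 1) := by
      rw [coe_growthRate, show 12 * (64 * ((n : ℝ) + 1) ^ 2 * t ^ 2)
        = 768 * ((n : ℝ) + 1) ^ 2 * t ^ 2 by ring, mul_pow, mul_pow, ← pow_mul, ← pow_mul]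
      push_cast
      ring
    _ ≤ _ := by gcongr

lemma radius_conditions {n : ℕ} {ρ : ℝ} (hρ : ρ = 1 / (8 * 256 * ((n + 1 : ℕ) : ℝ))) :
    0 < ρ ∧ 128 * ρ ^ 2 ≤ 1 ∧ growthRate n * (4 * ρ) ^ 2 ≤ 1 / 64 := by
  push_cast at hρ
  have hρ0 : 0 < ρ := by rw [hρ]; positivity
  have hS : growthRate n * (4 * ρ) ^ 2 = 1 / 4096 := by
    rw [coe_growthRate, hρ]
    field_simp
    norm_num
  refine ⟨hρ0, ?_, hS.trans_le (by norm_num)⟩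
  linarith [growthRate_mul_sq_le hS.le]

open Gevrey in
theorem proposition3p1_general :
    ∃ C : ℝ, 2 ^ 8 ≤ C ∧
      ∀ (σ θ : ℝ), 0 < σ → 0 < θ → θ ≤ 1 → ∀ r : ℕ, 2 ≤ r →
      ∀ ρ : ℝ, ρ = 1 / (8 * C * (r : ℝ)) →
      ∃ (φ₀ φ₁ : Gevrey σ θ → Gevrey σ θ) (K : (m : ℕ) → HPoly m) (R : Gevrey σ θ → ℝ),
        ContDiffOn ℝ ∞ φ₀ (Metric.ball 0 ρ) ∧
        ContDiffOn ℝ ∞ φ₁ (Metric.ball 0 (2 * ρ)) ∧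
        Gevrey.IsSymplecticOn φ₀ (Metric.ball 0 ρ) ∧
        Gevrey.IsSymplecticOn φ₁ (Metric.ball 0 (2 * ρ)) ∧
        Set.MapsTo φ₀ (Metric.ball 0 ρ) (Metric.ball 0 (2 * ρ)) ∧
        (∀ z ∈ Metric.ball (0 : Gevrey σ θ) ρ, φ₁ (φ₀ z) = z) ∧
        (∀ z ∈ Metric.ball (0 : Gevrey σ θ) ρ, ‖φ₀ z - z‖ ≤ C ^ 2 * ‖z‖ ^ 3) ∧
        (∀ z ∈ Metric.ball (0 : Gevrey σ θ) (2 * ρ), ‖φ₁ z - z‖ ≤ C ^ 2 * ‖z‖ ^ 3) ∧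
        (∀ z ∈ Metric.ball (0 : Gevrey σ θ) (2 * ρ),
          NLSP.H (φ₁ z) = (NLSP.L2 z : ℂ) + (NLSP.L4 z : ℂ)
            + ∑ m ∈ Finset.Icc 3 r, (K m).eval z + (R z : ℂ)) ∧
        (∀ z : Gevrey σ θ, (K 2).eval z = (NLSP.L4 z : ℂ)) ∧
        (∀ m : ℕ, 2 ≤ m → m ≤ r →
          (K m).IsResonant ∧ (K m).supNorm ≤ C ^ (2 * m - 3) * (m : ℝ) ^ (2 * (m - 2))) ∧
        ContDiffOn ℝ ∞ R (Metric.ball 0 (2 * ρ)) ∧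
        (∀ z ∈ Metric.ball (0 : Gevrey σ θ) (2 * ρ), ∃ X : Gevrey σ θ,
          (∀ a : ℤ, X a = Gevrey.hamVF (fun y => (R y : ℂ)) z a) ∧
          ‖X‖ ≤ C ^ (4 * r - 1) * (r : ℝ) ^ (2 * r) * ‖z‖ ^ (2 * r + 1)) := by
  refine ⟨256, by norm_num, fun σ θ hσ hθ hθ1 r hr ρ hρ => ?_⟩
  obtain ⟨n, rfl⟩ : ∃ n, r = n + 1 := ⟨r - 1, by lia⟩
  have hn : 1 ≤ n := by lia
  obtain ⟨hρ0, hρ1, hS⟩ := radius_conditions hρ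
  obtain ⟨φ₀, φ₁, hφ₀, hφ₁, hinv, hham⟩ :=
    exists_lieTransform (σ := σ) hσ hθ hθ1 hn (S := 4 * ρ) (by positivity) hS
  rw [show 4 * ρ / 2 = 2 * ρ by ring] at hφ₀ hφ₁ hinv hham
  have hsub : Metric.ball (0 : Gevrey σ θ) ρ ⊆ Metric.ball 0 (2 * ρ) :=
    Metric.ball_subset_ball (by linarith)
  replace hφ₀ := hφ₀.mono hsub
  have hmaps := hφ₀.mapsTo_ball hρ1
  have hsmall : ∀ z ∈ Metric.ball (0 : Gevrey σ θ) (2 * ρ), growthRate n * ‖z‖ ^ 2 ≤ 1 / 64 :=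
    fun z hz => hS.trans' (by gcongr; linarith [mem_ball_zero_iff.1 hz])
  have hnormal : ∀ z ∈ Metric.ball (0 : Gevrey σ θ) (2 * ρ),
      NLSP.H (φ₁ z) = normalForm n z + (remainder n z : ℂ) := fun z hz =>
    hamiltonian_eq_normalForm_add_remainder hσ.le hn (hsmall z hz) (hham z hz)
  have hcubic : ∀ z : Gevrey σ θ, 128 * ‖z‖ ^ 3 ≤ 256 ^ 2 * ‖z‖ ^ 3 := fun z => by
    gcongr; norm_num
  exact ⟨φ₀, φ₁, normalPoly n, remainder n, hφ₀.smooth, hφ₁.smooth, hφ₀.symplectic,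
    hφ₁.symplectic, hmaps, fun z hz => hinv z (hsub hz) (hmaps hz),
    fun z hz => (hφ₀.norm_sub_le z hz).trans (hcubic z),
    fun z hz => (hφ₁.norm_sub_le z hz).trans (hcubic z), hnormal, eval_normalPoly_two hσ.le hn,
    fun m hm hmr => ⟨isResonant_normalPoly hmr, supNorm_normalPoly_le hm hmr⟩,
    contDiffOn_remainder hσ hθ hn hφ₁.smooth hnormal, fun z hz => ⟨remainderField n z,
      remainderField_apply hσ.le hn hθ hθ1 hS (Metric.ball_subset_ball (by linarith) hz),
      (norm_remainderField_le hσ.le hn hθ hθ1 (hsmall z hz)).trans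
        (remainder_constant_le n (norm_nonneg z))⟩⟩

theorem proposition3p1 :
    ∃ C : ℝ, 2 ^ 8 ≤ C ∧
      ∀ (σ θ : ℝ), 0 < σ → 0 < θ → θ < 1 → ∀ r : ℕ, 2 ≤ r →
      ∀ ρ : ℝ, ρ = 1 / (8 * C * (r : ℝ)) →
      ∃ (φ₀ φ₁ : Gevrey σ θ → Gevrey σ θ) (K : (m : ℕ) → HPoly m) (R : Gevrey σ θ → ℝ),
        -- smooth symplectic maps
        ContDiffOn ℝ ∞ φ₀ (Metric.ball 0 ρ) ∧
        ContDiffOn ℝ ∞ φ₁ (Metric.ball 0 (2 * ρ)) ∧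
        Gevrey.IsSymplecticOn φ₀ (Metric.ball 0 ρ) ∧
        Gevrey.IsSymplecticOn φ₁ (Metric.ball 0 (2 * ρ)) ∧
        -- commuting diagram
        Set.MapsTo φ₀ (Metric.ball 0 ρ) (Metric.ball 0 (2 * ρ)) ∧
        (∀ z ∈ Metric.ball (0 : Gevrey σ θ) ρ, φ₁ (φ₀ z) = z) ∧
        -- closeness to the identity
        (∀ z ∈ Metric.ball (0 : Gevrey σ θ) ρ, ‖φ₀ z - z‖ ≤ C ^ 2 * ‖z‖ ^ 3) ∧
        (∀ z ∈ Metric.ball (0 : Gevrey σ θ) (2 * ρ), ‖φ₁ z - z‖ ≤ C ^ 2 * ‖z‖ ^ 3) ∧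
        -- normal form decomposition
        (∀ z ∈ Metric.ball (0 : Gevrey σ θ) (2 * ρ),
          NLSP.H (φ₁ z) = (NLSP.L2 z : ℂ) + (NLSP.L4 z : ℂ)
            + ∑ m ∈ Finset.Icc 3 r, (K m).eval z + (R z : ℂ)) ∧
        -- resonant polynomials, the quartic one being `L₄`
        (∀ z : Gevrey σ θ, (K 2).eval z = (NLSP.L4 z : ℂ)) ∧
        (∀ m : ℕ, 2 ≤ m → m ≤ r →
          (K m).IsResonant ∧ (K m).supNorm ≤ C ^ (2 * m - 3) * (m : ℝ) ^ (2 * (m - 2))) ∧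
        -- smooth remainder, whose vector field takes values in the Gevrey space
        ContDiffOn ℝ ∞ R (Metric.ball 0 (2 * ρ)) ∧
        (∀ z ∈ Metric.ball (0 : Gevrey σ θ) (2 * ρ), ∃ X : Gevrey σ θ,
          (∀ a : ℤ, X a = Gevrey.hamVF (fun y => (R y : ℂ)) z a) ∧
          ‖X‖ ≤ C ^ (4 * r - 1) * (r : ℝ) ^ (2 * r) * ‖z‖ ^ (2 * r + 1)) := by
  obtain ⟨C, hC, h⟩ := proposition3p1_general
  exact ⟨C, hC, fun σ θ hσ hθ hθ1 => h σ θ hσ hθ hθ1.le⟩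

end
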